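/- Let $n,m\ge 0$, let $\mathbb D$ be the open unit disk and $\mathbb T$ the unit circle, and let $\Lambda_{n,m}=\{(k,l)\in\mathbb Z^2:0\le k\le n,\ 0\le l\le m\}$, so that $\Lambda_{n,m}-\Lambda_{n,m}=\{(k,l):|k|\le n,|l|\le m\}$. Let complex numbers $c_u$, $u\in\Lambda_{n,m}-\Lambda_{n,m}$, be given. **The filter problem.** An $\mathrm{eAR}(n,m)$ process is a zero-mean (wide sense) stationary process $X=(X_u)_{u\in\mathbb Z^2}$ in $L^2(\Omega,\mathcal A,P)$, for a probability space $(\Omega,\mathcal A,P)$, such that for some complex $a_k$ ($k\in\Lambda_{n,m}$), with $a_{(i,0)}\neq0$ for some $0\le i\le n$, and some zero-mean white noise $(\mathcal E_u)_{u\in\mathbb Z^2}$ of variance $1$, $$\sum_{k\in\Lambda_{n,m}}a_kX_{u-k}=\mathcal E_u\qquad(u\in\mathbb Z^2).$$ The $\mathrm{eAR}(n,m)$ problem for $(c_u)$ asks for such a process with $E(X_0\overline{X_k})=c_k$ for all $k\in\Lambda_{n,m}-\Lambda_{n,m}$. Let $\tilde H=\{(k,l):l>0\}\cup\{(k,0):k>0\}$.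 A solution is *acausal (in $z$)* if $X_u=\sum_{k\in S}\phi_k\mathcal E_{u-k}$ in $L^2$ for all $u$, with $\sum_{k\in S}|\phi_k|<\infty$, where $S=\tilde H\cup\{(0,0),(-1,0),(-2,0),\dots\}$; it is *causal* if the same holds with $S=\tilde H\cup\{(0,0)\}$. **The linear form.** Let $\mathcal L_{n,m}$ be the span of the $z^sw^t$ with $|s|\le n$, $|t|\le m$, and $\mathcal P_{k,l}$ the span of the $z^sw^t$ with $0\le s\le k$, $0\le t\le l$ (zero if $k$ or $l$ is negative). Let $\mathcal T:\mathcal L_{n,m}\to\mathbb C$ be the linear form with $\mathcal T(z^{-u_1}w^{-u_2})=c_u$. It is *positive* if $\mathcal T(f(z,w)\bar f(1/z,1/w))>0$ for all $0\ne f\in\mathcal P_{n,m}$, where $\bar f(z,w)=\overline{f(\bar z,\bar w)}$. If so, $\langle f,g\rangle=\mathcal T(f(z,w)\bar g(1/z,1/w))$ is an inner product on $\mathcal P_{n,m}$; orthogonality, orthogonal complements $\ominus$ and orthogonal projections $P_{\mathcal V}$ refer to it. Put $\mathcal E^1_{k,l}=\mathcal P_{k,l}\ominus w\mathcal P_{k,l-1}$,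 $\mathcal E^2_{k,l}=\mathcal P_{k,l}\ominus z\mathcal P_{k-1,l}$, $\mathcal F^2_{k,l}=\mathcal P_{k,l}\ominus\mathcal P_{k-1,l}$, and, with $M_z$ multiplication by $z$, $$A=P_{w\mathcal E^2_{n,m-1}}M_z:\mathcal E^1_{n-1,m}\to w\mathcal E^2_{n,m-1},\quad B=P_{\mathcal E^1_{n-1,m}}:w\mathcal F^2_{n,m-1}\to\mathcal E^1_{n-1,m},\quad T=P_{\mathcal E^1_{n-1,m}}M_z:\mathcal E^1_{n-1,m}\to\mathcal E^1_{n-1,m}.$$ **Theorem.** There exists an acausal (in $z$) solution to the $\mathrm{eAR}(n,m)$ problem for $(c_u)$ if and only if $\mathcal T$ is positive and satisfies any one of the following conditions (each of them gives a valid equivalence): 1. there is $p\in\mathcal P_{n,m}$ without zeros on $\mathbb T\times\overline{\mathbb D}$ such that $\displaystyle\mathcal T(z^jw^k)=\int_{\mathbb T^2}z^jw^k\,\frac{|dz|\,|dw|}{(2\pi)^2|p(z,w)|^2}$ for $|j|\le n$, $|k|\le m$; 2. there are subspaces $\mathcal K_1,\mathcal K_2\subset\mathcal P_{n,m}$ with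 $\mathcal E^1_{n-1,m}=\mathcal K_1\oplus\mathcal K_2$ (orthogonal sum), $\mathcal K_1\perp z\mathcal K_2$, and $\mathcal K_1,\,z\mathcal K_2\subset\mathcal E^1_{n,m}$; 3. $AT^jB=0$ for $j=0,1,\dots,n-1$; equivalently, the invariant subspace of $T$ generated by the range of $B$ is contained in the kernel of $A$. Moreover, there exists a causal solution to the $\mathrm{eAR}(n,m)$ problem for $(c_u)$ if and only if $\mathcal T$ is positive and $A=0$. -/

import Mathlib

noncomputable section

namespace EAR

open MeasureTheory
open scoped ComplexConjugate Pointwise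

/-! ## Laurent polynomials in two variables -/

/-- Laurent polynomials in `z, w` with complex coefficients. -/
abbrev Laurent : Type := AddMonoidAlgebra ℂ (ℤ × ℤ)

/-- The monomial `z ^ u.1 * w ^ u.2`. -/
def mono (u : ℤ × ℤ) : Laurent := AddMonoidAlgebra.single u 1

/-- The span of the monomials `z ^ s * w ^ t` with `-j ≤ s ≤ j`, `-k ≤ t ≤ k`. -/
def L (j k : ℤ) : Submodule ℂ Laurent := Submodule.span ℂ (mono '' Set.Icc (-j, -k) (j, k))

/-- The polynomials of degree at most `(j, k)`, that is, the span of the monomials `z ^ s * w ^ t`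
with `0 ≤ s ≤ j`, `0 ≤ t ≤ k`. It is `0` if one of `j, k` is negative. -/
def P (j k : ℤ) : Submodule ℂ Laurent := Submodule.span ℂ (mono '' Set.Icc (0, 0) (j, k))

/-- The value of a Laurent polynomial at `(z, w)`. (For `p ∈ P n m` only nonnegative exponents
occur, so that this is also the value of the polynomial `p` at points with `z = 0` or `w = 0`.) -/
def evalAt (p : Laurent) (z w : ℂ) : ℂ := p.coeff.sum fun u a => a * z ^ u.1 * w ^ u.2

/-- `f ↦ conj f (1/z, 1/w)`: conjugate the coefficients, invert the variables. -/
def sharp (f : Laurent) : Laurent :=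
  AddMonoidAlgebra.ofCoeff
    ((f.coeff.mapRange (starRingEnd ℂ) (map_zero _)).equivMapDomain (Equiv.neg (ℤ × ℤ)))

lemma sharp_coeff (f : Laurent) (u : ℤ × ℤ) : (sharp f).coeff u = conj (f.coeff (-u)) := rfl

lemma sharp_zero : sharp 0 = 0 := by
  ext u; simp [sharp_coeff]

lemma sharp_add (f g : Laurent) : sharp (f + g) = sharp f + sharp g := by
  ext u; simp [sharp_coeff]

lemma sharp_smul (a : ℂ) (f : Laurent) : sharp (a • f) = conj a • sharp f := by
  ext u; simp [sharp_coeff]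

lemma sharp_mono (u : ℤ × ℤ) : sharp (mono u) = mono (-u) := by
  ext v
  simp only [sharp_coeff, mono, AddMonoidAlgebra.coeff_single, Finsupp.single_apply]
  by_cases h : u = -v
  · have h' : -u = v := by rw [h, neg_neg]
    simp [h]
  · have h' : ¬ (-u = v) := fun e => h (by rw [← e, neg_neg])
    simp [h, h']

lemma mono_mul (u v : ℤ × ℤ) : mono u * mono v = mono (u + v) := by
  simp [mono, AddMonoidAlgebra.single_mul_single]

lemma mono_mem_L {j k : ℤ} {u : ℤ × ℤ} (hu : u ∈ Set.Icc (-j, -k) (j, k)) : mono u ∈ L j k :=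
  Submodule.subset_span ⟨u, hu, rfl⟩

lemma mul_sharp_mem {j k : ℤ} {f g : Laurent} (hf : f ∈ P j k) (hg : g ∈ P j k) :
    f * sharp g ∈ L j k := by
  induction hf using Submodule.span_induction with
  | zero => simp
  | add x y _ _ hx hy => rw [add_mul]; exact add_mem hx hy
  | smul a x _ hx => rw [smul_mul_assoc]; exact Submodule.smul_mem _ _ hx
  | mem x hx =>
    obtain ⟨u, hu, rfl⟩ := hx
    induction hg using Submodule.span_induction with
    | zero => simp [sharp_zero]
    | add x y _ _ hx hy => rw [sharp_add, mul_add]; exact add_mem hx hy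
    | smul a x _ hx => rw [sharp_smul, mul_smul_comm]; exact Submodule.smul_mem _ _ hx
    | mem x hx =>
      obtain ⟨v, hv, rfl⟩ := hx
      rw [sharp_mono, mono_mul]
      apply mono_mem_L
      simp only [Set.mem_Icc, Prod.le_def, Prod.fst_add, Prod.snd_add, Prod.fst_neg,
        Prod.snd_neg] at *
      omega

/-! ## Linear forms and the Hilbert space of a positive form -/

section Form

variable {n m : ℕ}

/-- `⟨f, g⟩_T = T (f(z, w) * conj g (1/z, 1/w))`, linear in the first argument. -/
def ip (T : L n m →ₗ[ℂ] ℂ) (f g : P n m) : ℂ := T ⟨f.1 * sharp g.1, mul_sharp_mem f.2 g.2⟩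

/-- `T (f(z, w) * conj f (1/z, 1/w)) > 0` (real and positive) for all `0 ≠ f ∈ P n m`. -/
def IsPositive (T : L n m →ₗ[ℂ] ℂ) : Prop :=
  ∀ f : P n m, f ≠ 0 → 0 < (ip T f f).re ∧ (ip T f f).im = 0

lemma ip_add_left (T : L n m →ₗ[ℂ] ℂ) (f g h : P n m) : ip T (f + g) h = ip T f h + ip T g h := by
  simp only [ip, ← map_add]
  congr 1
  ext1
  simp [add_mul]

lemma ip_add_right (T : L n m →ₗ[ℂ] ℂ) (f g h : P n m) :
    ip T f (g + h) = ip T f g + ip T f h := by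
  simp only [ip, ← map_add]
  congr 1
  ext1
  simp [sharp_add, mul_add]

lemma ip_smul_left (T : L n m →ₗ[ℂ] ℂ) (a : ℂ) (f g : P n m) :
    ip T (a • f) g = a * ip T f g := by
  simp only [ip, ← smul_eq_mul, ← map_smul]
  congr 1
  ext1
  simp

lemma ip_smul_right (T : L n m →ₗ[ℂ] ℂ) (a : ℂ) (f g : P n m) :
    ip T f (a • g) = conj a * ip T f g := by
  simp only [ip, ← smul_eq_mul, ← map_smul]
  congr 1
  ext1
  simp [sharp_smul]

lemma ip_self_im {T : L n m →ₗ[ℂ] ℂ} (hT : IsPositive T) (f : P n m) : (ip T f f).im = 0 := by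
  by_cases h : f = 0
  · have h0 := ip_smul_left T 0 f f
    rw [h] at h0 ⊢
    simp only [smul_zero, zero_mul] at h0
    simp [h0]
  · exact (hT f h).2

lemma ip_conj_symm {T : L n m →ₗ[ℂ] ℂ} (hT : IsPositive T) (f g : P n m) :
    conj (ip T f g) = ip T g f := by
  have h1 := ip_self_im hT (f + g)
  have h2 := ip_self_im hT (f + Complex.I • g)
  have hf := ip_self_im hT f
  have hg := ip_self_im hT g
  simp only [ip_add_left, ip_add_right, ip_smul_left, ip_smul_right, Complex.add_im, Complex.add_re,
    Complex.mul_im, Complex.conj_I, Complex.neg_re, Complex.neg_im, Complex.I_re, Complex.I_im,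
    Complex.mul_re] at h1 h2
  apply Complex.ext
  · simp only [Complex.conj_re]; linarith
  · simp only [Complex.conj_im]; linarith

/-- The finite dimensional Hilbert space `H_T`: the space `P n m` with the inner product
`⟨·, ·⟩_T`. -/
def HT (T : L n m →ₗ[ℂ] ℂ) (_hT : IsPositive T) : Type := P n m

variable {T : L n m →ₗ[ℂ] ℂ} (hT : IsPositive T)

instance : AddCommGroup (HT T hT) := inferInstanceAs (AddCommGroup (P n m))

instance : Module ℂ (HT T hT) := inferInstanceAs (Module ℂ (P n m))

/-- Mathlib's inner products are linear in the second argument, hence the swap. -/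
@[reducible] def core : InnerProductSpace.Core ℂ (HT T hT) where
  inner f g := ip T g f
  conj_inner_symm f g := ip_conj_symm hT f g
  re_inner_nonneg f := by
    by_cases h : f = 0
    · subst h
      have h0 := ip_smul_left T 0 (0 : P n m) (0 : P n m)
      simp only [smul_zero, zero_mul] at h0
      exact (congrArg Complex.re h0).ge
    · exact (hT f h).1.le
  add_left f g h := ip_add_right T h f g
  smul_left f g a := ip_smul_right T a g f
  definite f hf := by
    by_contra h
    have h1 := (hT f h).1
    rw [hf] at h1
    simp at h1

instance : NormedAddCommGroup (HT T hT) := (core hT).toNormedAddCommGroup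

instance : InnerProductSpace ℂ (HT T hT) := InnerProductSpace.ofCore (core hT).toCore

instance : FiniteDimensional ℂ (P n m) :=
  FiniteDimensional.span_of_finite ℂ ((Set.finite_Icc _ _).image mono)

instance : FiniteDimensional ℂ (HT T hT) := inferInstanceAs (FiniteDimensional ℂ (P n m))

lemma inner_eq (f g : HT T hT) : inner ℂ f g = ip T g f := rfl

/-- The Laurent polynomial underlying an element of `H_T`. -/
def toLaurent : HT T hT →ₗ[ℂ] Laurent := (P n m).subtype

/-! ### Subspaces of `H_T`

The indices `k, l` are integers with `k ≤ n`, `l ≤ m`; index `-1` gives the zero space. -/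

/-- `P_{k,l}` as a subspace of `H_T`. -/
def polys (k l : ℤ) : Submodule ℂ (HT T hT) := (P k l).comap (toLaurent hT)

/-- `z ^ s.1 * w ^ s.2 * K = {h ∈ H_T | h = z ^ s.1 * w ^ s.2 * f for some f ∈ K}`; it is only used
for `K` such that all these products have degree at most `(n, m)`. -/
def shift (s : ℤ × ℤ) (K : Submodule ℂ (HT T hT)) : Submodule ℂ (HT T hT) :=
  ((K.map (toLaurent hT)).map (LinearMap.mulLeft ℂ (mono s))).comap (toLaurent hT)

/-- `E¹_{k,l} = P_{k,l} ⊖ w P_{k,l-1}`. -/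
def E1 (k l : ℤ) : Submodule ℂ (HT T hT) :=
  polys hT k l ⊓ (shift hT (0, 1) (polys hT k (l - 1)))ᗮ

/-- `E²_{k,l} = P_{k,l} ⊖ z P_{k-1,l}`. -/
def E2 (k l : ℤ) : Submodule ℂ (HT T hT) :=
  polys hT k l ⊓ (shift hT (1, 0) (polys hT (k - 1) l))ᗮ

/-- `F²_{k,l} = P_{k,l} ⊖ P_{k-1,l}`. -/
def F2 (k l : ℤ) : Submodule ℂ (HT T hT) :=
  polys hT k l ⊓ (polys hT (k - 1) l)ᗮ

lemma z_mul_mem {f : Laurent} (hf : f ∈ P ((n : ℤ) - 1) m) : mono (1, 0) * f ∈ P n m := by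
  induction hf using Submodule.span_induction with
  | zero => simp
  | add x y _ _ hx hy => rw [mul_add]; exact add_mem hx hy
  | smul a x _ hx => rw [mul_smul_comm]; exact Submodule.smul_mem _ _ hx
  | mem x hx =>
    obtain ⟨u, hu, rfl⟩ := hx
    rw [mono_mul]
    refine Submodule.subset_span ⟨_, ?_, rfl⟩
    simp only [Set.mem_Icc, Prod.le_def, Prod.fst_add, Prod.snd_add] at *
    omega

/-- Multiplication by `z` on `E¹_{n-1,m} ⊆ P_{n-1,m}`, with values in `H_T`. -/
def mulZ : E1 hT ((n : ℤ) - 1) m →ₗ[ℂ] HT T hT :=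
  LinearMap.codRestrict (P n m)
    (LinearMap.mulLeft ℂ (mono (1, 0)) ∘ₗ toLaurent hT ∘ₗ (E1 hT ((n : ℤ) - 1) m).subtype)
    (fun f => z_mul_mem f.2.1)

/-- `A = P_{w E²_{n,m-1}} M_z : E¹_{n-1,m} → w E²_{n,m-1}`. -/
def opA : E1 hT ((n : ℤ) - 1) m →ₗ[ℂ] shift hT (0, 1) (E2 hT n ((m : ℤ) - 1)) :=
  (shift hT (0, 1) (E2 hT n ((m : ℤ) - 1))).orthogonalProjectionOnto.toLinearMap ∘ₗ mulZ hT

/-- `B = P_{E¹_{n-1,m}} : w F²_{n,m-1} → E¹_{n-1,m}`. -/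
def opB : shift hT (0, 1) (F2 hT n ((m : ℤ) - 1)) →ₗ[ℂ] E1 hT ((n : ℤ) - 1) m :=
  (E1 hT ((n : ℤ) - 1) m).orthogonalProjectionOnto.toLinearMap ∘ₗ
    (shift hT (0, 1) (F2 hT n ((m : ℤ) - 1))).subtype

/-- `T = P_{E¹_{n-1,m}} M_z : E¹_{n-1,m} → E¹_{n-1,m}`. -/
def opT : Module.End ℂ (E1 hT ((n : ℤ) - 1) m) :=
  (E1 hT ((n : ℤ) - 1) m).orthogonalProjectionOnto.toLinearMap ∘ₗ mulZ hT

/-! ### The three conditions -/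

/-- The matrix condition `A T ^ j B = 0` for `j = 0, …, n - 1`. -/
def MatrixCondition : Prop := ∀ j < n, opA hT ∘ₗ (opT hT ^ j) ∘ₗ opB hT = 0

/-- The invariant subspace of `T` generated by the range of `B` is contained in the kernel
of `A`. -/
def InvariantSubspaceCondition : Prop :=
  sInf {W : Submodule ℂ (E1 hT ((n : ℤ) - 1) m) |
    LinearMap.range (opB hT) ≤ W ∧ W ≤ W.comap (opT hT)} ≤ LinearMap.ker (opA hT)

/-- The split-shift orthogonality condition: `E¹_{n-1,m} = K₁ ⊕ K₂` (an orthogonal sum),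
`K₁ ⟂ z K₂`, and `K₁, z K₂ ⊆ E¹_{n,m}`. -/
def SplitShift : Prop :=
  ∃ K₁ K₂ : Submodule ℂ (HT T hT),
    (K₁ ⟂ K₂ ∧ K₁ ⊔ K₂ = E1 hT ((n : ℤ) - 1) m) ∧
    K₁ ⟂ shift hT (1, 0) K₂ ∧
    K₁ ≤ E1 hT n m ∧ shift hT (1, 0) K₂ ≤ E1 hT n m

/-- The point `e ^ (iθ)` of the unit circle. -/
def circ (θ : ℝ) : ℂ := Complex.exp (θ * Complex.I)

/-- The Bernstein-Szegő condition: for some polynomial `p` of degree at most `(n, m)` without zeros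
on `𝕋 × closure 𝔻`, `T (z ^ j * w ^ k)` is the integral of
`z ^ j * w ^ k / |p(z, w)| ^ 2` with respect to normalized Lebesgue measure on `𝕋²`, for all
`|j| ≤ n`, `|k| ≤ m`. -/
def BernsteinSzego (T : L n m →ₗ[ℂ] ℂ) : Prop :=
  ∃ p ∈ P n m, (∀ z w : ℂ, ‖z‖ = 1 → ‖w‖ ≤ 1 → evalAt p z w ≠ 0) ∧
    ∀ (u : ℤ × ℤ) (hu : u ∈ Set.Icc (-(n : ℤ), -(m : ℤ)) (n, m)),
      T ⟨mono u, mono_mem_L hu⟩ =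
        ((2 * Real.pi : ℝ) : ℂ)⁻¹ ^ 2 * ∫ s in (0 : ℝ)..2 * Real.pi, ∫ t in (0 : ℝ)..2 * Real.pi,
          circ s ^ u.1 * circ t ^ u.2 / ((‖evalAt p (circ s) (circ t)‖ ^ 2 : ℝ) : ℂ)

end Form

/-- The linear form on `L_{n,m}` with Fourier coefficients `c`: `T (z ^ (-u)) = c u`. Only the
values of `c` at `u` with `|u.1| ≤ n`, `|u.2| ≤ m` matter. -/
def fourierForm (n m : ℕ) (c : ℤ × ℤ → ℂ) : L n m →ₗ[ℂ] ℂ where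
  toFun f := f.1.coeff.sum fun u a => a * c (-u)
  map_add' f g := by
    simp only [Submodule.coe_add, AddMonoidAlgebra.coeff_add]
    exact Finsupp.sum_add_index' (by simp) (by intros; ring)
  map_smul' a f := by
    simp only [Submodule.coe_smul, AddMonoidAlgebra.coeff_smul]
    rw [Finsupp.sum_smul_index (by simp)]
    simp [Finsupp.sum, Finset.mul_sum, mul_assoc]

lemma fourierForm_mono (n m : ℕ) (c : ℤ × ℤ → ℂ) (u : ℤ × ℤ) (hu : mono (-u) ∈ L n m) :
    fourierForm n m c ⟨mono (-u), hu⟩ = c u := by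
  simp [fourierForm, mono]

/-! ## Extended autoregressive models -/

/-- `Λ_{n,m} = {(k, l) : 0 ≤ k ≤ n, 0 ≤ l ≤ m}`. -/
def Lam (n m : ℕ) : Finset (ℤ × ℤ) := Finset.Icc (0, 0) ((n : ℤ), (m : ℤ))

/-- The half-plane `{(k, l) : l > 0} ∪ {(k, 0) : k > 0}`. -/
def HTilde : Set (ℤ × ℤ) := {k | 0 < k.2} ∪ {k | k.2 = 0 ∧ 0 < k.1}

/-- The index set of causal representations. -/
def causalIndex : Set (ℤ × ℤ) := HTilde ∪ {(0, 0)}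

/-- The index set of representations that are acausal in `z`. -/
def acausalIndex : Set (ℤ × ℤ) := HTilde ∪ {k | k.1 ≤ 0 ∧ k.2 = 0}

section Stochastic

variable {Ω : Type*} [MeasurableSpace Ω] (Pr : Measure Ω)

/-- `E (X Y*)` for square integrable complex random variables. -/
def cov (X Y : Lp ℂ 2 Pr) : ℂ := ∫ ω, X ω * conj (Y ω) ∂Pr

/-- Zero mean wide sense stationary processes on `ℤ²`. -/
def IsStationary (X : ℤ × ℤ → Lp ℂ 2 Pr) : Prop :=
  (∀ u, ∫ ω, X u ω ∂Pr = 0) ∧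
    ∀ k l u, cov Pr (X k) (X l) = cov Pr (X (k + u)) (X (l + u))

/-- Zero mean white noise with variance `1`. -/
def IsWhiteNoise (ε : ℤ × ℤ → Lp ℂ 2 Pr) : Prop :=
  (∀ u, ∫ ω, ε u ω ∂Pr = 0) ∧ ∀ u v, cov Pr (ε u) (ε v) = if u = v then 1 else 0

/-- `X` is an `eAR(n,m)` process with filter coefficients `a` and driving noise `ε`. -/
def IsEAR (n m : ℕ) (a : ℤ × ℤ → ℂ) (X ε : ℤ × ℤ → Lp ℂ 2 Pr) : Prop :=
  IsStationary Pr X ∧ IsWhiteNoise Pr ε ∧ (∃ i : ℤ, 0 ≤ i ∧ i ≤ n ∧ a (i, 0) ≠ 0) ∧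
    ∀ u, ∑ k ∈ Lam n m, a k • X (u - k) = ε u

/-- `X u = ∑_{k ∈ S} φ k • ε (u - k)` for all `u`, with absolutely summable coefficients `φ k`. -/
def HasNoiseExpansion (S : Set (ℤ × ℤ)) (X ε : ℤ × ℤ → Lp ℂ 2 Pr) : Prop :=
  ∃ φ : S → ℂ, (Summable fun k => ‖φ k‖) ∧
    ∀ u, HasSum (fun k : S => φ k • ε (u - (k : ℤ × ℤ))) (X u)

end Stochastic

/-- There are an `eAR(n,m)` model and a solution of it, expanded in its noise over the index set
`S`, with the prescribed autocorrelations `E (X_0 X_k*) = c_k` for `k ∈ Λ_{n,m} - Λ_{n,m}`. -/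
def HasSolution (S : Set (ℤ × ℤ)) (n m : ℕ) (c : ℤ × ℤ → ℂ) : Prop :=
  ∃ (Ω : Type) (_ : MeasurableSpace Ω) (Pr : Measure Ω) (_ : IsProbabilityMeasure Pr)
    (a : ℤ × ℤ → ℂ) (X ε : ℤ × ℤ → Lp ℂ 2 Pr),
    IsEAR Pr n m a X ε ∧ HasNoiseExpansion Pr S X ε ∧
      ∀ k ∈ Lam n m - Lam n m, cov Pr (X 0) (X k) = c k

/-- An acausal (in `z`) solution of the `eAR(n,m)` problem with autocorrelations `c` exists. -/
def HasAcausalSolution (n m : ℕ) (c : ℤ × ℤ → ℂ) : Prop := HasSolution acausalIndex n m c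

/-- A causal solution of the `eAR(n,m)` problem with autocorrelations `c` exists. -/
def HasCausalSolution (n m : ℕ) (c : ℤ × ℤ → ℂ) : Prop := HasSolution causalIndex n m c

end EAR

end

noncomputable section

namespace EAR

open MeasureTheory
open scoped ComplexConjugate Pointwise

/-! ## Coefficients of Laurent polynomials -/

/-! Everything passes through an intermediate notion, `IsFactor`: a polynomial `p` of degree at most
`(n, m)` and a summable sequence `φ` without negative `w`-exponents, such that `φ` is the
convolution inverse of `p` and `c` is its autocorrelation. A process solving the filter problem
yields such a pair, since pairing with the noise recovers its expansion coefficients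
(`exists_isFactor_of_hasSolution`). Conversely, filtering any white noise by `φ` gives a process
(`hasSolution_of_isFactor`).

From a factor to split shifts: convolution with `φ`, which is `f ↦ f / p` on the torus, embeds `H_T`
isometrically into `ℓ²(ℤ²)`. Let `M` be the closed span of the images of `z^i w^j` and `z^i p` for
`i ≥ 0`, `1 ≤ j ≤ m`. It is invariant under `z`. The elements of `P_{n-1,m}` orthogonal to `M` form
`K₁`, and the elements of `E¹_{n-1,m}` inside `M` form `K₂`. The essential point is that the
projection onto `M` keeps polynomials polynomial (`exists_projection`), because coefficients of
large `z`-index are inner products with elements of `M` (`exists_reproducing`). For a causal `φ` one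
gets `K₁ = 0`, hence `A = 0`.

From split shifts to a polynomial: `K₁ ⊕ zK₂` has codimension one in `E¹_{n,m}`, and `p` is a unit
vector of the complement. On a fibre `|z| = 1` the reproducing kernels of `K₂` and `zK₂` coincide,
so the kernels of `E¹_{n,m}` and `E¹_{n-1,m}` differ by the rank one kernel of `p`. Together with
the reversal symmetry this gives a one variable Christoffel-Darboux formula for the kernel of
`E²_{n,m}` on each fibre (`fibreRecursion_of_split`). The formula excludes zeros of `p` on `𝕋 ×
closure 𝔻` (`FibreRecursion.evalAt_ne_zero`) and identifies the inner product of `E²_{n,m}` with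
integration against `1 / |p|²` on every fibre (`FibreRecursion.J_E2`). Splitting off `E²_{n,m}` and
dividing the rest by `z` is a map whose powers tend to zero, and this carries the identity to all of
`H_T` (`FibreRecursion.mean_J`).

The circle closes because the Fourier coefficients of `1 / p` form a factor (`isFactor_recip`). The
operator conditions are a translation of split shifts: `K₂` is the smallest `T`-invariant subspace
containing the range of `B`, and `K₁` is its complement. If `A = 0`, then `K₁ = 0` is admissible,
and a Pythagoras argument shows that `p(z, 0)` has no zeros in the closed disk, which makes the
expansion causal (`evalAt_zero_right_ne_zero`). -/

lemma mono_coeff (u v : ℤ × ℤ) : (mono u).coeff v = if u = v then 1 else 0 := by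
  classical
  simp [mono, Finsupp.single_apply]

lemma mem_span_mono_iff (S : Set (ℤ × ℤ)) (f : Laurent) :
    f ∈ Submodule.span ℂ (mono '' S) ↔ ∀ u ∉ S, f.coeff u = 0 := by
  constructor
  · intro hf u hu
    induction hf using Submodule.span_induction with
    | zero => simp
    | add x y _ _ hx hy => simp [hx, hy]
    | smul a x _ hx => simp [hx]
    | mem x hx =>
      obtain ⟨v, hv, rfl⟩ := hx
      rw [mono_coeff, if_neg]
      rintro rfl
      exact hu hv
  · intro hf
    rw [← AddMonoidAlgebra.sum_coeff_single f]
    refine Submodule.sum_mem _ fun u hu => ?_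
    have hS : u ∈ S := by
      by_contra h
      exact (Finsupp.mem_support_iff.mp hu) (hf u h)
    have : AddMonoidAlgebra.single u (f.coeff u) = f.coeff u • mono u := by
      simp [mono]
    rw [this]
    exact Submodule.smul_mem _ _ (Submodule.subset_span ⟨u, hS, rfl⟩)

lemma mem_P_iff {j k : ℤ} {f : Laurent} :
    f ∈ P j k ↔ ∀ u ∉ Set.Icc ((0 : ℤ), (0 : ℤ)) (j, k), f.coeff u = 0 :=
  mem_span_mono_iff _ _

lemma mono_mem_P {j k : ℤ} {u : ℤ × ℤ} (hu : u ∈ Set.Icc ((0 : ℤ), (0 : ℤ)) (j, k)) :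
    mono u ∈ P j k :=
  Submodule.subset_span ⟨u, hu, rfl⟩

lemma coeff_mono_mul (s : ℤ × ℤ) (f : Laurent) (u : ℤ × ℤ) :
    (mono s * f).coeff u = f.coeff (u - s) := by
  rw [mono, AddMonoidAlgebra.coeff_single_mul_apply]
  simp [sub_eq_neg_add]

lemma sharp_sharp (f : Laurent) : sharp (sharp f) = f := by
  ext u; simp [sharp_coeff]

lemma sharp_mul (f g : Laurent) : sharp (f * g) = sharp f * sharp g := by
  induction f using AddMonoidAlgebra.induction_linear with
  | zero => simp [sharp_zero]
  | add x y hx hy => rw [add_mul, sharp_add, hx, hy, sharp_add, add_mul]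
  | single u a =>
    have : (AddMonoidAlgebra.single u a : Laurent) = a • mono u := by simp [mono]
    rw [this, smul_mul_assoc, sharp_smul, sharp_smul, smul_mul_assoc, sharp_mono]
    congr 1
    ext v
    rw [sharp_coeff, coeff_mono_mul, coeff_mono_mul, sharp_coeff]
    congr 2
    abel

section Form

variable {n m : ℕ} {T : L n m →ₗ[ℂ] ℂ} (hT : IsPositive T)

/-- The coefficient functionals on `H_T`. -/
def cf (u : ℤ × ℤ) : HT T hT →ₗ[ℂ] ℂ where
  toFun f := (toLaurent hT f).coeff u
  map_add' f g := by simp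
  map_smul' a f := by simp

lemma cf_apply (u : ℤ × ℤ) (f : HT T hT) : cf hT u f = (toLaurent hT f).coeff u := rfl

lemma toLaurent_injective : Function.Injective (toLaurent hT) := Subtype.val_injective

lemma toLaurent_mem (f : HT T hT) : toLaurent hT f ∈ P n m := Subtype.property (p := (· ∈ P n m)) f

variable {hT} in
lemma HT_ext {f g : HT T hT} (h : ∀ u, cf hT u f = cf hT u g) : f = g := by
  apply toLaurent_injective hT
  ext u
  exact h u

lemma cf_eq_zero (f : HT T hT) {u : ℤ × ℤ} (hu : u ∉ Set.Icc ((0 : ℤ), (0 : ℤ)) (n, m)) :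
    cf hT u f = 0 := mem_P_iff.mp (toLaurent_mem hT f) u hu

/-- The element of `H_T` given by a polynomial. -/
def ofLaurent (f : Laurent) (hf : f ∈ P n m) : HT T hT := (⟨f, hf⟩ : P n m)

@[simp] lemma toLaurent_ofLaurent (f : Laurent) (hf : f ∈ P n m) :
    toLaurent hT (ofLaurent hT f hf) = f := rfl

/-- Discard all monomials outside of the range of exponents of `H_T`. -/
def trunc : Laurent →ₗ[ℂ] HT T hT where
  toFun f := ofLaurent hT
    (AddMonoidAlgebra.ofCoeff (f.coeff.filter (· ∈ Set.Icc ((0 : ℤ), (0 : ℤ)) (n, m))))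
    (mem_P_iff.mpr fun _ hu => Finsupp.filter_apply_neg _ _ hu)
  map_add' f g := by
    apply toLaurent_injective hT
    rw [map_add]
    ext u
    simp [Finsupp.filter_add]
  map_smul' a f := by
    apply toLaurent_injective hT
    rw [map_smul]
    ext u
    simp [Finsupp.filter_smul]

lemma cf_trunc (f : Laurent) {u : ℤ × ℤ} (hu : u ∈ Set.Icc ((0 : ℤ), (0 : ℤ)) (n, m)) :
    cf hT u (trunc hT f) = f.coeff u := Finsupp.filter_apply_pos _ _ hu

/-- Multiplication by the monomial with exponent `s`, followed by truncation. -/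
def sh (s : ℤ × ℤ) : HT T hT →ₗ[ℂ] HT T hT :=
  trunc hT ∘ₗ LinearMap.mulLeft ℂ (mono s) ∘ₗ toLaurent hT

lemma cf_sh (s : ℤ × ℤ) (f : HT T hT) {u : ℤ × ℤ} (hu : u ∈ Set.Icc ((0 : ℤ), (0 : ℤ)) (n, m)) :
    cf hT u (sh hT s f) = cf hT (u - s) f := by
  rw [sh, LinearMap.comp_apply, cf_trunc hT _ hu]
  exact coeff_mono_mul _ _ _

lemma mem_polys_iff {k l : ℤ} {f : HT T hT} :
    f ∈ polys hT k l ↔ ∀ u ∉ Set.Icc ((0 : ℤ), (0 : ℤ)) (k, l), cf hT u f = 0 := mem_P_iff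

lemma polys_mono {k l k' l' : ℤ} (hk : k ≤ k') (hl : l ≤ l') : polys hT k l ≤ polys hT k' l' := by
  intro f hf
  rw [mem_polys_iff] at hf ⊢
  intro u hu
  apply hf
  simp only [Set.mem_Icc, Prod.le_def] at hu ⊢
  omega

/-- Under these degree bounds the truncation in `sh` discards nothing. -/
lemma toLaurent_sh {s : ℤ × ℤ} {k l : ℤ} (hs : 0 ≤ s.1 ∧ 0 ≤ s.2) (hk : k + s.1 ≤ n)
    (hl : l + s.2 ≤ m) {f : HT T hT} (hf : f ∈ polys hT k l) :
    toLaurent hT (sh hT s f) = mono s * toLaurent hT f := by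
  ext u
  rw [coeff_mono_mul, ← cf_apply, ← cf_apply]
  by_cases hu : u ∈ Set.Icc ((0 : ℤ), (0 : ℤ)) (n, m)
  · rw [cf_sh hT s f hu]
  · rw [cf_eq_zero hT _ hu, (mem_polys_iff hT).mp hf]
    simp only [Set.mem_Icc, Prod.le_def, Prod.fst_sub, Prod.snd_sub] at hu ⊢
    omega

lemma cf_sh_of_mem {s : ℤ × ℤ} {k l : ℤ} (hs : 0 ≤ s.1 ∧ 0 ≤ s.2) (hk : k + s.1 ≤ n)
    (hl : l + s.2 ≤ m) {f : HT T hT} (hf : f ∈ polys hT k l) (u : ℤ × ℤ) :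
    cf hT u (sh hT s f) = cf hT (u - s) f := by
  rw [cf_apply, toLaurent_sh hT hs hk hl hf, coeff_mono_mul, cf_apply]

lemma mem_shift_iff {s : ℤ × ℤ} {K : Submodule ℂ (HT T hT)} {g : HT T hT} :
    g ∈ shift hT s K ↔ ∃ f ∈ K, toLaurent hT g = mono s * toLaurent hT f := by
  simp only [shift, Submodule.mem_comap, Submodule.mem_map, LinearMap.mulLeft_apply]
  constructor
  · rintro ⟨_, ⟨f, hf, rfl⟩, h⟩
    exact ⟨f, hf, h.symm⟩
  · rintro ⟨f, hf, h⟩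
    exact ⟨_, ⟨f, hf, rfl⟩, h.symm⟩

lemma sh_mem_shift {s : ℤ × ℤ} {k l : ℤ} (hs : 0 ≤ s.1 ∧ 0 ≤ s.2) (hk : k + s.1 ≤ n)
    (hl : l + s.2 ≤ m) {K : Submodule ℂ (HT T hT)} (hK : K ≤ polys hT k l) {f : HT T hT}
    (hf : f ∈ K) : sh hT s f ∈ shift hT s K :=
  (mem_shift_iff hT).mpr ⟨f, hf, toLaurent_sh hT hs hk hl (hK hf)⟩

lemma shift_eq_map {s : ℤ × ℤ} {k l : ℤ} (hs : 0 ≤ s.1 ∧ 0 ≤ s.2) (hk : k + s.1 ≤ n)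
    (hl : l + s.2 ≤ m) {K : Submodule ℂ (HT T hT)} (hK : K ≤ polys hT k l) :
    shift hT s K = K.map (sh hT s) := by
  ext g
  rw [mem_shift_iff, Submodule.mem_map]
  constructor
  · rintro ⟨f, hf, h⟩
    refine ⟨f, hf, toLaurent_injective hT ?_⟩
    rw [toLaurent_sh hT hs hk hl (hK hf), h]
  · rintro ⟨f, hf, rfl⟩
    exact ⟨f, hf, toLaurent_sh hT hs hk hl (hK hf)⟩

lemma shift_mono {s : ℤ × ℤ} {K K' : Submodule ℂ (HT T hT)} (h : K ≤ K') :
    shift hT s K ≤ shift hT s K' := by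
  intro g hg
  rw [mem_shift_iff] at hg ⊢
  obtain ⟨f, hf, e⟩ := hg
  exact ⟨f, h hf, e⟩

/-- The form sees a pair only through the product of one member with the reflection of the other.
This is the source of the isometry of monomial shifts and of the antiunitarity of reversal. -/
lemma inner_congr {f g f' g' : HT T hT}
    (h : toLaurent hT g' * sharp (toLaurent hT f') = toLaurent hT g * sharp (toLaurent hT f)) :
    inner ℂ f' g' = inner ℂ f g := by
  rw [inner_eq, inner_eq]
  exact congrArg T (Subtype.ext h)

lemma inner_eq_of_mono_mul {s : ℤ × ℤ} {f g f' g' : HT T hT}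
    (hf : toLaurent hT f' = mono s * toLaurent hT f)
    (hg : toLaurent hT g' = mono s * toLaurent hT g) : inner ℂ f' g' = inner ℂ f g := by
  apply inner_congr
  rw [hf, hg, sharp_mul, sharp_mono, mul_mul_mul_comm, mono_mul, add_neg_cancel]
  simp [mono, ← AddMonoidAlgebra.one_def]

lemma inner_sh {s : ℤ × ℤ} {k l : ℤ} (hs : 0 ≤ s.1 ∧ 0 ≤ s.2) (hk : k + s.1 ≤ n)
    (hl : l + s.2 ≤ m) {f g : HT T hT} (hf : f ∈ polys hT k l) (hg : g ∈ polys hT k l) :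
    inner ℂ (sh hT s f) (sh hT s g) = inner ℂ f g :=
  inner_eq_of_mono_mul hT (toLaurent_sh hT hs hk hl hf) (toLaurent_sh hT hs hk hl hg)

/-- A polynomial is divisible by `w` if it has no terms of degree `0` in `w`. -/
lemma mem_shift_w_iff {k l : ℤ} (hk : k ≤ n) (hl : l ≤ m) {g : HT T hT} :
    g ∈ shift hT (0, 1) (polys hT k (l - 1)) ↔
      g ∈ polys hT k l ∧ ∀ i : ℤ, cf hT (i, 0) g = 0 := by
  rw [mem_shift_iff]
  constructor
  · rintro ⟨f, hf, h⟩
    have hc (u : ℤ × ℤ) : cf hT u g = cf hT (u - (0, 1)) f := by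
      rw [cf_apply, h, coeff_mono_mul, cf_apply]
    rw [mem_polys_iff] at hf ⊢
    refine ⟨fun u hu => ?_, fun i => ?_⟩
    · rw [hc]
      apply hf
      simp only [Set.mem_Icc, Prod.le_def, Prod.fst_sub, Prod.snd_sub] at hu ⊢
      omega
    · rw [hc]
      apply hf
      simp [Prod.le_def]
  · rintro ⟨hg, h0⟩
    refine ⟨sh hT (0, -1) g, ?_, ?_⟩
    · rw [mem_polys_iff] at hg ⊢
      intro u hu
      by_cases hu' : u ∈ Set.Icc ((0 : ℤ), (0 : ℤ)) (n, m)
      · rw [cf_sh hT _ _ hu']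
        apply hg
        simp only [Set.mem_Icc, Prod.le_def, Prod.fst_sub, Prod.snd_sub] at hu hu' ⊢
        omega
      · exact cf_eq_zero hT _ hu'
    · ext u
      rw [coeff_mono_mul, ← cf_apply, ← cf_apply]
      by_cases hu' : u - (0, 1) ∈ Set.Icc ((0 : ℤ), (0 : ℤ)) (n, m)
      · rw [cf_sh hT _ _ hu']
        congr 2
        ext <;> simp
      · rw [cf_eq_zero hT _ hu']
        by_cases h1 : u.2 = 0
        · have := h0 u.1
          rwa [← h1] at this
        · rw [mem_polys_iff] at hg
          apply hg
          simp only [Set.mem_Icc, Prod.le_def, Prod.fst_sub, Prod.snd_sub] at hu' ⊢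
          omega

/-- A polynomial is divisible by `z` if it has no terms of degree `0` in `z`. -/
lemma mem_shift_z_iff {k l : ℤ} (hk : k ≤ n) (hl : l ≤ m) {g : HT T hT} :
    g ∈ shift hT (1, 0) (polys hT (k - 1) l) ↔
      g ∈ polys hT k l ∧ ∀ j : ℤ, cf hT (0, j) g = 0 := by
  rw [mem_shift_iff]
  constructor
  · rintro ⟨f, hf, h⟩
    have hc (u : ℤ × ℤ) : cf hT u g = cf hT (u - (1, 0)) f := by
      rw [cf_apply, h, coeff_mono_mul, cf_apply]
    rw [mem_polys_iff] at hf ⊢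
    refine ⟨fun u hu => ?_, fun i => ?_⟩
    · rw [hc]
      apply hf
      simp only [Set.mem_Icc, Prod.le_def, Prod.fst_sub, Prod.snd_sub] at hu ⊢
      omega
    · rw [hc]
      apply hf
      simp [Prod.le_def]
  · rintro ⟨hg, h0⟩
    refine ⟨sh hT (-1, 0) g, ?_, ?_⟩
    · rw [mem_polys_iff] at hg ⊢
      intro u hu
      by_cases hu' : u ∈ Set.Icc ((0 : ℤ), (0 : ℤ)) (n, m)
      · rw [cf_sh hT _ _ hu']
        apply hg
        simp only [Set.mem_Icc, Prod.le_def, Prod.fst_sub, Prod.snd_sub] at hu hu' ⊢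
        omega
      · exact cf_eq_zero hT _ hu'
    · ext u
      rw [coeff_mono_mul, ← cf_apply, ← cf_apply]
      by_cases hu' : u - (1, 0) ∈ Set.Icc ((0 : ℤ), (0 : ℤ)) (n, m)
      · rw [cf_sh hT _ _ hu']
        congr 2
        ext <;> simp
      · rw [cf_eq_zero hT _ hu']
        by_cases h1 : u.1 = 0
        · have := h0 u.2
          rwa [← h1] at this
        · rw [mem_polys_iff] at hg
          apply hg
          simp only [Set.mem_Icc, Prod.le_def, Prod.fst_sub, Prod.snd_sub] at hu' ⊢
          omega

lemma mem_E1_iff {k l : ℤ} {f : HT T hT} :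
    f ∈ E1 hT k l ↔ f ∈ polys hT k l ∧
      ∀ g ∈ shift hT (0, 1) (polys hT k (l - 1)), inner ℂ g f = 0 := by
  rw [E1, Submodule.mem_inf, Submodule.mem_orthogonal]

lemma mem_E2_iff {k l : ℤ} {f : HT T hT} :
    f ∈ E2 hT k l ↔ f ∈ polys hT k l ∧
      ∀ g ∈ shift hT (1, 0) (polys hT (k - 1) l), inner ℂ g f = 0 := by
  rw [E2, Submodule.mem_inf, Submodule.mem_orthogonal]

/-- An element of `E¹_{k,l}` is determined by its terms of degree `0` in `w`. -/
lemma eq_zero_of_mem_E1 {k l : ℤ} (hk : k ≤ n) (hl : l ≤ m) {f : HT T hT} (hf : f ∈ E1 hT k l)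
    (h : ∀ i : ℤ, cf hT (i, 0) f = 0) : f = 0 := by
  rw [mem_E1_iff] at hf
  exact inner_self_eq_zero.mp (hf.2 f ((mem_shift_w_iff hT hk hl).mpr ⟨hf.1, h⟩))

lemma eq_zero_of_mem_E2 {k l : ℤ} (hk : k ≤ n) (hl : l ≤ m) {f : HT T hT} (hf : f ∈ E2 hT k l)
    (h : ∀ i : ℤ, cf hT (0, i) f = 0) : f = 0 := by
  rw [mem_E2_iff] at hf
  exact inner_self_eq_zero.mp (hf.2 f ((mem_shift_z_iff hT hk hl).mpr ⟨hf.1, h⟩))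

/-- The terms of degree `0` in `w` of an element of `E¹_{k,l}` can be prescribed. -/
lemma exists_mem_E1 {k l : ℤ} (hk : k ≤ n) (hl : l ≤ m) {g : HT T hT} (hg : g ∈ polys hT k l) :
    ∃ f ∈ E1 hT k l, ∀ i : ℤ, cf hT (i, 0) f = cf hT (i, 0) g := by
  -- Subtracting the projection onto the multiples of `w` leaves the terms of degree `0` in `w`
  -- unchanged.
  set W := shift hT (0, 1) (polys hT k (l - 1)) with hW
  have hW' : W.starProjection g ∈ W := W.starProjection_apply_mem g
  have := (mem_shift_w_iff hT hk hl).mp hW'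
  refine ⟨g - W.starProjection g, Submodule.mem_inf.mpr
    ⟨Submodule.sub_mem _ hg this.1, W.sub_starProjection_mem_orthogonal g⟩, fun i => ?_⟩
  rw [map_sub, this.2, sub_zero]

/-- Reading off the row of degree `0` in `w` is a bijection onto `ℂ^d`. The index `d - 1` allows `d
= 0`, so that both `E¹_{n-1,m}` and `E¹_{n,m}` are covered for every `n`. -/
lemma finrank_E1 (d : ℕ) (hd : (d : ℤ) - 1 ≤ n) :
    Module.finrank ℂ (E1 hT ((d : ℤ) - 1) m) = d := by
  let φ : E1 hT ((d : ℤ) - 1) m →ₗ[ℂ] (Fin d → ℂ) :=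
    LinearMap.pi fun i => cf hT ((i : ℕ), 0) ∘ₗ (E1 hT ((d : ℤ) - 1) m).subtype
  have hφ (f) (i : Fin d) : φ f i = cf hT ((i : ℕ), 0) f.1 := rfl
  have h1 : Function.Injective φ := by
    rw [← LinearMap.ker_eq_bot, LinearMap.ker_eq_bot']
    intro f hf
    apply Subtype.ext
    apply eq_zero_of_mem_E1 hT hd le_rfl f.2
    intro i
    by_cases hi : 0 ≤ i ∧ i < d
    · have := congrFun hf ⟨i.toNat, by omega⟩
      rw [hφ] at this
      simpa [hi.1] using this
    · apply (mem_polys_iff hT).mp f.2.1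
      simp only [Set.mem_Icc, Prod.le_def]
      omega
  have h2 : Function.Surjective φ := by
    intro a
    let q : Laurent := ∑ i : Fin d, a i • mono ((i : ℕ), 0)
    have hq : q ∈ P n m := by
      refine Submodule.sum_mem _ fun i _ => Submodule.smul_mem _ _ (mono_mem_P ?_)
      simp only [Set.mem_Icc, Prod.le_def]
      have := i.2
      omega
    have hq' : ofLaurent hT q hq ∈ polys hT ((d : ℤ) - 1) m := by
      change q ∈ P _ _
      refine Submodule.sum_mem _ fun i _ => Submodule.smul_mem _ _ (mono_mem_P ?_)
      simp only [Set.mem_Icc, Prod.le_def]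
      have := i.2
      omega
    obtain ⟨f, hf, e⟩ := exists_mem_E1 hT hd le_rfl hq'
    refine ⟨⟨f, hf⟩, ?_⟩
    ext i
    rw [hφ, e, cf_apply, toLaurent_ofLaurent]
    simp [q, mono_coeff, Finsupp.finsetSum_apply]
    simp [← Fin.ext_iff]
  simpa using (LinearEquiv.ofBijective φ ⟨h1, h2⟩).finrank_eq

/-- An upper bound suffices: `span_kv` supplies `m + 1` independent vectors. -/
lemma finrank_E2_le : Module.finrank ℂ (E2 hT n m) ≤ m + 1 := by
  let φ : E2 hT n m →ₗ[ℂ] (Fin (m + 1) → ℂ) :=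
    LinearMap.pi fun i => cf hT (0, (i : ℕ)) ∘ₗ (E2 hT n m).subtype
  have hφ (f) (i : Fin (m + 1)) : φ f i = cf hT (0, (i : ℕ)) f.1 := rfl
  have h1 : Function.Injective φ := by
    rw [← LinearMap.ker_eq_bot, LinearMap.ker_eq_bot']
    intro f hf
    apply Subtype.ext
    apply eq_zero_of_mem_E2 hT le_rfl le_rfl f.2
    intro i
    by_cases hi : 0 ≤ i ∧ i < m + 1
    · have := congrFun hf ⟨i.toNat, by omega⟩
      rw [hφ] at this
      simpa [hi.1] using this
    · apply (mem_polys_iff hT).mp f.2.1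
      simp only [Set.mem_Icc, Prod.le_def]
      omega
  simpa using LinearMap.finrank_le_finrank_of_injective h1

end Form

end EAR

end

noncomputable section

namespace EAR

open MeasureTheory
open scoped ComplexConjugate Pointwise

/-! ## The three operator conditions -/

section Form

variable {n m : ℕ} {T : L n m →ₗ[ℂ] ℂ} (hT : IsPositive T)

lemma mem_polys_top (f : HT T hT) : f ∈ polys hT n m := toLaurent_mem hT f

lemma E1_le_polys (k l : ℤ) : E1 hT k l ≤ polys hT k l := inf_le_left

lemma coe_mulZ (f : E1 hT ((n : ℤ) - 1) m) : mulZ hT f = sh hT (1, 0) (f : HT T hT) := by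
  apply toLaurent_injective hT
  rw [toLaurent_sh hT (k := (n : ℤ) - 1) (l := m) (by simp) (by simp) (by simp)
    (E1_le_polys hT _ _ f.2)]
  rfl

lemma sub_inf_orthogonal_sup {U V : Submodule ℂ (HT T hT)} (h : U ≤ V) {x : HT T hT} (hx : x ∈ V) :
    ∃ a ∈ V ⊓ Uᗮ, ∃ b ∈ U, x = a + b := by
  have hb := U.starProjection_apply_mem x
  exact ⟨x - U.starProjection x, ⟨V.sub_mem hx (h hb), U.sub_starProjection_mem_orthogonal x⟩, _,
    hb, (sub_add_cancel _ _).symm⟩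

lemma shift_polys_le {k l : ℤ} (hk : k ≤ n) (hl : l ≤ m) :
    shift hT (1, 0) (polys hT (k - 1) l) ≤ polys hT k l :=
  fun _ hg => ((mem_shift_z_iff hT hk hl).mp hg).1

/-- The space `w P_{n,m-1}` is spanned by `w E²_{n,m-1}` and `z w P_{n-1,m-1}`, and `z f` is
orthogonal to the latter because multiplication by `z` is isometric and `f` is in `E¹_{n-1,m}`. Only
the first summand has to be tested, and this is what `A` measures. -/
lemma sh_z_mem_E1_iff {f : HT T hT} (hf : f ∈ E1 hT ((n : ℤ) - 1) m) :
    sh hT (1, 0) f ∈ E1 hT n m ↔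
      ∀ g ∈ shift hT (0, 1) (E2 hT n ((m : ℤ) - 1)), inner ℂ g (sh hT (1, 0) f) = 0 := by
  rw [mem_E1_iff]
  constructor
  · exact fun h g hg => h.2 g (shift_mono hT inf_le_left hg)
  · refine fun h => ⟨mem_polys_top hT _, fun g hg => ?_⟩
    obtain ⟨q, hq, e⟩ := (mem_shift_iff hT).mp hg
    obtain ⟨a, ha, b, hb, rfl⟩ :=
      sub_inf_orthogonal_sup hT (shift_polys_le hT (k := n) (l := (m : ℤ) - 1) le_rfl (by simp)) hq
    have hs : toLaurent hT (sh hT (0, 1) b) = mono (0, 1) * toLaurent hT b :=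
      toLaurent_sh hT (k := n) (l := (m : ℤ) - 1) (by simp) (by simp) (by simp)
        (shift_polys_le hT le_rfl (by simp) hb)
    have ha' : sh hT (0, 1) a ∈ shift hT (0, 1) (E2 hT n ((m : ℤ) - 1)) :=
      sh_mem_shift hT (k := n) (l := (m : ℤ) - 1) (by simp) (by simp) (by simp) inf_le_left ha
    have hg' : g = sh hT (0, 1) a + sh hT (0, 1) b := by
      apply toLaurent_injective hT
      rw [← map_add, e, toLaurent_sh hT (k := n) (l := (m : ℤ) - 1) (by simp) (by simp) (by simp) hq]
    rw [hg', inner_add_left, h _ ha', zero_add]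
    obtain ⟨c, hc, e'⟩ := (mem_shift_iff hT).mp hb
    have hc' : sh hT (0, 1) c ∈ shift hT (0, 1) (polys hT ((n : ℤ) - 1) ((m : ℤ) - 1)) :=
      sh_mem_shift hT (k := (n : ℤ) - 1) (l := (m : ℤ) - 1) (by simp) (by simp) (by simp) le_rfl hc
    rw [← (mem_E1_iff hT).mp hf |>.2 _ hc']
    refine inner_eq_of_mono_mul hT (s := (1, 0)) ?_ ?_
    · rw [hs, e', toLaurent_sh hT (k := (n : ℤ) - 1) (l := (m : ℤ) - 1) (by simp) (by simp)
        (by simp) hc, mul_left_comm]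
    · exact toLaurent_sh hT (k := (n : ℤ) - 1) (l := m) (by simp) (by simp) (by simp)
        (E1_le_polys hT _ _ hf)

/-- Here `w P_{n,m-1}` is split into `w F²_{n,m-1}` and `w P_{n-1,m-1}`, the latter being orthogonal
to `f` already. What remains is orthogonality to the range of `B`. -/
lemma mem_E1_succ_iff {f : HT T hT} (hf : f ∈ E1 hT ((n : ℤ) - 1) m) :
    f ∈ E1 hT n m ↔
      ∀ g ∈ shift hT (0, 1) (F2 hT n ((m : ℤ) - 1)), inner ℂ g f = 0 := by
  rw [mem_E1_iff]
  constructor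
  · exact fun h g hg => h.2 g (shift_mono hT inf_le_left hg)
  · refine fun h => ⟨mem_polys_top hT _, fun g hg => ?_⟩
    obtain ⟨q, hq, e⟩ := (mem_shift_iff hT).mp hg
    obtain ⟨a, ha, b, hb, rfl⟩ :=
      sub_inf_orthogonal_sup hT (polys_mono hT (k := (n : ℤ) - 1) (k' := n) (by simp) le_rfl) hq
    have ha' : sh hT (0, 1) a ∈ shift hT (0, 1) (F2 hT n ((m : ℤ) - 1)) :=
      sh_mem_shift hT (k := n) (l := (m : ℤ) - 1) (by simp) (by simp) (by simp) inf_le_left ha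
    have hb' : sh hT (0, 1) b ∈ shift hT (0, 1) (polys hT ((n : ℤ) - 1) ((m : ℤ) - 1)) :=
      sh_mem_shift hT (k := (n : ℤ) - 1) (l := (m : ℤ) - 1) (by simp) (by simp) (by simp) le_rfl hb
    have hg' : g = sh hT (0, 1) a + sh hT (0, 1) b := by
      apply toLaurent_injective hT
      rw [← map_add, e, toLaurent_sh hT (k := n) (l := (m : ℤ) - 1) (by simp) (by simp) (by simp) hq]
    rw [hg', inner_add_left, h _ ha', zero_add]
    exact ((mem_E1_iff hT).mp hf).2 _ hb'

lemma opA_eq_zero_iff (f : E1 hT ((n : ℤ) - 1) m) :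
    opA hT f = 0 ↔ sh hT (1, 0) (f : HT T hT) ∈ E1 hT n m := by
  rw [sh_z_mem_E1_iff hT f.2, ← coe_mulZ]
  have h : opA hT f = (shift hT (0, 1) (E2 hT n ((m : ℤ) - 1))).orthogonalProjectionOnto
    (mulZ hT f) := rfl
  rw [h, Submodule.orthogonalProjectionOnto_eq_zero_iff, Submodule.mem_orthogonal]

lemma inner_opB (f : E1 hT ((n : ℤ) - 1) m) (g : shift hT (0, 1) (F2 hT n ((m : ℤ) - 1))) :
    inner ℂ f (opB hT g) = inner ℂ (f : HT T hT) (g : HT T hT) :=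
  Submodule.inner_orthogonalProjectionOnto_eq_of_mem_left _ _

lemma inner_opT (f g : E1 hT ((n : ℤ) - 1) m) :
    inner ℂ f (opT hT g) = inner ℂ (f : HT T hT) (sh hT (1, 0) (g : HT T hT)) := by
  rw [← coe_mulZ]
  exact Submodule.inner_orthogonalProjectionOnto_eq_of_mem_left _ _

lemma shift_z_eq_map {K : Submodule ℂ (HT T hT)} (hK : K ≤ E1 hT ((n : ℤ) - 1) m) :
    shift hT (1, 0) K = K.map (sh hT (1, 0)) :=
  shift_eq_map hT (k := (n : ℤ) - 1) (l := m) (by simp) (by simp) (by simp)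
    (hK.trans (E1_le_polys hT _ _))

/-- With `K₂ = W` and `K₁` its complement in `E¹_{n-1,m}`, each requirement matches one property of
`W`: containing the range of `B` gives `K₁ ⊆ E¹_{n,m}`, invariance under `T` gives `K₁ ⟂ z K₂`, and
lying in the kernel of `A` gives `z K₂ ⊆ E¹_{n,m}`. -/
theorem splitShift_of_invariantSubspaceCondition (h : InvariantSubspaceCondition hT) :
    SplitShift hT := by
  set S := {W : Submodule ℂ (E1 hT ((n : ℤ) - 1) m) |
    LinearMap.range (opB hT) ≤ W ∧ W ≤ W.comap (opT hT)} with hS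
  set W := sInf S with hW
  have hB : LinearMap.range (opB hT) ≤ W := le_sInf fun V hV => hV.1
  have hTW : ∀ x ∈ W, opT hT x ∈ W := by
    intro x hx
    rw [hW, Submodule.mem_sInf] at hx ⊢
    exact fun V hV => hV.2 (hx V hV)
  have hle (V : Submodule ℂ (E1 hT ((n : ℤ) - 1) m)) :
      V.map (E1 hT ((n : ℤ) - 1) m).subtype ≤ E1 hT ((n : ℤ) - 1) m := Submodule.map_subtype_le _ _
  refine ⟨Wᗮ.map (E1 hT ((n : ℤ) - 1) m).subtype, W.map (E1 hT ((n : ℤ) - 1) m).subtype,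
    ⟨?_, ?_⟩, ?_, ?_, ?_⟩
  · rw [Submodule.isOrtho_iff_inner_eq]
    rintro _ ⟨x, hx, rfl⟩ _ ⟨y, hy, rfl⟩
    exact (Submodule.coe_inner _ x y).symm.trans (Submodule.inner_left_of_mem_orthogonal hy hx)
  · rw [← Submodule.map_sup, sup_comm, Submodule.sup_orthogonal_of_hasOrthogonalProjection]
    simp
  · rw [shift_z_eq_map hT (hle _), Submodule.isOrtho_iff_inner_eq]
    rintro _ ⟨x, hx, rfl⟩ _ ⟨_, ⟨y, hy, rfl⟩, rfl⟩
    exact (inner_opT hT x y).symm.trans (Submodule.inner_left_of_mem_orthogonal (hTW y hy) hx)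
  · rintro _ ⟨x, hx, rfl⟩
    refine (mem_E1_succ_iff hT x.2).mpr fun g hg => ?_
    have := Submodule.inner_left_of_mem_orthogonal (hB ⟨⟨g, hg⟩, rfl⟩) hx
    rw [inner_opB] at this
    exact inner_eq_zero_symm.mp this
  · rw [shift_z_eq_map hT (hle _)]
    rintro _ ⟨_, ⟨y, hy, rfl⟩, rfl⟩
    exact (opA_eq_zero_iff hT y).mp (h hy)

theorem invariantSubspaceCondition_of_splitShift (h : SplitShift hT) :
    InvariantSubspaceCondition hT := by
  obtain ⟨K₁, K₂, ⟨h1, h2⟩, h3, h4, h5⟩ := h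
  have hK₁ : K₁ ≤ E1 hT ((n : ℤ) - 1) m := h2 ▸ le_sup_left
  have hK₂ : K₂ ≤ E1 hT ((n : ℤ) - 1) m := h2 ▸ le_sup_right
  rw [shift_z_eq_map hT hK₂] at h3 h5
  rw [Submodule.isOrtho_iff_inner_eq] at h1 h3
  -- Inside `E¹_{n-1,m}` the orthogonal complement of `K₁` is contained in `K₂`.
  have key (x : E1 hT ((n : ℤ) - 1) m) (hx : ∀ y : E1 hT ((n : ℤ) - 1) m, y.1 ∈ K₁ →
      inner ℂ y x = 0) : x.1 ∈ K₂ := by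
    have : x.1 ∈ K₁ ⊔ K₂ := h2.symm ▸ x.2
    obtain ⟨a, ha, b, hb, e⟩ := Submodule.mem_sup.mp this
    have h0 := hx ⟨a, hK₁ ha⟩ ha
    rw [Submodule.coe_inner] at h0
    simp only [← e, inner_add_right, h1 a ha b hb, add_zero, inner_self_eq_zero] at h0
    rwa [← e, h0, zero_add]
  refine le_trans (b := K₂.comap (E1 hT ((n : ℤ) - 1) m).subtype)
    (sInf_le (Set.mem_ofPred.mpr ⟨?_, ?_⟩)) ?_
  · rintro _ ⟨g, rfl⟩
    refine key _ fun y hy => ?_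
    rw [inner_opB]
    exact inner_eq_zero_symm.mp ((mem_E1_succ_iff hT y.2).mp (h4 hy) _ g.2)
  · intro x hx
    refine key _ fun y hy => ?_
    rw [inner_opT]
    exact h3 _ hy _ ⟨_, hx, rfl⟩
  · intro x hx
    exact (opA_eq_zero_iff hT x).mpr (h5 ⟨_, hx, rfl⟩)

/-- By Cayley-Hamilton the powers of `T` below `n = dim E¹_{n-1,m}` determine all the others. -/
theorem matrixCondition_iff : MatrixCondition hT ↔ InvariantSubspaceCondition hT := by
  constructor
  · intro h
    have hall (j : ℕ) : opA hT ∘ₗ (opT hT ^ j) ∘ₗ opB hT = 0 := by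
      rw [LinearMap.pow_eq_aeval_mod_charpoly]
      -- For `n = 0` the characteristic polynomial is `1` and a remainder modulo it has no degree
      -- below `0` to speak of, so the zero space is treated apart.
      rcases Nat.eq_zero_or_pos n with hn | hn
      · have h0 : Module.finrank ℂ (E1 hT ((n : ℤ) - 1) m) = 0 := by
          rw [finrank_E1 hT n (by simp), hn]
        have := Module.finrank_zero_iff.mp h0
        ext x
        rw [LinearMap.comp_apply, LinearMap.comp_apply, Subsingleton.elim (opB hT x) 0]
        simp
      · rw [Polynomial.aeval_eq_sum_range' (n := n)]
        · ext x
          simp only [LinearMap.comp_apply, LinearMap.sum_apply, map_sum, LinearMap.smul_apply,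
            map_smul]
          rw [Finset.sum_eq_zero]
          · simp
          · intro i hi
            have := LinearMap.congr_fun (h i (Finset.mem_range.mp hi)) x
            simp only [LinearMap.comp_apply] at this
            rw [this]
            simp
        · have hd : (opT hT).charpoly.natDegree = n := by
            rw [LinearMap.charpoly_natDegree, finrank_E1 hT n (by simp)]
          refine lt_of_lt_of_eq
            (Polynomial.natDegree_modByMonic_lt _ (LinearMap.charpoly_monic _) ?_) hd
          intro h1
          rw [h1] at hd
          simp at hd
          omega
    -- The common kernel of all `A T^j` is `T`-invariant, contains the range of `B`, and lies in the
    -- kernel of `A` by its `j = 0` member.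
    refine le_trans (b := ⨅ j : ℕ, LinearMap.ker (opA hT ∘ₗ (opT hT ^ j)))
      (sInf_le (Set.mem_ofPred.mpr ⟨?_, ?_⟩)) ?_
    · rintro _ ⟨g, rfl⟩
      rw [Submodule.mem_iInf]
      exact fun j => LinearMap.congr_fun (hall j) g
    · intro x hx
      rw [Submodule.mem_comap, Submodule.mem_iInf]
      rw [Submodule.mem_iInf] at hx
      intro j
      have := hx (j + 1)
      rwa [pow_succ] at this
    · exact (iInf_le _ 0).trans (by simp [Module.End.one_eq_id])
  · intro h j _
    ext x : 1
    refine h ?_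
    rw [Submodule.mem_sInf]
    rintro V ⟨h1, h2⟩
    induction j with
    | zero => exact h1 ⟨x, rfl⟩
    | succ j ih =>
      rw [pow_succ']
      exact h2 (ih (by omega))

theorem opA_eq_zero_iff_forall :
    opA hT = 0 ↔ ∀ f ∈ E1 hT ((n : ℤ) - 1) m, sh hT (1, 0) f ∈ E1 hT n m := by
  constructor
  · intro h f hf
    exact (opA_eq_zero_iff hT ⟨f, hf⟩).mp (by rw [h]; rfl)
  · intro h
    ext1 f
    exact (opA_eq_zero_iff hT f).mpr (h f f.2)

end Form

end EAR

end

noncomputable section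

namespace EAR

open MeasureTheory
open scoped ComplexConjugate Pointwise

/-! ## Means over the unit circle -/

/-- The mean of a function over `[0, 2π]`. -/
def mean (F : ℝ → ℂ) : ℂ := ((2 * Real.pi : ℝ) : ℂ)⁻¹ * ∫ t in (0 : ℝ)..2 * Real.pi, F t

lemma continuous_circ : Continuous circ := by
  unfold circ; fun_prop

lemma norm_circ (t : ℝ) : ‖circ t‖ = 1 := Complex.norm_exp_ofReal_mul_I t

lemma circ_ne_zero (t : ℝ) : circ t ≠ 0 := Complex.exp_ne_zero _

lemma conj_circ (t : ℝ) : conj (circ t) = (circ t)⁻¹ := by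
  rw [Complex.inv_def, Complex.normSq_eq_norm_sq, norm_circ]; simp

lemma continuous_circ_zpow (k : ℤ) : Continuous fun t => circ t ^ k :=
  continuous_circ.zpow₀ k fun t => Or.inl (circ_ne_zero t)

lemma circ_eq_circleMap (t : ℝ) : circ t = circleMap 0 1 t := by
  simp [circ, circleMap]

lemma two_pi_ne_zero' : ((2 * Real.pi : ℝ) : ℂ) ≠ 0 :=
  Complex.ofReal_ne_zero.mpr Real.two_pi_pos.ne'

lemma mean_add {F G : ℝ → ℂ} (hF : Continuous F) (hG : Continuous G) :
    mean (fun t => F t + G t) = mean F + mean G := by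
  rw [mean, intervalIntegral.integral_add (hF.intervalIntegrable _ _) (hG.intervalIntegrable _ _),
    mul_add]
  rfl

lemma mean_sub {F G : ℝ → ℂ} (hF : Continuous F) (hG : Continuous G) :
    mean (fun t => F t - G t) = mean F - mean G := by
  rw [mean, intervalIntegral.integral_sub (hF.intervalIntegrable _ _) (hG.intervalIntegrable _ _),
    mul_sub]
  rfl

lemma mean_sum {ι : Type*} (s : Finset ι) {F : ι → ℝ → ℂ} (hF : ∀ i ∈ s, Continuous (F i)) :
    mean (fun t => ∑ i ∈ s, F i t) = ∑ i ∈ s, mean (F i) := by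
  rw [mean, intervalIntegral.integral_finsetSum fun i hi => (hF i hi).intervalIntegrable _ _,
    Finset.mul_sum]
  rfl

lemma mean_const_mul (a : ℂ) (F : ℝ → ℂ) : mean (fun t => a * F t) = a * mean F := by
  rw [mean, intervalIntegral.integral_const_mul, mean, mul_left_comm]

lemma mean_mul_const (a : ℂ) (F : ℝ → ℂ) : mean (fun t => F t * a) = mean F * a := by
  rw [mean, intervalIntegral.integral_mul_const, mean, mul_assoc]

lemma mean_const (a : ℂ) : mean (fun _ => a) = a := by
  rw [mean, intervalIntegral.integral_const, sub_zero, Complex.real_smul,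
    inv_mul_cancel_left₀ two_pi_ne_zero']

lemma mean_conj (F : ℝ → ℂ) : mean (fun t => conj (F t)) = conj (mean F) := by
  rw [mean, mean, map_mul, map_inv₀, Complex.conj_ofReal]
  congr 1
  rw [intervalIntegral.integral_of_le Real.two_pi_pos.le,
    intervalIntegral.integral_of_le Real.two_pi_pos.le, integral_conj]

lemma norm_mean_le {F : ℝ → ℂ} {C : ℝ} (hF : ∀ t, ‖F t‖ ≤ C) : ‖mean F‖ ≤ C := by
  have h := intervalIntegral.norm_integral_le_of_norm_le_const (a := 0) (b := 2 * Real.pi)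
    (f := F) (C := C) fun t _ => hF t
  rw [sub_zero, abs_of_pos Real.two_pi_pos] at h
  rw [mean, norm_mul, norm_inv, Complex.norm_real, Real.norm_of_nonneg Real.two_pi_pos.le]
  rw [inv_mul_le_iff₀ Real.two_pi_pos]
  linarith

lemma mean_eq_circleAverage (f : ℂ → ℂ) :
    mean (fun t => f (circ t)) = Real.circleAverage f 0 1 := by
  rw [mean, Real.circleAverage_def, Complex.real_smul, Complex.ofReal_inv]
  simp_rw [circ_eq_circleMap]

lemma mean_eq_apply_zero {f : ℂ → ℂ} (hf : DiffContOnCl ℂ f (Metric.ball 0 1)) :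
    mean (fun t => f (circ t)) = f 0 := by
  rw [mean_eq_circleAverage]
  exact DiffContOnCl.circleAverage (by simpa using hf)

lemma mean_circ_pow (k : ℕ) (hk : k ≠ 0) : mean (fun t => circ t ^ k) = 0 := by
  have := mean_eq_apply_zero (f := fun w => w ^ k) (differentiable_id.pow k).diffContOnCl
  rw [this, zero_pow hk]

lemma mean_circ_zpow (k : ℤ) : mean (fun t => circ t ^ k) = if k = 0 then 1 else 0 := by
  rcases lt_trichotomy k 0 with h | h | h
  · obtain ⟨j, rfl⟩ : ∃ j : ℕ, k = -j := ⟨k.natAbs, by omega⟩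
    rw [if_neg h.ne]
    have := mean_conj fun t => circ t ^ j
    rw [mean_circ_pow j (by omega), map_zero] at this
    rw [← this]
    congr 1 with t
    rw [map_pow, conj_circ, zpow_neg, zpow_natCast, inv_pow]
  · subst h
    simpa using mean_const 1
  · obtain ⟨j, rfl⟩ : ∃ j : ℕ, k = j := ⟨k.natAbs, by omega⟩
    rw [if_neg h.ne']
    simp_rw [zpow_natCast]
    exact mean_circ_pow j (by omega)

lemma mean_mean (F : ℝ → ℝ → ℂ) :
    ((2 * Real.pi : ℝ) : ℂ)⁻¹ ^ 2 * ∫ s in (0 : ℝ)..2 * Real.pi, ∫ t in (0 : ℝ)..2 * Real.pi,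
      F s t = mean fun s => mean fun t => F s t := by
  simp_rw [mean]
  rw [intervalIntegral.integral_const_mul, sq, mul_assoc]

/-! ## Reproducing kernels of polynomials without zeros on the disk -/

section Kernel

variable {m : ℕ} {a : ℤ → ℂ}

/-- The polynomial with coefficients `a 0, …, a m`. -/
def pol (m : ℕ) (a : ℤ → ℂ) (w : ℂ) : ℂ := ∑ i ∈ Finset.range (m + 1), a i * w ^ i

lemma differentiable_pol : Differentiable ℂ (pol m a) := by
  unfold pol; fun_prop

lemma pol_circ_ne_zero (h : ∀ w : ℂ, ‖w‖ ≤ 1 → pol m a w ≠ 0) (t : ℝ) :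
    pol m a (circ t) ≠ 0 := h _ (norm_circ t).le

lemma continuous_pol_circ : Continuous fun t => pol m a (circ t) :=
  differentiable_pol.continuous.comp continuous_circ

lemma diffContOnCl_div_pol (h : ∀ w : ℂ, ‖w‖ ≤ 1 → pol m a w ≠ 0) {f : ℂ → ℂ}
    (hf : Differentiable ℂ f) : DiffContOnCl ℂ (fun w => f w / pol m a w) (Metric.ball 0 1) := by
  refine DifferentiableOn.diffContOnCl_ball (U := Metric.closedBall 0 1) ?_ subset_rfl
  refine hf.differentiableOn.div differentiable_pol.differentiableOn fun w hw => h w ?_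
  simpa using hw

lemma mean_zpow_div_pol (h : ∀ w : ℂ, ‖w‖ ≤ 1 → pol m a w ≠ 0) {k : ℤ} (hk : 0 < k) :
    mean (fun t => circ t ^ k / pol m a (circ t)) = 0 := by
  obtain ⟨j, rfl⟩ : ∃ j : ℕ, k = j := ⟨k.natAbs, by omega⟩
  have := mean_eq_apply_zero (f := fun w => w ^ j / pol m a w)
    (diffContOnCl_div_pol h (differentiable_id.pow j))
  simp_rw [zpow_natCast]
  rw [this, zero_pow (by omega), zero_div]

lemma continuous_zpow_div_pol (h : ∀ w : ℂ, ‖w‖ ≤ 1 → pol m a w ≠ 0) (k : ℤ) :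
    Continuous fun t => circ t ^ k / pol m a (circ t) :=
  (continuous_circ_zpow k).div continuous_pol_circ (pol_circ_ne_zero h)

/-- The sum reassembles `q` in the numerator of `w^k / q`, where `q` is the polynomial `pol m a`. -/
lemma sum_mul_mean_zpow_div_pol (h : ∀ w : ℂ, ‖w‖ ≤ 1 → pol m a w ≠ 0) (k : ℤ) :
    ∑ j ∈ Finset.range (m + 1), a j * mean (fun t => circ t ^ (k + j) / pol m a (circ t)) =
      if k = 0 then 1 else 0 := by
  simp_rw [← mean_const_mul]
  rw [← mean_sum _ fun j _ => (continuous_zpow_div_pol h _).const_mul _, ← mean_circ_zpow]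
  congr 1 with t
  have h0 := pol_circ_ne_zero h t
  calc ∑ j ∈ Finset.range (m + 1), a j * (circ t ^ (k + j) / pol m a (circ t))
      = pol m a (circ t) * (circ t ^ k / pol m a (circ t)) := by
        rw [pol, Finset.sum_mul]
        refine Finset.sum_congr rfl fun j _ => ?_
        rw [zpow_add₀ (circ_ne_zero t), zpow_natCast]
        ring
    _ = circ t ^ k := mul_div_cancel₀ _ h0

variable {D : ℤ → ℤ → ℂ}

/-- If the coefficients `D i j` of a polynomial kernel satisfy the Christoffel-Darboux recursion
determined by the polynomial `pol m a`, then this is the reproducing kernel of the polynomials of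
degree at most `m` with respect to the weight `1 / |pol m a| ^ 2` on the circle. -/
theorem mean_mul_kernel (h : ∀ w : ℂ, ‖w‖ ≤ 1 → pol m a w ≠ 0)
    (hD0 : ∀ i j, (i ∉ Set.Icc (0 : ℤ) m ∨ j ∉ Set.Icc (0 : ℤ) m) → D i j = 0)
    (ha : ∀ i ∉ Set.Icc (0 : ℤ) m, a i = 0)
    (hD : ∀ i j, D i j - D (i - 1) (j - 1) =
      a i * conj (a j) - conj (a (m - (i - 1))) * a (m - (j - 1)))
    (l i : ℕ) (hl : l ≤ m) (hi : i ≤ m) :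
    mean (fun t => circ t ^ i * conj (pol m (fun r => D r l) (circ t)) /
      (pol m a (circ t) * conj (pol m a (circ t)))) = if i = l then 1 else 0 := by
  have hc (t : ℝ) : circ t ≠ 0 := circ_ne_zero t
  have hq (t : ℝ) := pol_circ_ne_zero h t
  have hq' (t : ℝ) : conj (pol m a (circ t)) ≠ 0 := by simpa using hq t
  have hcont (k : ℤ) : Continuous fun t => circ t ^ k / (pol m a (circ t) *
      conj (pol m a (circ t))) :=
    (continuous_circ_zpow k).div
      (continuous_pol_circ.mul (Complex.continuous_conj.comp continuous_pol_circ))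
      fun t => mul_ne_zero (hq t) (hq' t)
  have hcont2 (k : ℤ) (b : ℤ → ℂ) : Continuous fun t => circ t ^ k * conj (pol m b (circ t)) /
      (pol m a (circ t) * conj (pol m a (circ t))) := by
    simp_rw [mul_div_right_comm]
    exact (hcont k).mul (Complex.continuous_conj.comp continuous_pol_circ)
  -- the recursion for the polynomials `pol m (D · l)`
  have hrec (l : ℤ) (w : ℂ) : pol m (fun r => D r l) w = w * pol m (fun r => D r (l - 1)) w +
      conj (a l) * pol m a w - a (m - (l - 1)) * (w * pol m (fun r => conj (a (m - r))) w) := by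
    have e1 : ∀ b : ℤ → ℂ, b (-1) = 0 → w * pol m b w =
        (∑ r ∈ Finset.range (m + 1), b ((r : ℤ) - 1) * w ^ r) + b m * w ^ (m + 1) := by
      intro b hb
      rw [Finset.sum_range_succ', pol, Finset.sum_range_succ, mul_add, Finset.mul_sum]
      simp only [Nat.cast_add, Nat.cast_one, add_sub_cancel_right, Nat.cast_zero, zero_sub, hb,
        zero_mul, add_zero]
      congr 1
      · exact Finset.sum_congr rfl fun r _ => by ring
      · ring
    rw [e1 (fun r => D r (l - 1)) (hD0 _ _ (Or.inl (by simp))),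
      e1 (fun r => conj (a (m - r))) (by simp [ha])]
    -- The recursion just outside the range of indices gives `D m (l - 1) = conj (a 0) * a (m - (l -
    -- 1))`. This cancels the terms in `w ^ (m + 1)`.
    have e2 := hD (m + 1) l
    rw [hD0 _ _ (Or.inl (by simp)), ha (m + 1) (by simp)] at e2
    simp only [add_sub_cancel_right, sub_self] at e2 ⊢
    have e3 : pol m (fun r => D r l) w = ∑ r ∈ Finset.range (m + 1),
        (D ((r : ℤ) - 1) (l - 1) * w ^ r + conj (a l) * (a r * w ^ r) -
          a (m - (l - 1)) * (conj (a (m - ((r : ℤ) - 1))) * w ^ r)) := by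
      refine Finset.sum_congr rfl fun r _ => ?_
      have := hD r l
      linear_combination (w ^ r) * this
    rw [e3, Finset.sum_sub_distrib, Finset.sum_add_distrib, ← Finset.mul_sum, ← Finset.mul_sum, pol]
    linear_combination (w ^ (m + 1)) * e2
  -- On the circle the conjugate of the reversed polynomial is `w^{-m} q`. In the quotient by `|q|²`
  -- the last term of the recursion therefore becomes a negative power of `w` over `conj q`, which
  -- has mean zero.
  have hrev (t : ℝ) : conj (pol m (fun r => conj (a (m - r))) (circ t)) =
      circ t ^ (-(m : ℤ)) * pol m a (circ t) := by
    simp only [pol, map_sum, map_mul, Complex.conj_conj, map_pow, conj_circ]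
    rw [← Finset.sum_range_reflect, Finset.mul_sum]
    refine Finset.sum_congr rfl fun r hr => ?_
    have hr' : r ≤ m := by simpa [Nat.lt_succ_iff] using hr
    rw [show m + 1 - 1 - r = m - r by omega, Nat.cast_sub hr', sub_sub_cancel, mul_left_comm,
      ← zpow_natCast, ← zpow_natCast, Nat.cast_sub hr', inv_zpow', ← zpow_add₀ (hc t)]
    congr 2
    ring
  have hzero (k : ℤ) (hk : k < 0) :
      mean (fun t => circ t ^ k / conj (pol m a (circ t))) = 0 := by
    have := mean_conj fun t => circ t ^ (-k) / pol m a (circ t)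
    rw [mean_zpow_div_pol h (by omega), map_zero] at this
    rw [← this]
    congr 1 with t
    rw [map_div₀, map_zpow₀, conj_circ, inv_zpow', neg_neg]
  -- The parameter `s` counts the factors `w` released while descending in `l`. The bound `i - s ≤
  -- m` keeps the exponent `i - (s + 1) - m` of the vanishing term negative.
  have key (l : ℕ) : ∀ s : ℤ, i - s ≤ m →
      mean (fun t => circ t ^ (i - s) * conj (pol m (fun r => D r l) (circ t)) /
        (pol m a (circ t) * conj (pol m a (circ t)))) =
      ∑ j ∈ Finset.range (l + 1),
        a j * mean (fun t => circ t ^ (i - s - l + j) / pol m a (circ t)) := by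
    have hstep (l s : ℤ) (hs : i - s ≤ m) :
        mean (fun t => circ t ^ (i - s) * conj (pol m (fun r => D r l) (circ t)) /
        (pol m a (circ t) * conj (pol m a (circ t)))) =
        mean (fun t => circ t ^ (i - (s + 1)) * conj (pol m (fun r => D r (l - 1)) (circ t)) /
        (pol m a (circ t) * conj (pol m a (circ t)))) +
        a l * mean (fun t => circ t ^ (i - s) / pol m a (circ t)) := by
      have e : ∀ t, circ t ^ (i - s) * conj (pol m (fun r => D r l) (circ t)) /
          (pol m a (circ t) * conj (pol m a (circ t))) =
          circ t ^ (i - (s + 1)) * conj (pol m (fun r => D r (l - 1)) (circ t)) /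
          (pol m a (circ t) * conj (pol m a (circ t))) +
          a l * (circ t ^ (i - s) / pol m a (circ t)) -
          conj (a (m - (l - 1))) * (circ t ^ (i - (s + 1) - m) / conj (pol m a (circ t))) := by
        intro t
        rw [hrec l]
        simp only [map_add, map_sub, map_mul, hrev, conj_circ, Complex.conj_conj]
        rw [show (i : ℤ) - (s + 1) - m = (i - s) + (-1) + -m by ring,
          show (i : ℤ) - (s + 1) = (i - s) + (-1) by ring, zpow_add₀ (hc t) (i - s + -1),
          zpow_add₀ (hc t) (i - s), zpow_neg_one]
        have := hc t
        have := hq t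
        have := hq' t
        field_simp
      simp_rw [e]
      have hcont3 : Continuous fun t => circ t ^ (i - (s + 1) - m) / conj (pol m a (circ t)) :=
        (continuous_circ_zpow _).div (Complex.continuous_conj.comp continuous_pol_circ) hq'
      have hcont4 : Continuous fun t =>
          circ t ^ (i - (s + 1)) * conj (pol m (fun r => D r (l - 1)) (circ t)) /
          (pol m a (circ t) * conj (pol m a (circ t))) +
          a l * (circ t ^ (i - s) / pol m a (circ t)) :=
        (hcont2 _ _).add ((continuous_zpow_div_pol h _).const_mul _)
      rw [mean_sub hcont4 (hcont3.const_mul _), mean_add (hcont2 _ _) ((continuous_zpow_div_pol h _).const_mul _),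
        mean_const_mul, mean_const_mul, hzero _ (by omega), mul_zero, sub_zero]
    induction l with
    | zero =>
      intro s hs
      rw [hstep _ s hs]
      have : ∀ t, pol m (fun r => D r (((0 : ℕ) : ℤ) - 1)) (circ t) = 0 := by
        intro t
        refine Finset.sum_eq_zero fun r _ => ?_
        simp [hD0 r (-1) (Or.inr (by simp))]
      simp_rw [this]
      simp [mean_const]
    | succ l ih =>
      intro s hs
      rw [hstep _ s hs]
      have := ih (s + 1) (by omega)
      rw [show (((l + 1 : ℕ) : ℤ) - 1) = l by push_cast; ring, this, Finset.sum_range_succ _ (l + 1)]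
      push_cast
      congr 1
      · refine Finset.sum_congr rfl fun j _ => ?_
        congr 4 with t
        ring_nf
      · congr 4 with t
        ring_nf
  have h1 := key l 0 (by simpa using hi)
  simp only [sub_zero, zpow_natCast] at h1
  rw [h1]
  have h2 := sum_mul_mean_zpow_div_pol h ((i : ℤ) - l)
  simp only [sub_eq_zero, Nat.cast_inj] at h2
  rw [← h2]
  -- The sum may be extended to `j ≤ m`: for `j > l` the exponent `i - l + j` is positive, so these
  -- means vanish.
  refine Finset.sum_subset (by simpa using hl) fun j _ hj => ?_
  rw [mean_zpow_div_pol h, mul_zero]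
  simp at hj
  omega

end Kernel

end EAR

end

noncomputable section

namespace EAR

open MeasureTheory
open scoped ComplexConjugate Pointwise

/-! ## Evaluation of Laurent polynomials -/

lemma laurent_induction {motive : Laurent → Prop} (f : Laurent) (mono : ∀ u, motive (mono u))
    (add : ∀ f g, motive f → motive g → motive (f + g))
    (smul : ∀ (a : ℂ) f, motive f → motive (a • f)) : motive f := by
  induction f using AddMonoidAlgebra.induction_linear with
  | zero => simpa using smul 0 _ (mono 0)
  | add x y hx hy => exact add x y hx hy
  | single u a =>
    have : (AddMonoidAlgebra.single u a : Laurent) = a • EAR.mono u := by simp [EAR.mono]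
    rw [this]
    exact smul a _ (mono u)

/-- The linear map on Laurent polynomials with prescribed values on monomials. -/
def liftMono (g : ℤ × ℤ → ℂ) : Laurent →ₗ[ℂ] ℂ :=
  Finsupp.linearCombination ℂ g ∘ₗ (AddMonoidAlgebra.coeffLinearEquiv ℂ).toLinearMap

lemma liftMono_mono (g : ℤ × ℤ → ℂ) (u : ℤ × ℤ) : liftMono g (mono u) = g u := by
  simp [liftMono, mono]

lemma liftMono_apply (g : ℤ × ℤ → ℂ) (f : Laurent) :
    liftMono g f = f.coeff.sum fun u a => a * g u := rfl

/-- The coefficient of `w ^ i` in `f(z, w)`. -/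
def rowEval (z : ℂ) (i : ℤ) : Laurent →ₗ[ℂ] ℂ := liftMono fun u => if u.2 = i then z ^ u.1 else 0

lemma rowEval_mono (z : ℂ) (i : ℤ) (u : ℤ × ℤ) :
    rowEval z i (mono u) = if u.2 = i then z ^ u.1 else 0 := liftMono_mono _ _

lemma rowEval_mono_mul {z : ℂ} (hz : z ≠ 0) (i : ℤ) (s : ℤ × ℤ) (f : Laurent) :
    rowEval z i (mono s * f) = z ^ s.1 * rowEval z (i - s.2) f := by
  induction f using laurent_induction with
  | mono u =>
    rw [mono_mul, rowEval_mono, rowEval_mono, Prod.snd_add, Prod.fst_add, zpow_add₀ hz, mul_ite,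
      mul_zero]
    simp only [eq_sub_iff_add_eq']
  | add f g hf hg => rw [mul_add, map_add, hf, hg, map_add, mul_add]
  | smul a f hf => rw [mul_smul_comm, map_smul, hf, map_smul, smul_eq_mul, smul_eq_mul,
      mul_left_comm]

lemma conj_zpow_of_norm_one {z : ℂ} (hz : ‖z‖ = 1) (k : ℤ) : conj (z ^ k) = z ^ (-k) := by
  rw [map_zpow₀, zpow_neg, ← inv_zpow, Complex.inv_def, Complex.normSq_eq_norm_sq, hz]
  simp

lemma rowEval_sharp {z : ℂ} (hz : ‖z‖ = 1) (i : ℤ) (f : Laurent) :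
    rowEval z i (sharp f) = conj (rowEval z (-i) f) := by
  induction f using laurent_induction with
  | mono u =>
    rw [sharp_mono, rowEval_mono, rowEval_mono, Prod.snd_neg, Prod.fst_neg, apply_ite conj,
      conj_zpow_of_norm_one hz, map_zero]
    simp only [neg_eq_iff_eq_neg]
  | add f g hf hg => rw [sharp_add, map_add, hf, hg, map_add, map_add]
  | smul a f hf => rw [sharp_smul, map_smul, hf, map_smul, smul_eq_mul, smul_eq_mul, map_mul]

lemma evalAt_eq_liftMono (f : Laurent) (z w : ℂ) :
    evalAt f z w = liftMono (fun u => z ^ u.1 * w ^ u.2) f := by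
  simp only [evalAt, liftMono_apply, mul_assoc]

lemma evalAt_mono (u : ℤ × ℤ) (z w : ℂ) : evalAt (mono u) z w = z ^ u.1 * w ^ u.2 := by
  rw [evalAt_eq_liftMono, liftMono_mono]

lemma evalAt_add (f g : Laurent) (z w : ℂ) : evalAt (f + g) z w = evalAt f z w + evalAt g z w := by
  simp only [evalAt_eq_liftMono, map_add]

lemma evalAt_smul (a : ℂ) (f : Laurent) (z w : ℂ) : evalAt (a • f) z w = a * evalAt f z w := by
  simp only [evalAt_eq_liftMono, map_smul, smul_eq_mul]

lemma evalAt_mul {z w : ℂ} (hz : z ≠ 0) (hw : w ≠ 0) (f g : Laurent) :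
    evalAt (f * g) z w = evalAt f z w * evalAt g z w := by
  induction f using laurent_induction with
  | mono u =>
    induction g using laurent_induction with
    | mono v =>
      rw [mono_mul, evalAt_mono, evalAt_mono, evalAt_mono, Prod.fst_add, Prod.snd_add,
        zpow_add₀ hz, zpow_add₀ hw]
      ring
    | add f g hf hg => rw [mul_add, evalAt_add, hf, hg, evalAt_add, mul_add]
    | smul a f hf => rw [mul_smul_comm, evalAt_smul, hf, evalAt_smul, mul_left_comm]
  | add f g hf hg => rw [add_mul, evalAt_add, hf, hg, evalAt_add, add_mul]
  | smul a f hf => rw [smul_mul_assoc, evalAt_smul, hf, evalAt_smul, mul_assoc]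

lemma evalAt_z_mul {z : ℂ} (hz : z ≠ 0) (w : ℂ) (k : ℤ) (f : Laurent) :
    evalAt (mono (k, 0) * f) z w = z ^ k * evalAt f z w := by
  induction f using laurent_induction with
  | mono u => rw [mono_mul, evalAt_mono, evalAt_mono, Prod.fst_add, Prod.snd_add, zpow_add₀ hz,
      zero_add, mul_assoc]
  | add f g hf hg => rw [mul_add, evalAt_add, hf, hg, evalAt_add, mul_add]
  | smul a f hf => rw [mul_smul_comm, evalAt_smul, hf, evalAt_smul, mul_left_comm]

lemma evalAt_sharp {z w : ℂ} (hz : ‖z‖ = 1) (hw : ‖w‖ = 1) (f : Laurent) :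
    evalAt (sharp f) z w = conj (evalAt f z w) := by
  induction f using laurent_induction with
  | mono u => rw [sharp_mono, evalAt_mono, evalAt_mono, map_mul, conj_zpow_of_norm_one hz,
      conj_zpow_of_norm_one hw]; rfl
  | add f g hf hg => rw [sharp_add, evalAt_add, hf, hg, evalAt_add, map_add]
  | smul a f hf => rw [sharp_smul, evalAt_smul, hf, evalAt_smul, map_mul]

lemma evalAt_eq_pol {j : ℤ} {m : ℕ} {f : Laurent} (hf : f ∈ P j m) (z w : ℂ) :
    evalAt f z w = pol m (fun i => rowEval z i f) w := by
  induction hf using Submodule.span_induction with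
  | zero => simp [evalAt_eq_liftMono, pol]
  | add x y _ _ hx hy =>
    rw [evalAt_add, hx, hy]
    simp only [pol, map_add, add_mul, Finset.sum_add_distrib]
  | smul a x _ hx =>
    rw [evalAt_smul, hx]
    simp only [pol, map_smul, smul_eq_mul, Finset.mul_sum, mul_assoc]
  | mem x hx =>
    obtain ⟨u, hu, rfl⟩ := hx
    simp only [Set.mem_Icc, Prod.le_def] at hu
    obtain ⟨k, hk⟩ : ∃ k : ℕ, u.2 = k := ⟨u.2.toNat, by omega⟩
    rw [evalAt_mono, pol, Finset.sum_eq_single k]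
    · rw [rowEval_mono, if_pos hk, hk, zpow_natCast]
    · intro i _ hi
      rw [rowEval_mono, if_neg, zero_mul]
      rw [hk]
      exact_mod_cast hi.symm
    · intro h
      simp at h
      omega

lemma rowEval_eq_zero {j k : ℤ} {f : Laurent} (hf : f ∈ P j k) (z : ℂ) {i : ℤ}
    (hi : i ∉ Set.Icc 0 k) : rowEval z i f = 0 := by
  induction hf using Submodule.span_induction with
  | zero => simp
  | add x y _ _ hx hy => rw [map_add, hx, hy, add_zero]
  | smul a x _ hx => rw [map_smul, hx, smul_zero]
  | mem x hx =>
    obtain ⟨u, hu, rfl⟩ := hx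
    rw [rowEval_mono, if_neg]
    rintro rfl
    exact hi ⟨hu.1.2, hu.2.2⟩

/-! ## Kernels of subspaces of `H_T` along a fibre -/

section Form

variable {n m : ℕ} {T : L n m →ₗ[ℂ] ℂ} (hT : IsPositive T)

instance : CompleteSpace (HT T hT) := FiniteDimensional.complete ℂ _

/-- The coefficient of `w ^ i` in `f(z, w)`, as a functional on `H_T`. -/
def lam (z : ℂ) (i : ℤ) : HT T hT →ₗ[ℂ] ℂ := rowEval z i ∘ₗ toLaurent hT

lemma lam_apply (z : ℂ) (i : ℤ) (f : HT T hT) : lam hT z i f = rowEval z i (toLaurent hT f) := rfl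

lemma lam_eq_zero (z : ℂ) {i : ℤ} (hi : i ∉ Set.Icc (0 : ℤ) m) : lam hT z i = 0 := by
  ext f
  exact rowEval_eq_zero (toLaurent_mem hT f) z hi

/-- The vector of `V` which represents the restriction of the functional `η` to `V`. -/
def kv (V : Submodule ℂ (HT T hT)) (η : HT T hT →ₗ[ℂ] ℂ) : HT T hT :=
  V.starProjection ((InnerProductSpace.toDual ℂ (HT T hT)).symm η.toContinuousLinearMap)

lemma kv_mem (V : Submodule ℂ (HT T hT)) (η : HT T hT →ₗ[ℂ] ℂ) : kv hT V η ∈ V :=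
  V.starProjection_apply_mem _

lemma inner_kv {V : Submodule ℂ (HT T hT)} (η : HT T hT →ₗ[ℂ] ℂ) {f : HT T hT} (hf : f ∈ V) :
    inner ℂ (kv hT V η) f = η f := by
  rw [kv, Submodule.inner_starProjection_left_eq_right, Submodule.starProjection_eq_self_iff.mpr hf,
    InnerProductSpace.toDual_symm_apply]
  rfl

lemma kv_eq {V : Submodule ℂ (HT T hT)} {η : HT T hT →ₗ[ℂ] ℂ} {x : HT T hT} (hx : x ∈ V)
    (h : ∀ f ∈ V, inner ℂ x f = η f) : kv hT V η = x := by
  rw [← sub_eq_zero, ← inner_self_eq_zero (𝕜 := ℂ)]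
  have hd : kv hT V η - x ∈ V := V.sub_mem (kv_mem hT V η) hx
  nth_rw 1 [inner_sub_left, inner_kv hT η hd, h _ hd, sub_self]

/-- The coefficients of the reproducing kernel of `V`, restricted to the fibre over `z`. -/
def D (z : ℂ) (V : Submodule ℂ (HT T hT)) (i j : ℤ) : ℂ := lam hT z i (kv hT V (lam hT z j))

lemma D_eq_zero (z : ℂ) (V : Submodule ℂ (HT T hT)) {i j : ℤ}
    (h : i ∉ Set.Icc (0 : ℤ) m ∨ j ∉ Set.Icc (0 : ℤ) m) : D hT z V i j = 0 := by
  rcases h with h | h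
  · rw [D, lam_eq_zero hT z h, LinearMap.zero_apply]
  · rw [D, lam_eq_zero hT z h, kv_eq hT (x := 0) V.zero_mem (by simp), map_zero]

/-- The representing vectors of a functional add over an orthogonal sum. -/
lemma D_sup (z : ℂ) {V W : Submodule ℂ (HT T hT)} (h : V ⟂ W) (i j : ℤ) :
    D hT z (V ⊔ W) i j = D hT z V i j + D hT z W i j := by
  rw [D, kv_eq hT (x := kv hT V (lam hT z j) + kv hT W (lam hT z j)), map_add]
  · rfl
  · exact Submodule.add_mem_sup (kv_mem hT _ _) (kv_mem hT _ _)
  · intro f hf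
    obtain ⟨a, ha, b, hb, rfl⟩ := Submodule.mem_sup.mp hf
    rw [Submodule.isOrtho_iff_inner_eq] at h
    rw [inner_add_left, inner_add_right, inner_add_right, inner_kv hT _ ha, inner_kv hT _ hb,
      h _ (kv_mem hT _ _) _ hb, inner_eq_zero_symm.mp (h _ ha _ (kv_mem hT _ _)), map_add,
      zero_add, add_zero]

lemma D_span_singleton (z : ℂ) {p : HT T hT} (hp : inner ℂ p p = (1 : ℂ)) (i j : ℤ) :
    D hT z (Submodule.span ℂ {p}) i j = lam hT z i p * conj (lam hT z j p) := by
  rw [D, kv_eq hT (x := conj (lam hT z j p) • p), map_smul, smul_eq_mul, mul_comm]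
  · exact Submodule.smul_mem _ _ (Submodule.mem_span_singleton_self p)
  · intro f hf
    obtain ⟨c, rfl⟩ := Submodule.mem_span_singleton.mp hf
    rw [inner_smul_left, inner_smul_right, hp, Complex.conj_conj, map_smul, smul_eq_mul, mul_one,
      mul_comm]

/-- A factor `z^{s.1}` enters once directly and once conjugated, so on `|z| = 1` it cancels and only
the shift in `w` is visible. In particular multiplication by `z` does not change the fibre kernel.
-/
lemma D_shift {z : ℂ} (hz : ‖z‖ = 1) {s : ℤ × ℤ} {k l : ℤ} (hs : 0 ≤ s.1 ∧ 0 ≤ s.2)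
    (hk : k + s.1 ≤ n) (hl : l + s.2 ≤ m) {V : Submodule ℂ (HT T hT)} (hV : V ≤ polys hT k l)
    (i j : ℤ) : D hT z (shift hT s V) i j = D hT z V (i - s.2) (j - s.2) := by
  have hz0 : z ≠ 0 := by rintro rfl; simp at hz
  have hlam (i : ℤ) {f : HT T hT} (hf : f ∈ V) :
      lam hT z i (sh hT s f) = z ^ s.1 * lam hT z (i - s.2) f := by
    rw [lam_apply, toLaurent_sh hT hs hk hl (hV hf), rowEval_mono_mul hz0, lam_apply]
  have hm := kv_mem hT V (lam hT z (j - s.2))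
  rw [D, kv_eq hT (x := conj (z ^ s.1) • sh hT s (kv hT V (lam hT z (j - s.2)))), map_smul,
    hlam _ hm, smul_eq_mul, ← mul_assoc, conj_zpow_of_norm_one hz, ← zpow_add₀ hz0,
    neg_add_cancel, zpow_zero, one_mul]
  · rfl
  · exact Submodule.smul_mem _ _ (sh_mem_shift hT hs hk hl hV hm)
  · rw [shift_eq_map hT hs hk hl hV]
    rintro _ ⟨f, hf, rfl⟩
    rw [inner_smul_left, Complex.conj_conj, inner_sh hT hs hk hl (hV hm) (hV hf), inner_kv hT _ hf,
      hlam _ hf]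

lemma rev_mem {f : Laurent} (hf : f ∈ P n m) : mono (n, m) * sharp f ∈ P n m := by
  rw [mem_P_iff] at hf ⊢
  intro u hu
  rw [coeff_mono_mul, sharp_coeff, hf, map_zero]
  simp only [Set.mem_Icc, Prod.le_def, Prod.fst_neg, Prod.snd_neg, Prod.fst_sub, Prod.snd_sub]
    at hu ⊢
  omega

/-- The reverse `z ^ n * w ^ m * conj f (1/z, 1/w)` of `f`. -/
def rev (f : HT T hT) : HT T hT :=
  ofLaurent hT (mono (n, m) * sharp (toLaurent hT f)) (rev_mem (toLaurent_mem hT f))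

lemma toLaurent_rev (f : HT T hT) :
    toLaurent hT (rev hT f) = mono (n, m) * sharp (toLaurent hT f) := rfl

lemma mono_mul_cancel (s : ℤ × ℤ) (f : Laurent) : mono s * (mono (-s) * f) = f := by
  rw [← mul_assoc, mono_mul, add_neg_cancel]
  simp [mono, ← AddMonoidAlgebra.one_def]

lemma mono_mul_neg_cancel (s : ℤ × ℤ) (f : Laurent) : mono (-s) * (mono s * f) = f := by
  simpa using mono_mul_cancel (-s) f

lemma rev_rev (f : HT T hT) : rev hT (rev hT f) = f := by
  apply toLaurent_injective hT
  rw [toLaurent_rev, toLaurent_rev, sharp_mul, sharp_mono, sharp_sharp, mono_mul_cancel]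

lemma inner_rev (f g : HT T hT) : inner ℂ (rev hT f) (rev hT g) = inner ℂ g f := by
  apply inner_congr
  rw [toLaurent_rev, toLaurent_rev, sharp_mul, sharp_mono, sharp_sharp, mul_mul_mul_comm, mono_mul,
    add_neg_cancel, mul_comm (sharp _)]
  simp [mono, ← AddMonoidAlgebra.one_def]

lemma cf_rev (f : HT T hT) (u : ℤ × ℤ) : cf hT u (rev hT f) = conj (cf hT (((n : ℤ), (m : ℤ)) - u) f) := by
  rw [cf_apply, toLaurent_rev, coeff_mono_mul, sharp_coeff, neg_sub, cf_apply]

lemma lam_rev {z : ℂ} (hz : ‖z‖ = 1) (f : HT T hT) (i : ℤ) :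
    lam hT z i (rev hT f) = z ^ n * conj (lam hT z (m - i) f) := by
  have hz0 : z ≠ 0 := by rintro rfl; simp at hz
  rw [lam_apply, toLaurent_rev, rowEval_mono_mul hz0, rowEval_sharp hz, neg_sub, zpow_natCast,
    lam_apply]

/-- Reversal is antiunitary, so it carries representing vectors to representing vectors, up to the
unimodular factor `z ^ n`. -/
lemma D_rev {z : ℂ} (hz : ‖z‖ = 1) {V V' : Submodule ℂ (HT T hT)} (h : ∀ f ∈ V, rev hT f ∈ V')
    (h' : ∀ f ∈ V', rev hT f ∈ V) (i j : ℤ) :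
    D hT z V' i j = conj (D hT z V (m - i) (m - j)) := by
  have hm := kv_mem hT V (lam hT z (m - j))
  have hzz : conj (z ^ n) * z ^ n = 1 := by
    rw [mul_comm, Complex.mul_conj, Complex.normSq_eq_norm_sq, norm_pow, hz]; simp
  rw [D, kv_eq hT (x := conj (z ^ n) • rev hT (kv hT V (lam hT z (m - j)))), map_smul,
    lam_rev hT hz, smul_eq_mul, ← mul_assoc, hzz, one_mul]
  · rfl
  · exact Submodule.smul_mem _ _ (h _ hm)
  · intro g hg
    rw [inner_smul_left, Complex.conj_conj, ← rev_rev hT g, inner_rev, rev_rev,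
      ← inner_conj_symm, inner_kv hT _ (h' g hg), lam_rev hT hz, sub_sub_cancel, map_mul,
      Complex.conj_conj, ← mul_assoc, mul_comm (z ^ n), hzz, one_mul]

lemma polys_eq_sup {k : ℤ} (hk : k ≤ n) :
    polys hT k m = E1 hT k m ⊔ shift hT (0, 1) (polys hT k ((m : ℤ) - 1)) := by
  rw [sup_comm, E1, inf_comm, Submodule.sup_orthogonal_inf_of_hasOrthogonalProjection]
  exact fun g hg => ((mem_shift_w_iff hT hk le_rfl).mp hg).1

lemma polys_eq_sup' :
    polys hT n m = E2 hT n m ⊔ shift hT (1, 0) (polys hT ((n : ℤ) - 1) m) := by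
  rw [sup_comm, E2, inf_comm, Submodule.sup_orthogonal_inf_of_hasOrthogonalProjection]
  exact fun g hg => ((mem_shift_z_iff hT le_rfl le_rfl).mp hg).1

lemma E1_isOrtho (k l : ℤ) : E1 hT k l ⟂ shift hT (0, 1) (polys hT k (l - 1)) :=
  (Submodule.isOrtho_orthogonal_left _).mono_left inf_le_right

lemma E2_isOrtho (k l : ℤ) : E2 hT k l ⟂ shift hT (1, 0) (polys hT (k - 1) l) :=
  (Submodule.isOrtho_orthogonal_left _).mono_left inf_le_right

/-- The kernel of `E²_{n,m}` on a fibre. -/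
lemma D_E2 {z : ℂ} (hz : ‖z‖ = 1) (i j : ℤ) : D hT z (E2 hT n m) i j =
    D hT z (polys hT n m) i j - D hT z (polys hT ((n : ℤ) - 1) m) i j := by
  rw [polys_eq_sup' hT, D_sup hT z (E2_isOrtho hT _ _),
    D_shift hT hz (k := (n : ℤ) - 1) (l := m) (by simp) (by simp) (by simp) le_rfl]
  simp

lemma D_polys_w {z : ℂ} (hz : ‖z‖ = 1) {k : ℤ} (hk : k ≤ n) (i j : ℤ) :
    D hT z (polys hT k m) i j = D hT z (E1 hT k m) i j +
      D hT z (polys hT k ((m : ℤ) - 1)) (i - 1) (j - 1) := by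
  conv_lhs => rw [polys_eq_sup hT hk]
  rw [D_sup hT z (E1_isOrtho hT _ _),
    D_shift hT hz (k := k) (l := (m : ℤ) - 1) (by simp) (by simpa) (by simp) le_rfl]

/-- The kernel of `P_{k,l}` on a fibre is invariant under reversal. -/
lemma D_polys_rev {z : ℂ} (hz : ‖z‖ = 1) {k l : ℤ} (hk : k ≤ n) (hl : l ≤ m) (i j : ℤ) :
    D hT z (polys hT k l) i j = conj (D hT z (polys hT k l) (l - i) (l - j)) := by
  -- Reversal is taken with respect to `(n, m)`, so it exchanges `P_{k,l}` with its copy shifted by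
  -- `(n - k, m - l)`. The shift in `w` is then undone by `D_shift`, turning `m` into `l` in the
  -- indices.
  have h1 : ∀ f ∈ shift hT ((n : ℤ) - k, (m : ℤ) - l) (polys hT k l), rev hT f ∈ polys hT k l := by
    intro f hf
    rw [mem_shift_iff] at hf
    obtain ⟨g, hg, e⟩ := hf
    rw [mem_polys_iff] at hg ⊢
    intro u hu
    rw [cf_rev, cf_apply, e, coeff_mono_mul, ← cf_apply, hg, map_zero]
    simp only [Set.mem_Icc, Prod.le_def, Prod.fst_sub, Prod.snd_sub] at hu ⊢
    omega
  have h2 : ∀ f ∈ polys hT k l, rev hT f ∈ shift hT ((n : ℤ) - k, (m : ℤ) - l) (polys hT k l) := by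
    intro f hf
    rw [mem_shift_iff]
    rw [mem_polys_iff] at hf
    have hP : mono (k, l) * sharp (toLaurent hT f) ∈ P k l := by
      rw [mem_P_iff]
      intro u hu
      rw [coeff_mono_mul, sharp_coeff, ← cf_apply, hf, map_zero]
      simp only [Set.mem_Icc, Prod.le_def, Prod.fst_neg, Prod.snd_neg, Prod.fst_sub,
        Prod.snd_sub] at hu ⊢
      omega
    have hP' : mono (k, l) * sharp (toLaurent hT f) ∈ P n m := by
      rw [mem_P_iff] at hP ⊢
      intro u hu
      apply hP
      simp only [Set.mem_Icc, Prod.le_def] at hu ⊢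
      omega
    refine ⟨ofLaurent hT _ hP', hP, ?_⟩
    rw [toLaurent_rev, toLaurent_ofLaurent, ← mul_assoc, mono_mul]
    simp
  rw [D_rev hT hz h1 h2, D_shift hT hz (k := k) (l := l) (by simp; omega) (by simp) (by simp)
    le_rfl]
  congr 2 <;> ring

end Form

end EAR

end

noncomputable section

namespace EAR

open MeasureTheory Filter Topology
open scoped ComplexConjugate Pointwise

section Form

variable {n m : ℕ} {T : L n m →ₗ[ℂ] ℂ} (hT : IsPositive T)

/-! ## The polynomial of a split shift -/

/-- The Christoffel-Darboux recursion for the fibre kernels of `E²_{n,m}`, determined by `p`. -/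
def FibreRecursion (p : HT T hT) : Prop :=
  ∀ z : ℂ, ‖z‖ = 1 → ∀ i j : ℤ,
    D hT z (E2 hT n m) i j - D hT z (E2 hT n m) (i - 1) (j - 1) =
      lam hT z i p * conj (lam hT z j p) -
        conj (lam hT z (m - (i - 1)) p) * lam hT z (m - (j - 1)) p

/-- The spaces `K₁` and `z K₂` are orthogonal of total dimension `dim E¹_{n-1,m} = n`, inside
`E¹_{n,m}` of dimension `n + 1`. A normalized vector of the one dimensional complement is the
polynomial `p`. -/
lemma exists_unit_of_split {K₁ K₂ : Submodule ℂ (HT T hT)} (h12 : K₁ ⟂ K₂)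
    (hsup : K₁ ⊔ K₂ = E1 hT ((n : ℤ) - 1) m) (hz : K₁ ⟂ shift hT (1, 0) K₂)
    (h1 : K₁ ≤ E1 hT n m) (h2 : shift hT (1, 0) K₂ ≤ E1 hT n m) :
    ∃ p ∈ E1 hT n m, inner ℂ p p = (1 : ℂ) ∧ Submodule.span ℂ {p} ⟂ (K₁ ⊔ shift hT (1, 0) K₂) ∧
      Submodule.span ℂ {p} ⊔ (K₁ ⊔ shift hT (1, 0) K₂) = E1 hT n m := by
  have hK₂ : K₂ ≤ E1 hT ((n : ℤ) - 1) m := hsup ▸ le_sup_right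
  have hinj : Set.InjOn (sh hT (1, 0)) K₂ := by
    intro f hf g hg e
    have hc (f) (hf : f ∈ K₂) := toLaurent_sh hT (s := (1, 0)) (k := (n : ℤ) - 1) (l := m)
      (by simp) (by simp) (by simp) (E1_le_polys hT _ _ (hK₂ hf))
    apply toLaurent_injective hT
    have e' := congrArg (toLaurent hT) e
    rw [hc f hf, hc g hg] at e'
    simpa only [mono_mul_neg_cancel] using congrArg (mono (-(1, 0)) * ·) e'
  have hd2 : Module.finrank ℂ (shift hT (1, 0) K₂) = Module.finrank ℂ K₂ := by
    rw [shift_z_eq_map hT hK₂]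
    have hker : Function.Injective ((sh hT (1, 0)).domRestrict K₂) := fun a b e =>
      Subtype.ext (hinj a.2 b.2 e)
    have := LinearMap.finrank_range_of_inj hker
    rwa [LinearMap.range_domRestrict] at this
  have e1 := Submodule.finrank_sup_add_finrank_inf_eq K₁ K₂
  have e2 := Submodule.finrank_sup_add_finrank_inf_eq K₁ (shift hT (1, 0) K₂)
  rw [h12.disjoint.eq_bot, finrank_bot, hsup, finrank_E1 hT n (by simp)] at e1
  rw [hz.disjoint.eq_bot, finrank_bot, hd2] at e2
  set U := K₁ ⊔ shift hT (1, 0) K₂ with hU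
  have hUE : U ≤ E1 hT n m := sup_le h1 h2
  have hE : Module.finrank ℂ (E1 hT n m) = n + 1 := by
    have := finrank_E1 hT (n + 1) (by simp)
    rwa [show ((n + 1 : ℕ) : ℤ) - 1 = n by push_cast; ring] at this
  have e3 := Submodule.finrank_add_inf_finrank_orthogonal hUE
  have hd : Module.finrank ℂ (Uᗮ ⊓ E1 hT n m : Submodule ℂ (HT T hT)) = 1 := by omega
  obtain ⟨v, hv0, hv⟩ := finrank_eq_one_iff'.mp hd
  have hv0' : (v : HT T hT) ≠ 0 := fun h => hv0 (Subtype.ext h)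
  have hn : (‖(v : HT T hT)‖ : ℂ) ≠ 0 := by simpa using hv0'
  set p : HT T hT := (‖(v : HT T hT)‖ : ℂ)⁻¹ • (v : HT T hT) with hp
  have hspan : Submodule.span ℂ {p} = Uᗮ ⊓ E1 hT n m := by
    apply le_antisymm
    · rw [Submodule.span_singleton_le_iff_mem]
      exact Submodule.smul_mem _ _ v.2
    · intro x hx
      obtain ⟨c, hc⟩ := hv ⟨x, hx⟩
      have hc' : c • (v : HT T hT) = x := congrArg Subtype.val hc
      rw [Submodule.mem_span_singleton]
      refine ⟨c * ‖(v : HT T hT)‖, ?_⟩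
      rw [hp, smul_smul, mul_assoc, mul_inv_cancel₀ hn, mul_one, hc']
  have hpm : p ∈ Uᗮ ⊓ E1 hT n m := hspan ▸ Submodule.mem_span_singleton_self p
  refine ⟨p, hpm.2, ?_, ?_, ?_⟩
  · rw [hp, inner_smul_left, inner_smul_right, inner_self_eq_norm_sq_to_K, map_inv₀,
      Complex.conj_ofReal]
    have hn' := hn
    simp only [Complex.coe_algebraMap]
    field_simp
  · rw [hspan]
    exact (Submodule.isOrtho_orthogonal_left _).mono_left inf_le_left
  · rw [hspan, sup_comm, Submodule.sup_orthogonal_inf_of_hasOrthogonalProjection hUE]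

/-- Since `K₂` and `z K₂` have equal fibre kernels, the kernels of `E¹_{n,m}` and `E¹_{n-1,m}`
differ by that of `p`. Reversal symmetry turns this into a recursion for `E²_{n,m}` alone. -/
lemma fibreRecursion_of_split {K₁ K₂ : Submodule ℂ (HT T hT)} (h12 : K₁ ⟂ K₂)
    (hsup : K₁ ⊔ K₂ = E1 hT ((n : ℤ) - 1) m) (hz : K₁ ⟂ shift hT (1, 0) K₂) {p : HT T hT}
    (hp : inner ℂ p p = (1 : ℂ)) (hp' : Submodule.span ℂ {p} ⟂ (K₁ ⊔ shift hT (1, 0) K₂))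
    (hE : Submodule.span ℂ {p} ⊔ (K₁ ⊔ shift hT (1, 0) K₂) = E1 hT n m) :
    FibreRecursion hT p := by
  intro z hz1
  have hK₂ : K₂ ≤ E1 hT ((n : ℤ) - 1) m := hsup ▸ le_sup_right
  set D1 : ℤ → ℤ → ℂ := D hT z (E2 hT n m) with hD1
  set D0 : ℤ → ℤ → ℂ := fun i j => D hT z (polys hT n ((m : ℤ) - 1)) i j -
    D hT z (polys hT ((n : ℤ) - 1) ((m : ℤ) - 1)) i j with hD0
  -- The kernels of `P_{n,m}` and `P_{n-1,m}` are each split into an `E¹` part and a `w`-shifted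
  -- part. The difference of the `E¹` parts is `p p*`.
  have hA (i j : ℤ) : D1 i j = lam hT z i p * conj (lam hT z j p) + D0 (i - 1) (j - 1) := by
    rw [hD1, D_E2 hT hz1, D_polys_w hT hz1 le_rfl, D_polys_w hT hz1 (by simp), ← hE, ← hsup,
      D_sup hT z hp', D_sup hT z hz, D_sup hT z h12, D_span_singleton hT z hp,
      D_shift hT hz1 (k := (n : ℤ) - 1) (l := m) (by simp) (by simp) (by simp)
        (hK₂.trans (E1_le_polys hT _ _))]
    simp only [sub_zero]
    ring
  have hr1 (i j : ℤ) : D1 i j = conj (D1 (m - i) (m - j)) := by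
    rw [hD1, D_E2 hT hz1, D_E2 hT hz1, map_sub, ← D_polys_rev hT hz1 le_rfl le_rfl,
      ← D_polys_rev hT hz1 (by simp) le_rfl]
  have hr0 (i j : ℤ) : D0 i j = conj (D0 (m - 1 - i) (m - 1 - j)) := by
    simp only [hD0]
    rw [map_sub, ← D_polys_rev hT hz1 le_rfl (by simp), ← D_polys_rev hT hz1 (by simp) (by simp)]
  -- Apply `hA` at `(i, j)` and at the reflected index `(m - (i - 1), m - (j - 1))`. The two `D0`
  -- terms coincide by their own reversal symmetry, which has `m - 1` in place of `m`, and cancel.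
  intro i j
  rw [hr1 (i - 1), hA i j, hA (m - (i - 1)), map_add, hr0 (i - 1)]
  rw [show (m : ℤ) - 1 - (i - 1) = m - (i - 1) - 1 by ring,
    show (m : ℤ) - 1 - (j - 1) = m - (j - 1) - 1 by ring, map_mul, Complex.conj_conj]
  ring

/-! ## The backward shift -/

/-- The compression of division by `z`. -/
def backShift : HT T hT →ₗ[ℂ] HT T hT :=
  sh hT (-1, 0) ∘ₗ (shift hT (1, 0) (polys hT ((n : ℤ) - 1) m)).starProjection.toLinearMap

lemma backShift_spec (f : HT T hT) : backShift hT f ∈ polys hT ((n : ℤ) - 1) m ∧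
    sh hT (1, 0) (backShift hT f) =
      (shift hT (1, 0) (polys hT ((n : ℤ) - 1) m)).starProjection f := by
  set Z := shift hT (1, 0) (polys hT ((n : ℤ) - 1) m)
  obtain ⟨g, hg, e⟩ := (mem_shift_iff hT).mp (Z.starProjection_apply_mem f)
  have hb : backShift hT f = g := by
    apply HT_ext
    intro u
    by_cases hu : u ∈ Set.Icc ((0 : ℤ), (0 : ℤ)) (n, m)
    · change cf hT u (sh hT (-1, 0) (Z.starProjection f)) = _
      rw [cf_sh hT _ _ hu, cf_apply, e, coeff_mono_mul, cf_apply]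
      congr 1
      ext <;> simp
    · rw [cf_eq_zero hT _ hu, cf_eq_zero hT _ hu]
  rw [hb]
  refine ⟨hg, toLaurent_injective hT ?_⟩
  rw [e, toLaurent_sh hT (k := (n : ℤ) - 1) (l := m) (by simp) (by simp) (by simp) hg]

/-- The component of `f` in `E²_{n,m}`. -/
def frontPart (f : HT T hT) : HT T hT := f - sh hT (1, 0) (backShift hT f)

lemma frontPart_mem (f : HT T hT) : frontPart hT f ∈ E2 hT n m := by
  rw [frontPart, (backShift_spec hT f).2]
  exact ⟨mem_polys_top hT _, Submodule.sub_starProjection_mem_orthogonal _⟩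

lemma frontPart_add (f : HT T hT) : frontPart hT f + sh hT (1, 0) (backShift hT f) = f :=
  sub_add_cancel _ _

lemma sh_backShift_mem (f : HT T hT) :
    sh hT (1, 0) (backShift hT f) ∈ shift hT (1, 0) (polys hT ((n : ℤ) - 1) m) := by
  rw [(backShift_spec hT f).2]
  exact Submodule.starProjection_apply_mem _ _

lemma inner_sh_z {f g : HT T hT} (hf : f ∈ polys hT ((n : ℤ) - 1) m)
    (hg : g ∈ polys hT ((n : ℤ) - 1) m) :
    inner ℂ (sh hT (1, 0) f) (sh hT (1, 0) g) = inner ℂ f g :=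
  inner_sh hT (k := (n : ℤ) - 1) (l := m) (by simp) (by simp) (by simp) hf hg

lemma norm_sh_z {f : HT T hT} (hf : f ∈ polys hT ((n : ℤ) - 1) m) :
    ‖sh hT (1, 0) f‖ = ‖f‖ := by
  rw [norm_eq_sqrt_re_inner (𝕜 := ℂ), norm_eq_sqrt_re_inner (𝕜 := ℂ), inner_sh_z hT hf hf]

/-- Both `E²_{n,m} ⟂ z P_{n-1,m}` and the isometry of multiplication by `z` enter. -/
lemma inner_decomp (f g : HT T hT) : inner ℂ f g =
    inner ℂ (frontPart hT f) (frontPart hT g) + inner ℂ (backShift hT f) (backShift hT g) := by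
  have ho := E2_isOrtho hT n m
  rw [Submodule.isOrtho_iff_inner_eq] at ho
  conv_lhs => rw [← frontPart_add hT f, ← frontPart_add hT g]
  rw [inner_add_left, inner_add_right, inner_add_right,
    ho _ (frontPart_mem hT f) _ (sh_backShift_mem hT g),
    inner_eq_zero_symm.mp (ho _ (frontPart_mem hT g) _ (sh_backShift_mem hT f)),
    inner_sh_z hT (backShift_spec hT f).1 (backShift_spec hT g).1]
  ring

/-- The polynomial `1` is a nonzero element. Nontriviality is used when a bound on the points of a
spectrum is passed to the spectral radius. -/
instance : Nontrivial (HT T hT) := by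
  refine ⟨ofLaurent hT (mono 0) (mono_mem_P (by simp [Prod.le_def])), 0, fun h => ?_⟩
  have := congrArg (cf hT 0) h
  rw [cf_apply, toLaurent_ofLaurent, mono_coeff, if_pos rfl, map_zero] at this
  exact one_ne_zero this

/-- For an eigenvector, `inner_decomp` reads `‖f‖² = ‖frontPart f‖² + |c|² ‖f‖²`. If `|c| ≥ 1`, the
front part vanishes and `f = c z f`, so all coefficients of `f` vanish in turn. -/
lemma norm_lt_one_of_hasEigenvalue {c : ℂ} (hc : Module.End.HasEigenvalue (backShift hT) c) :
    ‖c‖ < 1 := by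
  obtain ⟨f, hf⟩ := hc.exists_hasEigenvector
  have hf0 := hf.2
  have hfe : backShift hT f = c • f := hf.apply_eq_smul
  have h1 : ‖f‖ ^ 2 = ‖frontPart hT f‖ ^ 2 + ‖c‖ ^ 2 * ‖f‖ ^ 2 := by
    have := congrArg Complex.re (inner_decomp hT f f)
    rw [hfe] at this
    have e (x : HT T hT) : (inner ℂ x x).re = ‖x‖ ^ 2 := by
      rw [inner_self_eq_norm_sq_to_K]; norm_cast
    rw [Complex.add_re, e, e, e, norm_smul, mul_pow] at this
    exact this
  have hpos : 0 < ‖f‖ ^ 2 := by positivity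
  by_contra hcon
  push Not at hcon
  have hc1 : 1 ≤ ‖c‖ ^ 2 := one_le_pow₀ hcon
  have hfr : ‖frontPart hT f‖ ^ 2 = 0 := by nlinarith [sq_nonneg ‖frontPart hT f‖]
  have hc2 : ‖c‖ ^ 2 = 1 := by nlinarith [sq_nonneg ‖frontPart hT f‖]
  have hfr' : frontPart hT f = 0 := by simpa using hfr
  have hff : f = sh hT (1, 0) (backShift hT f) := by
    conv_lhs => rw [← frontPart_add hT f, hfr', zero_add]
  have hc0 : c ≠ 0 := by rintro rfl; simp at hc2
  -- `f = c z f` forces `f = 0`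
  have hcoef : ∀ k : ℕ, ∀ j : ℤ, cf hT ((k : ℤ), j) f = 0 := by
    have hstep (u : ℤ × ℤ) : cf hT u f = cf hT (u - (1, 0)) (c • f) := by
      conv_lhs => rw [hff]
      rw [cf_sh_of_mem hT (k := (n : ℤ) - 1) (l := m) (by simp) (by simp) (by simp)
        (backShift_spec hT f).1, hfe]
    intro k
    induction k with
    | zero =>
      intro j
      rw [hstep, cf_eq_zero hT]
      simp [Prod.le_def]
    | succ k ih =>
      intro j
      rw [hstep, map_smul]
      have := ih j
      simp [this]
  refine hf0 (HT_ext fun u => ?_)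
  rw [map_zero]
  by_cases hu : u ∈ Set.Icc ((0 : ℤ), (0 : ℤ)) (n, m)
  · obtain ⟨k, hk⟩ : ∃ k : ℕ, u.1 = k := ⟨u.1.toNat, by have := hu.1.1; simp at this; omega⟩
    have := hcoef k u.2
    rwa [← hk] at this
  · exact cf_eq_zero hT _ hu

/-- In finite dimension the eigenvalue bound makes the spectral radius less than one, and Gelfand's
formula gives geometric decay of the powers. -/
lemma tendsto_backShift_pow (f : HT T hT) :
    Tendsto (fun N : ℕ => (backShift hT ^ N) f) atTop (𝓝 0) := by
  set C : HT T hT →L[ℂ] HT T hT := Module.End.toContinuousLinearMap (HT T hT) (backShift hT) with hC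
  have hpow (N : ℕ) : (backShift hT ^ N) f = (C ^ N) f := by
    rw [hC, ← map_pow]
    rfl
  have hspec : ∀ c ∈ spectrum ℂ C, ‖c‖₊ < 1 := by
    intro c hc
    rw [hC, AlgEquiv.spectrum_eq, ← Module.End.hasEigenvalue_iff_mem_spectrum] at hc
    exact norm_lt_one_of_hasEigenvalue hT hc
  have hr := spectrum.spectralRadius_lt_of_forall_lt C hspec
  obtain ⟨r, hr1, hr2⟩ := ENNReal.lt_iff_exists_nnreal_btwn.mp hr
  have hr2' : r < 1 := by exact_mod_cast hr2
  have hlim := spectrum.pow_nnnorm_pow_one_div_tendsto_nhds_spectralRadius C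
  have hev : ∀ᶠ N : ℕ in atTop, ‖C ^ N‖ ≤ (r : ℝ) ^ N := by
    filter_upwards [hlim.eventually_lt_const hr1, eventually_gt_atTop 0] with N hN hN0
    have hN1 : ((‖C ^ N‖₊ : ENNReal) ^ (1 / N : ℝ)) ^ (N : ℝ) ≤ (r : ENNReal) ^ (N : ℝ) :=
      ENNReal.rpow_le_rpow hN.le (by positivity)
    rw [← ENNReal.rpow_mul, one_div_mul_cancel (by positivity), ENNReal.rpow_one,
      ENNReal.rpow_natCast] at hN1
    exact_mod_cast hN1
  simp_rw [hpow]
  rw [tendsto_zero_iff_norm_tendsto_zero]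
  have h0 : Tendsto (fun N : ℕ => (r : ℝ) ^ N * ‖f‖) atTop (𝓝 0) := by
    simpa using (tendsto_pow_atTop_nhds_zero_of_lt_one r.2 (by exact_mod_cast hr2')).mul_const ‖f‖
  refine squeeze_zero' (Eventually.of_forall fun _ => norm_nonneg _) ?_ h0
  filter_upwards [hev] with N hN
  exact (C ^ N).le_of_opNorm_le hN f

/-- A functional which commutes with multiplication by `z` up to a scalar in the closed disk is
determined by its values on `E²_{n,m}`. -/
lemma eq_zero_of_E2 {η : HT T hT →ₗ[ℂ] ℂ} {c : ℂ} (hc : ‖c‖ ≤ 1)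
    (hη : ∀ f ∈ polys hT ((n : ℤ) - 1) m, η (sh hT (1, 0) f) = c * η f)
    (h0 : ∀ f ∈ E2 hT n m, η f = 0) : η = 0 := by
  ext f
  -- Each step splits off a component in `E²_{n,m}`, on which the functional vanishes, and divides
  -- the rest by `z`.
  have hN (N : ℕ) : η f = c ^ N * η ((backShift hT ^ N) f) := by
    induction N with
    | zero => simp
    | succ N ih =>
      rw [ih, pow_succ' (backShift hT), Module.End.mul_apply]
      conv_lhs => rw [← frontPart_add hT ((backShift hT ^ N) f)]
      rw [map_add, h0 _ (frontPart_mem hT _), zero_add, hη _ (backShift_spec hT _).1]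
      ring
  have hlim : Tendsto (fun N : ℕ => η ((backShift hT ^ N) f)) atTop (𝓝 0) := by
    have := (LinearMap.continuous_of_finiteDimensional η).tendsto 0
    rw [map_zero] at this
    exact this.comp (tendsto_backShift_pow hT f)
  rw [LinearMap.zero_apply, ← norm_le_zero_iff]
  refine ge_of_tendsto (tendsto_zero_iff_norm_tendsto_zero.mp hlim) (Eventually.of_forall ?_)
  intro N
  rw [hN N, norm_mul, norm_pow]
  exact mul_le_of_le_one_left (norm_nonneg _) (pow_le_one₀ (norm_nonneg _) hc)

end Form

end EAR

end

/-! ### Absence of zeros and the inner product on a fibre -/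

noncomputable section

namespace EAR

open MeasureTheory Filter Topology
open scoped ComplexConjugate Pointwise

section Form

variable {n m : ℕ} {T : L n m →ₗ[ℂ] ℂ} (hT : IsPositive T)

lemma lam_sh_z {z : ℂ} (hz : z ≠ 0) (i : ℤ) {f : HT T hT} (hf : f ∈ polys hT ((n : ℤ) - 1) m) :
    lam hT z i (sh hT (1, 0) f) = z * lam hT z i f := by
  rw [lam_apply, toLaurent_sh hT (k := (n : ℤ) - 1) (l := m) (by simp) (by simp) (by simp) hf,
    rowEval_mono_mul hz, zpow_one, sub_zero, lam_apply]

lemma toLaurent_sh_z {f : HT T hT} (hf : f ∈ polys hT ((n : ℤ) - 1) m) :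
    toLaurent hT (sh hT (1, 0) f) = mono (1, 0) * toLaurent hT f :=
  toLaurent_sh hT (k := (n : ℤ) - 1) (l := m) (by simp) (by simp) (by simp) hf

lemma sum_pow_mul_shift {m : ℕ} {b : ℤ → ℂ} (hb : ∀ i ∉ Set.Icc (0 : ℤ) m, b i = 0) (w : ℂ) :
    ∑ j ∈ Finset.range (m + 2), b ((j : ℤ) - 1) * w ^ j = w * pol m b w := by
  rw [Finset.sum_range_succ', pol, Finset.mul_sum, Nat.cast_zero, hb _ (by simp), zero_mul,
    add_zero]
  refine Finset.sum_congr rfl fun j _ => ?_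
  push_cast
  rw [add_sub_cancel_right]
  ring

lemma sum_range_succ_pol {m : ℕ} {b : ℤ → ℂ} (hb : ∀ i ∉ Set.Icc (0 : ℤ) m, b i = 0) (w : ℂ) :
    ∑ j ∈ Finset.range (m + 2), b j * w ^ j = pol m b w := by
  rw [Finset.sum_range_succ, hb, zero_mul, add_zero, pol]
  simp

lemma conj_pol {m : ℕ} (b : ℤ → ℂ) (w : ℂ) :
    conj (pol m b w) = pol m (fun i => conj (b i)) (conj w) := by
  simp [pol]

variable {hT}

/-- A polynomial satisfying the fibre recursion has no zeros on `𝕋 × closure 𝔻`. -/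
theorem FibreRecursion.evalAt_ne_zero {p : HT T hT} (hp : FibreRecursion hT p) {z w : ℂ}
    (hz : ‖z‖ = 1) (hw : ‖w‖ ≤ 1) : evalAt (toLaurent hT p) z w ≠ 0 := by
  intro h0
  have hz0 : z ≠ 0 := by rintro rfl; simp at hz
  set a : ℤ → ℂ := fun i => lam hT z i p with ha
  have ha0 : ∀ i ∉ Set.Icc (0 : ℤ) m, a i = 0 := fun i hi => by
    simp only [ha]; rw [lam_eq_zero hT z hi, LinearMap.zero_apply]
  set at' : ℤ → ℂ := fun i => conj (a (m - i)) with hat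
  have hat0 : ∀ i ∉ Set.Icc (0 : ℤ) m, at' i = 0 := fun i hi => by
    simp only [hat]
    rw [ha0, map_zero]
    simp only [Set.mem_Icc] at hi ⊢
    omega
  set K := D hT z (E2 hT n m) with hK
  have hrec (i j : ℤ) : K i j - K (i - 1) (j - 1) =
      a i * conj (a j) - at' (i - 1) * conj (at' (j - 1)) := by
    have := hp z hz i j
    simp only [hat, Complex.conj_conj]
    exact this
  have hpol : pol m a w = 0 := by
    rw [← h0, evalAt_eq_pol (toLaurent_mem hT p)]
    rfl
  -- These are the fibre coefficients of the vector `v` of `E²_{n,m}` that represents evaluation at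
  -- the supposed zero. Summed against powers of `conj w`, the recursion loses its first term
  -- because `p(z, w) = 0`.
  set d : ℤ → ℂ := fun i => pol m (fun j => K i j) (conj w) with hd
  have hd0 : ∀ i ∉ Set.Icc (0 : ℤ) m, d i = 0 := fun i hi => by
    refine Finset.sum_eq_zero fun j _ => ?_
    simp only [hK]
    rw [D_eq_zero hT z _ (Or.inl hi), zero_mul]
  have hdrec (i : ℤ) : d i - conj w * d (i - 1) =
      - (at' (i - 1) * (conj w * conj (pol m at' w))) := by
    have e1 := sum_range_succ_pol (b := fun j => K i j)
      (fun j hj => D_eq_zero hT z _ (Or.inr hj)) (conj w)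
    have e2 := sum_pow_mul_shift (b := fun j => K (i - 1) j)
      (fun j hj => D_eq_zero hT z _ (Or.inr hj)) (conj w)
    have e3 := sum_range_succ_pol (b := fun j => conj (a j))
      (fun j hj => by rw [ha0 j hj, map_zero]) (conj w)
    have e4 := sum_pow_mul_shift (b := fun j => conj (at' j))
      (fun j hj => by rw [hat0 j hj, map_zero]) (conj w)
    rw [← conj_pol, hpol, map_zero] at e3
    rw [← conj_pol] at e4
    simp only [hd]
    rw [← e1, ← e2, ← e4, ← Finset.sum_sub_distrib]
    have : ∀ j ∈ Finset.range (m + 2), K i j * conj w ^ j - K (i - 1) (j - 1) * conj w ^ j =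
        a i * (conj (a j) * conj w ^ j) - at' (i - 1) * (conj (at' (j - 1)) * conj w ^ j) := by
      intro j _
      linear_combination (conj w ^ j) * hrec i j
    rw [Finset.sum_congr rfl this, Finset.sum_sub_distrib, ← Finset.mul_sum, ← Finset.mul_sum, e3]
    ring
  -- the vector of `E²` representing evaluation at `(z, w)`
  let η : HT T hT →ₗ[ℂ] ℂ := ∑ i ∈ Finset.range (m + 1), w ^ i • lam hT z i
  have hη (f : HT T hT) : η f = pol m (fun i => lam hT z i f) w := by
    simp [η, pol, LinearMap.sum_apply, mul_comm]
  set v : HT T hT := ∑ j ∈ Finset.range (m + 1), conj w ^ j • kv hT (E2 hT n m) (lam hT z j) with hv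
  have hvm : v ∈ E2 hT n m :=
    Submodule.sum_mem _ fun j _ => Submodule.smul_mem _ _ (kv_mem hT _ _)
  have hvη : ∀ f ∈ E2 hT n m, inner ℂ v f = η f := by
    intro f hf
    rw [hv, sum_inner, hη, pol]
    refine Finset.sum_congr rfl fun j _ => ?_
    rw [inner_smul_left, inner_kv hT _ hf, map_pow, Complex.conj_conj, mul_comm]
  have hvd (i : ℤ) : lam hT z i v = d i := by
    simp only [hv, map_sum, map_smul, smul_eq_mul, hd, pol]
    exact Finset.sum_congr rfl fun j _ => mul_comm _ _
  have hvv : inner ℂ v v = pol m d w := by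
    rw [hvη v hvm, hη]
    simp only [hvd]
  have hv0 : v = 0 := by
    rcases hw.lt_or_eq with hlt | heq
    · have e1 := sum_range_succ_pol hd0 w
      have e2 := sum_pow_mul_shift hd0 w
      have e3 := sum_pow_mul_shift hat0 w
      -- Summing once more against `w ^ i` gives the diagonal Christoffel-Darboux identity. With the
      -- contribution of `p` gone it says that `(1 - |w|²) ‖v‖²` is nonpositive, so `v = 0` for `|w|
      -- < 1`.
      have hS : pol m d w - conj w * (w * pol m d w) =
          - ((w * pol m at' w) * (conj w * conj (pol m at' w))) := by
        rw [← e2, ← e1, ← e3, Finset.mul_sum, ← Finset.sum_sub_distrib, Finset.sum_mul,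
          ← Finset.sum_neg_distrib]
        refine Finset.sum_congr rfl fun i _ => ?_
        linear_combination w ^ i * hdrec i
      have hS' : (1 - ‖w‖ ^ 2) * ‖v‖ ^ 2 = - ‖w * pol m at' w‖ ^ 2 := by
        rw [← hvv, inner_self_eq_norm_sq_to_K, ← map_mul, Complex.mul_conj,
          Complex.normSq_eq_norm_sq, ← mul_assoc, mul_comm (conj w), Complex.mul_conj,
          Complex.normSq_eq_norm_sq] at hS
        have hS2 : (((1 - ‖w‖ ^ 2) * ‖v‖ ^ 2 : ℝ) : ℂ) = ((- ‖w * pol m at' w‖ ^ 2 : ℝ) : ℂ) := by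
          rw [Complex.ofReal_neg, ← hS]
          simp only [Complex.coe_algebraMap]
          push_cast
          ring
        exact_mod_cast hS2
      have h1 : 0 < 1 - ‖w‖ ^ 2 := by nlinarith [norm_nonneg w]
      by_contra hne
      have : 0 < ‖v‖ ^ 2 := by positivity
      nlinarith [sq_nonneg ‖w * pol m at' w‖]
    -- On `|w| = 1` the factor `1 - |w|²` is useless. But there the reversed polynomial vanishes
    -- together with `p`, and `hdrec` becomes `d i = conj w * d (i - 1)`, starting from `d (-1) =
    -- 0`.
    · have hP : pol m at' w = 0 := by
        have hw0 : w ≠ 0 := by rintro rfl; simp at heq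
        have hinv : conj w = w⁻¹ := by
          have := conj_zpow_of_norm_one heq 1
          simpa using this
        have : w ^ m * conj (pol m at' w) = pol m a w := by
          rw [conj_pol, hinv, pol, ← Finset.sum_range_reflect, Finset.mul_sum, pol]
          refine Finset.sum_congr rfl fun i hi => ?_
          have hi' : i ≤ m := by simpa [Nat.lt_succ_iff] using hi
          simp only [hat, Complex.conj_conj]
          rw [show m + 1 - 1 - i = m - i by omega, Nat.cast_sub hi', sub_sub_cancel, mul_left_comm]
          congr 1
          have : w ^ m = w ^ i * w ^ (m - i) := by rw [← pow_add]; congr 1; omega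
          rw [this, inv_pow, mul_assoc, mul_inv_cancel₀ (pow_ne_zero _ hw0), mul_one]
        rw [hpol] at this
        have := (mul_eq_zero.mp this).resolve_left (pow_ne_zero _ hw0)
        simpa using this
      have hdn : ∀ i : ℕ, d i = 0 := by
        intro i
        induction i with
        | zero =>
          have := hdrec 0
          rw [hP, hd0 (0 - 1) (by simp)] at this
          simpa using this
        | succ i ih =>
          have := hdrec ((i : ℤ) + 1)
          rw [hP, add_sub_cancel_right, ih] at this
          simpa using this
      rw [← inner_self_eq_zero (𝕜 := ℂ), hvv, pol]
      exact Finset.sum_eq_zero fun i _ => by rw [hdn i, zero_mul]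
  -- Evaluation at `(z, w)` turns multiplication by `z` into a scalar of modulus one and vanishes on
  -- `E²_{n,m}`, hence everywhere. Its value at the polynomial `1` contradicts this.
  have hη0 : η = 0 := by
    refine eq_zero_of_E2 hT hz.le (fun f hf => ?_) (fun f hf => ?_)
    · rw [hη, hη, pol, pol, Finset.mul_sum]
      refine Finset.sum_congr rfl fun i _ => ?_
      rw [lam_sh_z hT hz0 _ hf, mul_assoc]
    · rw [← hvη f hf, hv0, inner_zero_left]
  have h1 := LinearMap.congr_fun hη0 (ofLaurent hT (mono 0) (mono_mem_P (by simp [Prod.le_def])))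
  rw [hη, LinearMap.zero_apply, pol, Finset.sum_eq_single 0] at h1
  · rw [lam_apply, toLaurent_ofLaurent, rowEval_mono] at h1
    simp at h1
  · intro i _ hi
    rw [lam_apply, toLaurent_ofLaurent, rowEval_mono, if_neg, zero_mul]
    exact fun h => hi (by simpa using h.symm)
  · simp

/-! ## The inner product on a fibre -/

/-- The inner product on the fibre over `z` with weight `1 / |p| ^ 2`. -/
def J (p : Laurent) (z : ℂ) (f g : Laurent) : ℂ :=
  mean fun t => evalAt f z (circ t) * conj (evalAt g z (circ t)) /
    (evalAt p z (circ t) * conj (evalAt p z (circ t)))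

lemma continuous_mean {F : ℝ → ℝ → ℂ} (hF : Continuous fun x : ℝ × ℝ => F x.1 x.2) :
    Continuous fun s => mean (F s) := by
  have h := intervalIntegral.continuous_parametric_intervalIntegral_of_continuous' (μ := volume)
    (f := F) hF 0 (2 * Real.pi)
  exact h.const_mul (((2 * Real.pi : ℝ) : ℂ)⁻¹)

lemma continuous_evalAt_circ (f : Laurent) : Continuous fun x : ℝ × ℝ =>
    evalAt f (circ x.1) (circ x.2) := by
  induction f using laurent_induction with
  | mono u =>
    simp_rw [evalAt_mono]
    exact ((continuous_circ_zpow _).comp continuous_fst).mul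
      ((continuous_circ_zpow _).comp continuous_snd)
  | add f g hf hg => simp_rw [evalAt_add]; exact hf.add hg
  | smul a f hf => simp_rw [evalAt_smul]; exact hf.const_mul a

lemma exists_circ_eq {z : ℂ} (hz : ‖z‖ = 1) : ∃ s, circ s = z := by
  refine ⟨z.arg, ?_⟩
  have := Complex.norm_mul_exp_arg_mul_I z
  rwa [hz, Complex.ofReal_one, one_mul] at this

section

variable {p : Laurent} (hp : ∀ z w : ℂ, ‖z‖ = 1 → ‖w‖ = 1 → evalAt p z w ≠ 0)

include hp

lemma continuous_J_integrand (f g : Laurent) : Continuous fun x : ℝ × ℝ =>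
    evalAt f (circ x.1) (circ x.2) * conj (evalAt g (circ x.1) (circ x.2)) /
    (evalAt p (circ x.1) (circ x.2) * conj (evalAt p (circ x.1) (circ x.2))) := by
  refine Continuous.div ?_ ?_ fun x => ?_
  · exact (continuous_evalAt_circ f).mul (Complex.continuous_conj.comp (continuous_evalAt_circ g))
  · exact (continuous_evalAt_circ p).mul (Complex.continuous_conj.comp (continuous_evalAt_circ p))
  · have := hp _ _ (norm_circ x.1) (norm_circ x.2)
    exact mul_ne_zero this (by simpa using this)

lemma continuous_J_integrand' {z : ℂ} (hz : ‖z‖ = 1) (f g : Laurent) : Continuous fun t : ℝ =>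
    evalAt f z (circ t) * conj (evalAt g z (circ t)) /
    (evalAt p z (circ t) * conj (evalAt p z (circ t))) := by
  obtain ⟨s, rfl⟩ := exists_circ_eq hz
  have h : Continuous fun t : ℝ => (s, t) := by fun_prop
  simpa only [Function.comp_def] using (continuous_J_integrand hp f g).comp h

lemma continuous_J (f g : Laurent) : Continuous fun s => J p (circ s) f g := by
  unfold J
  exact continuous_mean (F := fun s t =>
    evalAt f (circ s) (circ t) * conj (evalAt g (circ s) (circ t)) /
    (evalAt p (circ s) (circ t) * conj (evalAt p (circ s) (circ t)))) (continuous_J_integrand hp f g)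

lemma J_add_left {z : ℂ} (hz : ‖z‖ = 1) (f f' g : Laurent) :
    J p z (f + f') g = J p z f g + J p z f' g := by
  rw [J, J, J, ← mean_add (continuous_J_integrand' hp hz _ _) (continuous_J_integrand' hp hz _ _)]
  congr 1 with t
  rw [evalAt_add]
  ring

lemma J_add_right {z : ℂ} (hz : ‖z‖ = 1) (f g g' : Laurent) :
    J p z f (g + g') = J p z f g + J p z f g' := by
  rw [J, J, J, ← mean_add (continuous_J_integrand' hp hz _ _) (continuous_J_integrand' hp hz _ _)]
  congr 1 with t
  rw [evalAt_add, map_add]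
  ring

omit hp

lemma J_smul_right (z : ℂ) (a : ℂ) (f g : Laurent) : J p z f (a • g) = conj a * J p z f g := by
  rw [J, J, ← mean_const_mul]
  congr 1 with t
  rw [evalAt_smul, map_mul]
  ring

lemma J_conj (z : ℂ) (f g : Laurent) : conj (J p z f g) = J p z g f := by
  rw [J, J, ← mean_conj]
  congr 1 with t
  simp only [map_div₀, map_mul, Complex.conj_conj]
  ring

lemma J_z_mul_left {z : ℂ} (hz : z ≠ 0) (f g : Laurent) :
    J p z (mono (1, 0) * f) g = z * J p z f g := by
  rw [J, J, ← mean_const_mul]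
  congr 1 with t
  rw [evalAt_z_mul hz, zpow_one]
  ring

lemma J_z_mul_right {z : ℂ} (hz : z ≠ 0) (f g : Laurent) :
    J p z f (mono (1, 0) * g) = conj z * J p z f g := by
  rw [← J_conj, J_z_mul_left hz, map_mul, J_conj]

end

end Form

end EAR

end

noncomputable section

namespace EAR

open MeasureTheory Filter Topology
open scoped ComplexConjugate Pointwise

section Form

variable {n m : ℕ} {T : L n m →ₗ[ℂ] ℂ} {hT : IsPositive T}

/-! ## The form is the integral against `1 / |p| ^ 2` -/

lemma FibreRecursion.ne_zero_torus {p : HT T hT} (hp : FibreRecursion hT p) (z w : ℂ)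
    (hz : ‖z‖ = 1) (hw : ‖w‖ = 1) : evalAt (toLaurent hT p) z w ≠ 0 :=
  hp.evalAt_ne_zero hz hw.le

/-- The recursion and the absence of zeros are the hypotheses of `mean_mul_kernel`: on the fibre,
the kernel of `E²_{n,m}` reproduces all polynomials in `w` of degree at most `m`, and `f` need not
belong to `E²_{n,m}`. -/
lemma FibreRecursion.J_kv {p : HT T hT} (hp : FibreRecursion hT p) {z : ℂ} (hz : ‖z‖ = 1)
    (f : HT T hT) {l : ℕ} (hl : l ≤ m) :
    J (toLaurent hT p) z (toLaurent hT f) (toLaurent hT (kv hT (E2 hT n m) (lam hT z l))) =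
      lam hT z l f := by
  set a : ℤ → ℂ := fun i => lam hT z i p with ha
  have hpol (g : HT T hT) (w : ℂ) : evalAt (toLaurent hT g) z w = pol m (fun i => lam hT z i g) w :=
    evalAt_eq_pol (toLaurent_mem hT g) z w
  have hne : ∀ w : ℂ, ‖w‖ ≤ 1 → pol m a w ≠ 0 := fun w hw => by
    rw [ha, ← hpol]
    exact hp.evalAt_ne_zero hz hw
  have hK := mean_mul_kernel (D := D hT z (E2 hT n m)) hne
    (fun i j h => D_eq_zero hT z _ h) (fun i hi => by
      simp only [ha]; rw [lam_eq_zero hT z hi, LinearMap.zero_apply]) (hp z hz) l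
  have hcont (i : ℕ) : Continuous fun t => circ t ^ i *
      conj (pol m (fun r => D hT z (E2 hT n m) r l) (circ t)) /
      (pol m a (circ t) * conj (pol m a (circ t))) := by
    refine Continuous.div ?_ ?_ fun t => ?_
    · exact (continuous_circ.pow i).mul (Complex.continuous_conj.comp continuous_pol_circ)
    · exact continuous_pol_circ.mul (Complex.continuous_conj.comp continuous_pol_circ)
    · have := pol_circ_ne_zero hne t
      exact mul_ne_zero this (by simpa using this)
  have e : J (toLaurent hT p) z (toLaurent hT f)
      (toLaurent hT (kv hT (E2 hT n m) (lam hT z l))) =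
      mean fun t => ∑ i ∈ Finset.range (m + 1), lam hT z i f * (circ t ^ i *
      conj (pol m (fun r => D hT z (E2 hT n m) r l) (circ t)) /
      (pol m a (circ t) * conj (pol m a (circ t)))) := by
    rw [J]
    congr 1 with t
    rw [hpol, hpol, hpol, pol, Finset.sum_mul, Finset.sum_div]
    refine Finset.sum_congr rfl fun i _ => ?_
    rw [← mul_div_assoc, mul_assoc]
    rfl
  rw [e, mean_sum _ fun i _ => (hcont i).const_mul _]
  simp_rw [mean_const_mul]
  rw [Finset.sum_eq_single l]
  · rw [hK l hl hl, if_pos rfl, mul_one]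
  · intro i hi hil
    rw [hK i hl (by simpa [Nat.lt_succ_iff] using hi), if_neg hil, mul_zero]
  · intro h
    simp at h
    omega

/-- A linear relation among these vectors gives a combination of the coefficient functionals that
vanishes on `E²_{n,m}`. By `eq_zero_of_E2` it vanishes on `H_T`, and testing on the monomials `w^l`
shows that it is trivial. The dimension bound `m + 1` does the rest. -/
lemma span_kv {z : ℂ} (hz : ‖z‖ = 1) :
    Submodule.span ℂ (Set.range fun l : Fin (m + 1) => kv hT (E2 hT n m) (lam hT z (l : ℕ))) =
      E2 hT n m := by
  have hz0 : z ≠ 0 := by rintro rfl; simp at hz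
  have hli : LinearIndependent ℂ
      fun l : Fin (m + 1) => kv hT (E2 hT n m) (lam hT z (l : ℕ)) := by
    rw [Fintype.linearIndependent_iff]
    intro c hc
    let η : HT T hT →ₗ[ℂ] ℂ := ∑ l : Fin (m + 1), conj (c l) • lam hT z (l : ℕ)
    have hη (f : HT T hT) : η f = ∑ l : Fin (m + 1), conj (c l) * lam hT z (l : ℕ) f := by
      simp [η, LinearMap.sum_apply]
    have h0 : η = 0 := by
      refine eq_zero_of_E2 hT hz.le (fun f hf => ?_) (fun f hf => ?_)
      · rw [hη, hη, Finset.mul_sum]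
        refine Finset.sum_congr rfl fun l _ => ?_
        rw [lam_sh_z hT hz0 _ hf, mul_left_comm]
      · have : inner ℂ (∑ l : Fin (m + 1), c l • kv hT (E2 hT n m) (lam hT z (l : ℕ))) f =
            (0 : ℂ) := by rw [hc, inner_zero_left]
        rw [sum_inner] at this
        rw [hη, ← this]
        refine Finset.sum_congr rfl fun l _ => ?_
        rw [inner_smul_left, inner_kv hT _ hf]
    intro l
    have hmem : mono (0, ((l : ℕ) : ℤ)) ∈ P n m := by
      refine mono_mem_P ?_
      have := l.2
      simp only [Set.mem_Icc, Prod.le_def]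
      omega
    have h1 := LinearMap.congr_fun h0 (ofLaurent hT _ hmem)
    rw [hη, Finset.sum_eq_single l] at h1
    · rw [lam_apply, toLaurent_ofLaurent, rowEval_mono] at h1
      simpa using h1
    · intro i _ hi
      rw [lam_apply, toLaurent_ofLaurent, rowEval_mono, if_neg, mul_zero]
      intro h
      exact hi (Fin.ext (by simpa using h.symm))
    · simp
  refine Submodule.eq_of_le_of_finrank_le ?_ ?_
  · rw [Submodule.span_le]
    rintro _ ⟨l, rfl⟩
    exact kv_mem hT _ _
  · rw [finrank_span_eq_card hli, Fintype.card_fin]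
    exact finrank_E2_le hT

/-- On `E²_{n,m}` the inner product of a fibre is the inner product of `H_T`. -/
lemma FibreRecursion.J_E2 {p : HT T hT} (hp : FibreRecursion hT p) {z : ℂ} (hz : ‖z‖ = 1)
    (f : HT T hT) (hf : f ∈ E2 hT n m) {g : HT T hT} (hg : g ∈ E2 hT n m) :
    J (toLaurent hT p) z (toLaurent hT f) (toLaurent hT g) = inner ℂ g f := by
  rw [← span_kv hz] at hg
  induction hg using Submodule.span_induction with
  | zero =>
    rw [inner_zero_left, map_zero, ← zero_smul ℂ (0 : Laurent), J_smul_right, map_zero, zero_mul]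
  | add x y _ _ hx hy =>
    rw [map_add, J_add_right hp.ne_zero_torus hz, hx, hy, inner_add_left]
  | smul a x _ hx => rw [map_smul, J_smul_right, hx, inner_smul_left]
  | mem x hx =>
    obtain ⟨l, rfl⟩ := hx
    have := l.2
    simp only
    rw [hp.J_kv hz f (by omega), inner_kv hT _ hf]

/-- The sum of the absolute values of the coefficients. -/
def coeffNorm (f : HT T hT) : ℝ := ∑ u ∈ Lam n m, ‖cf hT u f‖

lemma coeffNorm_nonneg (f : HT T hT) : 0 ≤ coeffNorm f := Finset.sum_nonneg fun _ _ => norm_nonneg _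

lemma norm_evalAt_le (f : HT T hT) {z w : ℂ} (hz : ‖z‖ = 1) (hw : ‖w‖ = 1) :
    ‖evalAt (toLaurent hT f) z w‖ ≤ coeffNorm f := by
  rw [evalAt, Finsupp.sum_of_support_subset (s := Lam n m)]
  · refine norm_sum_le_of_le _ fun u _ => ?_
    simp [hz, hw, cf_apply]
  · intro u hu
    by_contra h
    refine (Finsupp.mem_support_iff.mp hu) (cf_eq_zero hT f ?_)
    simpa [Lam] using h
  · simp

/-- Compactness of the torus, parametrized by arguments in `[-π, π]`. -/
lemma exists_bound_weight {p : Laurent}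
    (hp : ∀ z w : ℂ, ‖z‖ = 1 → ‖w‖ = 1 → evalAt p z w ≠ 0) :
    ∃ B : ℝ, 0 ≤ B ∧ ∀ z w : ℂ, ‖z‖ = 1 → ‖w‖ = 1 → ‖1 / (evalAt p z w * conj (evalAt p z w))‖ ≤ B := by
  have hK : IsCompact (Set.Icc (-Real.pi) Real.pi ×ˢ Set.Icc (-Real.pi) Real.pi) :=
    isCompact_Icc.prod isCompact_Icc
  have hc : Continuous fun x : ℝ × ℝ => 1 / (evalAt p (circ x.1) (circ x.2) *
      conj (evalAt p (circ x.1) (circ x.2))) := by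
    refine Continuous.div continuous_const ?_ fun x => ?_
    · exact (continuous_evalAt_circ p).mul (Complex.continuous_conj.comp (continuous_evalAt_circ p))
    · have := hp _ _ (norm_circ x.1) (norm_circ x.2)
      exact mul_ne_zero this (by simpa using this)
  obtain ⟨B, hB⟩ := hK.exists_bound_of_continuousOn hc.continuousOn
  have harg {z : ℂ} (hz : ‖z‖ = 1) : circ z.arg = z := by
    have := Complex.norm_mul_exp_arg_mul_I z
    rwa [hz, Complex.ofReal_one, one_mul] at this
  have hmem (z : ℂ) : z.arg ∈ Set.Icc (-Real.pi) Real.pi :=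
    ⟨(Complex.neg_pi_lt_arg z).le, Complex.arg_le_pi z⟩
  refine ⟨max B 0, le_max_right _ _, fun z w hz hw => ?_⟩
  have := hB (z.arg, w.arg) ⟨hmem z, hmem w⟩
  simp only [harg hz, harg hw] at this
  exact this.trans (le_max_left _ _)

lemma norm_J_le {p : Laurent} {B : ℝ}
    (hB : ∀ z w : ℂ, ‖z‖ = 1 → ‖w‖ = 1 → ‖1 / (evalAt p z w * conj (evalAt p z w))‖ ≤ B)
    {z : ℂ} (hz : ‖z‖ = 1) (f g : HT T hT) :
    ‖J p z (toLaurent hT f) (toLaurent hT g)‖ ≤ B * (coeffNorm f * coeffNorm g) := by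
  refine norm_mean_le fun t => ?_
  rw [div_eq_mul_one_div, mul_comm, norm_mul, norm_mul, RCLike.norm_conj]
  have h1 := hB z (circ t) hz (norm_circ t)
  have h2 := norm_evalAt_le f hz (norm_circ t)
  have h3 := norm_evalAt_le g hz (norm_circ t)
  have := coeffNorm_nonneg f
  have := (norm_nonneg _).trans h1
  gcongr

lemma tendsto_coeffNorm (f : HT T hT) :
    Tendsto (fun N : ℕ => coeffNorm ((backShift hT ^ N) f)) atTop (𝓝 0) := by
  have : Tendsto (fun N : ℕ => ∑ u ∈ Lam n m, ‖cf hT u ((backShift hT ^ N) f)‖) atTop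
      (𝓝 (∑ u ∈ Lam n m, 0)) := by
    refine tendsto_finsetSum _ fun u _ => ?_
    have h := (LinearMap.continuous_of_finiteDimensional (cf hT u)).tendsto 0
    rw [map_zero] at h
    exact tendsto_zero_iff_norm_tendsto_zero.mp (h.comp (tendsto_backShift_pow hT f))
  simpa [coeffNorm] using this

lemma toLaurent_decomp (f : HT T hT) : toLaurent hT f =
    toLaurent hT (frontPart hT f) + mono (1, 0) * toLaurent hT (backShift hT f) := by
  conv_lhs => rw [← frontPart_add hT f]
  rw [map_add, toLaurent_sh_z hT (backShift_spec hT f).1]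

variable {p : HT T hT} (hp : FibreRecursion hT p)

include hp

/-- By `J_E2` the front part of `g` contributes a constant times a nonzero power of `z`, of mean
zero. So `g` may be replaced by its backward shift at the cost of one more negative power, and
iterating drives the integral to zero. -/
lemma FibreRecursion.mean_J_front {e : HT T hT} (he : e ∈ E2 hT n m) (g : HT T hT) {j : ℕ}
    (hj : 0 < j) : mean (fun s => circ s ^ (-(j : ℤ)) *
      J (toLaurent hT p) (circ s) (toLaurent hT e) (toLaurent hT g)) = 0 := by
  have hc (j : ℤ) (g : HT T hT) : Continuous fun s => circ s ^ j *
      J (toLaurent hT p) (circ s) (toLaurent hT e) (toLaurent hT g) :=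
    (continuous_circ_zpow j).mul (continuous_J hp.ne_zero_torus _ _)
  have hstep (j : ℕ) (hj : 0 < j) (g : HT T hT) : mean (fun s => circ s ^ (-(j : ℤ)) *
      J (toLaurent hT p) (circ s) (toLaurent hT e) (toLaurent hT g)) =
      mean (fun s => circ s ^ (-((j + 1 : ℕ) : ℤ)) *
      J (toLaurent hT p) (circ s) (toLaurent hT e) (toLaurent hT (backShift hT g))) := by
    have : ∀ s, circ s ^ (-(j : ℤ)) *
        J (toLaurent hT p) (circ s) (toLaurent hT e) (toLaurent hT g) =
        circ s ^ (-(j : ℤ)) * inner ℂ (frontPart hT g) e + circ s ^ (-((j + 1 : ℕ) : ℤ)) *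
        J (toLaurent hT p) (circ s) (toLaurent hT e) (toLaurent hT (backShift hT g)) := by
      intro s
      rw [toLaurent_decomp g, J_add_right hp.ne_zero_torus (norm_circ s),
        hp.J_E2 (norm_circ s) e he (frontPart_mem hT g), J_z_mul_right (circ_ne_zero s), conj_circ,
        Nat.cast_add, neg_add, zpow_add₀ (circ_ne_zero s), Nat.cast_one, zpow_neg_one]
      ring
    simp_rw [this]
    rw [mean_add ((continuous_circ_zpow _).mul_const _) (hc _ _), mean_mul_const, mean_circ_zpow,
      if_neg (by omega), zero_mul, zero_add]
  have hN (N : ℕ) : mean (fun s => circ s ^ (-(j : ℤ)) *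
      J (toLaurent hT p) (circ s) (toLaurent hT e) (toLaurent hT g)) =
      mean (fun s => circ s ^ (-((j + N : ℕ) : ℤ)) *
      J (toLaurent hT p) (circ s) (toLaurent hT e) (toLaurent hT ((backShift hT ^ N) g))) := by
    induction N with
    | zero => simp
    | succ N ih => rw [ih, hstep _ (by omega), pow_succ', Module.End.mul_apply, add_assoc]
  obtain ⟨B, hB0, hB⟩ := exists_bound_weight hp.ne_zero_torus
  have hlim : Tendsto (fun N : ℕ => B * (coeffNorm e * coeffNorm ((backShift hT ^ N) g))) atTop
      (𝓝 0) := by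
    simpa using ((tendsto_coeffNorm g).const_mul (coeffNorm e)).const_mul B
  rw [← norm_le_zero_iff]
  refine ge_of_tendsto hlim (Eventually.of_forall fun N => ?_)
  rw [hN N]
  refine norm_mean_le fun s => ?_
  rw [norm_mul, norm_zpow, norm_circ, one_zpow, one_mul]
  exact norm_J_le hB (norm_circ s) _ _

/-- The difference of the two forms does not change when both arguments are replaced by their
backward shifts. The powers of the backward shift tend to zero, so the difference is zero. -/
lemma FibreRecursion.mean_J (f g : HT T hT) :
    mean (fun s => J (toLaurent hT p) (circ s) (toLaurent hT f) (toLaurent hT g)) =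
      inner ℂ g f := by
  set I : HT T hT → HT T hT → ℂ := fun f g =>
    mean (fun s => J (toLaurent hT p) (circ s) (toLaurent hT f) (toLaurent hT g)) with hI
  have hc (f g : HT T hT) : Continuous fun s =>
      J (toLaurent hT p) (circ s) (toLaurent hT f) (toLaurent hT g) :=
    continuous_J hp.ne_zero_torus _ _
  have hc' (k : ℤ) (f g : HT T hT) : Continuous fun s => circ s ^ k *
      J (toLaurent hT p) (circ s) (toLaurent hT f) (toLaurent hT g) :=
    (continuous_circ_zpow k).mul (hc f g)
  have hstep (f g : HT T hT) : inner ℂ g f - I f g =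
      inner ℂ (backShift hT g) (backShift hT f) - I (backShift hT f) (backShift hT g) := by
    -- Expansion into four terms: front with front is constant by `J_E2`, the two cross terms have
    -- mean zero by `mean_J_front` (one of them after conjugation), and the factors `z` cancel in
    -- the last.
    have e1 : ∀ s, J (toLaurent hT p) (circ s) (toLaurent hT f) (toLaurent hT g) =
        (inner ℂ (frontPart hT g) (frontPart hT f) + circ s ^ (-((1 : ℕ) : ℤ)) *
          J (toLaurent hT p) (circ s) (toLaurent hT (frontPart hT f))
            (toLaurent hT (backShift hT g))) +
        (conj (circ s ^ (-((1 : ℕ) : ℤ)) *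
          J (toLaurent hT p) (circ s) (toLaurent hT (frontPart hT g))
            (toLaurent hT (backShift hT f))) +
        J (toLaurent hT p) (circ s) (toLaurent hT (backShift hT f))
            (toLaurent hT (backShift hT g))) := by
      intro s
      have hs := circ_ne_zero s
      have h1 := norm_circ s
      conv_lhs => rw [toLaurent_decomp f, toLaurent_decomp g]
      rw [J_add_left hp.ne_zero_torus h1, J_add_right hp.ne_zero_torus h1,
        J_add_right hp.ne_zero_torus h1, hp.J_E2 h1 _ (frontPart_mem hT f) (frontPart_mem hT g),
        J_z_mul_right hs, J_z_mul_right hs, J_z_mul_left hs, J_z_mul_left hs, map_mul, J_conj,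
        map_zpow₀, conj_circ]
      simp only [Nat.cast_one, zpow_neg_one, inv_inv]
      field_simp
    have e2 : I f g = inner ℂ (frontPart hT g) (frontPart hT f) +
        I (backShift hT f) (backShift hT g) := by
      simp only [hI]
      simp_rw [e1]
      have hA : Continuous fun s => inner ℂ (frontPart hT g) (frontPart hT f) +
          circ s ^ (-((1 : ℕ) : ℤ)) * J (toLaurent hT p) (circ s) (toLaurent hT (frontPart hT f))
            (toLaurent hT (backShift hT g)) := continuous_const.add (hc' _ _ _)
      have hC : Continuous fun s => conj (circ s ^ (-((1 : ℕ) : ℤ)) *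
          J (toLaurent hT p) (circ s) (toLaurent hT (frontPart hT g))
            (toLaurent hT (backShift hT f))) := Complex.continuous_conj.comp (hc' _ _ _)
      have hB : Continuous fun s => conj (circ s ^ (-((1 : ℕ) : ℤ)) *
          J (toLaurent hT p) (circ s) (toLaurent hT (frontPart hT g))
            (toLaurent hT (backShift hT f))) +
          J (toLaurent hT p) (circ s) (toLaurent hT (backShift hT f))
            (toLaurent hT (backShift hT g)) := hC.add (hc _ _)
      rw [mean_add hA hB, mean_add continuous_const (hc' _ _ _),
        mean_add hC (hc _ _), mean_const, mean_conj,
        hp.mean_J_front (frontPart_mem hT f) _ one_pos,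
        hp.mean_J_front (frontPart_mem hT g) _ one_pos]
      simp
    rw [e2, inner_decomp hT g f]
    ring
  have hN (N : ℕ) : inner ℂ g f - I f g = inner ℂ ((backShift hT ^ N) g) ((backShift hT ^ N) f) -
      I ((backShift hT ^ N) f) ((backShift hT ^ N) g) := by
    induction N with
    | zero => simp
    | succ N ih => rw [ih, hstep, pow_succ', Module.End.mul_apply, Module.End.mul_apply]
  obtain ⟨B, hB0, hB⟩ := exists_bound_weight hp.ne_zero_torus
  have hlim : Tendsto (fun N : ℕ => ‖(backShift hT ^ N) g‖ * ‖(backShift hT ^ N) f‖ +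
      B * (coeffNorm ((backShift hT ^ N) f) * coeffNorm ((backShift hT ^ N) g))) atTop (𝓝 0) := by
    have h1 := tendsto_zero_iff_norm_tendsto_zero.mp (tendsto_backShift_pow hT f)
    have h2 := tendsto_zero_iff_norm_tendsto_zero.mp (tendsto_backShift_pow hT g)
    simpa using (h2.mul h1).add (((tendsto_coeffNorm f).mul (tendsto_coeffNorm g)).const_mul B)
  refine (sub_eq_zero.mp ?_).symm
  rw [← norm_le_zero_iff]
  refine ge_of_tendsto hlim (Eventually.of_forall fun N => ?_)
  rw [hN N]
  refine (norm_sub_le _ _).trans (add_le_add (norm_inner_le_norm _ _) ?_)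
  exact norm_mean_le fun s => norm_J_le hB (norm_circ s) _ _

/-- The moments of the Bernstein-Szegő measure of `p`. -/
theorem FibreRecursion.moments (u : ℤ × ℤ) (hu : u ∈ Set.Icc (-(n : ℤ), -(m : ℤ)) (n, m)) :
    T ⟨mono u, mono_mem_L hu⟩ =
        ((2 * Real.pi : ℝ) : ℂ)⁻¹ ^ 2 * ∫ s in (0 : ℝ)..2 * Real.pi, ∫ t in (0 : ℝ)..2 * Real.pi,
          circ s ^ u.1 * circ t ^ u.2 /
            ((‖evalAt (toLaurent hT p) (circ s) (circ t)‖ ^ 2 : ℝ) : ℂ) := by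
  simp only [Set.mem_Icc, Prod.le_def] at hu
  -- The positive and negative parts of `u` express `mono u` as a product of one polynomial of
  -- degree at most `(n, m)` and the reflection of another.
  have ha : mono (max u.1 0, max u.2 0) ∈ P n m := mono_mem_P (by
    simp only [Set.mem_Icc, Prod.le_def]; omega)
  have hb : mono (max (-u.1) 0, max (-u.2) 0) ∈ P n m := mono_mem_P (by
    simp only [Set.mem_Icc, Prod.le_def]; omega)
  have hab : ((max u.1 0, max u.2 0) : ℤ × ℤ) - (max (-u.1) 0, max (-u.2) 0) = u := by
    ext
    · simp only [Prod.fst_sub]; omega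
    · simp only [Prod.snd_sub]; omega
  have h := hp.mean_J (ofLaurent hT _ ha) (ofLaurent hT _ hb)
  change _ = T _ at h
  rw [mean_mean]
  refine Eq.trans ?_ (h.symm.trans ?_)
  · congr 1
    apply Subtype.ext
    change mono u = mono _ * sharp (mono _)
    rw [sharp_mono, mono_mul, ← sub_eq_add_neg, hab]
  · congr 1 with s
    rw [J]
    congr 1 with t
    rw [toLaurent_ofLaurent, toLaurent_ofLaurent, ← evalAt_sharp (norm_circ s) (norm_circ t),
      ← evalAt_mul (circ_ne_zero s) (circ_ne_zero t), sharp_mono, mono_mul, ← sub_eq_add_neg, hab,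
      evalAt_mono, Complex.mul_conj, Complex.normSq_eq_norm_sq]

end Form

end EAR

end

noncomputable section

namespace EAR

open MeasureTheory Filter Topology
open scoped ComplexConjugate Pointwise ENNReal

/-! ## Factorizations of the autocorrelations -/

/-- The Laurent polynomials with exponents in `S`. -/
def Supp (S : Set (ℤ × ℤ)) : Submodule ℂ Laurent := Submodule.span ℂ (mono '' S)

lemma mem_Supp_iff {S : Set (ℤ × ℤ)} {f : Laurent} : f ∈ Supp S ↔ ∀ u ∉ S, f.coeff u = 0 :=
  mem_span_mono_iff S f

lemma mul_mem_Supp {S S' S'' : Set (ℤ × ℤ)} (h : ∀ u ∈ S, ∀ v ∈ S', u + v ∈ S'') {f g : Laurent}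
    (hf : f ∈ Supp S) (hg : g ∈ Supp S') : f * g ∈ Supp S'' := by
  have := Submodule.mul_mem_mul hf hg
  rw [Supp, Supp, Submodule.span_mul_span] at this
  refine Submodule.span_mono ?_ this
  rintro _ ⟨_, ⟨u, hu, rfl⟩, _, ⟨v, hv, rfl⟩, rfl⟩
  exact ⟨u + v, h u hu v hv, (mono_mul u v).symm⟩

lemma sharp_mem_Supp {S S' : Set (ℤ × ℤ)} (h : ∀ u ∈ S, -u ∈ S') {f : Laurent}
    (hf : f ∈ Supp S) : sharp f ∈ Supp S' := by
  rw [mem_Supp_iff] at hf ⊢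
  intro u hu
  rw [sharp_coeff, hf, map_zero]
  exact fun h' => hu (by simpa using h _ h')

lemma Supp_mono {S S' : Set (ℤ × ℤ)} (h : S ⊆ S') : Supp S ≤ Supp S' :=
  Submodule.span_mono (Set.image_mono h)

/-- The part of a Laurent polynomial with exponents in `S`. -/
def part (S : Set (ℤ × ℤ)) [DecidablePred (· ∈ S)] (f : Laurent) : Laurent :=
  AddMonoidAlgebra.ofCoeff (f.coeff.filter (· ∈ S))

lemma part_coeff (S : Set (ℤ × ℤ)) [DecidablePred (· ∈ S)] (f : Laurent) (u : ℤ × ℤ) :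
    (part S f).coeff u = if u ∈ S then f.coeff u else 0 := Finsupp.filter_apply _ _ _

/-- The convolution of the coefficients of `p` with a function on `ℤ²`. -/
def conv (p : Laurent) (F : ℤ × ℤ → ℂ) (u : ℤ × ℤ) : ℂ := p.coeff.sum fun k a => a * F (u - k)

lemma conv_eq_liftMono (p : Laurent) (F : ℤ × ℤ → ℂ) (u : ℤ × ℤ) :
    conv p F u = liftMono (fun k => F (u - k)) p := rfl

/-- `φ` are the Fourier coefficients of `1 / p`, with `c` the autocorrelations of `φ`. -/
structure IsFactor (n m : ℕ) (c : ℤ × ℤ → ℂ) (p : Laurent) (φ : ℤ × ℤ → ℂ) : Prop where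
  mem : p ∈ P n m
  summable : Summable fun u => ‖φ u‖
  eq_zero : ∀ u : ℤ × ℤ, u.2 < 0 → φ u = 0
  conv_eq : ∀ u, conv p φ u = if u = 0 then 1 else 0
  cov_eq : ∀ u ∈ Set.Icc (-(n : ℤ), -(m : ℤ)) (n, m), c u = ∑' j, conj (φ j) * φ (j + u)

/-- The square summable functions on `ℤ²`. -/
abbrev Seq : Type := lp (fun _ : ℤ × ℤ => ℂ) 2

lemma memlp_shift {φ : ℤ × ℤ → ℂ} (hφ : Summable fun u => ‖φ u‖) (u : ℤ × ℤ) :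
    Memℓp (fun v => φ (v - u)) 2 := by
  have h : Memℓp (fun v => φ (v - u)) 1 := by
    rw [memℓp_gen_iff (by norm_num)]
    simpa [Function.comp_def] using (Equiv.subRight u).summable_iff.mpr hφ
  exact h.of_exponent_ge (by norm_num)

section Synthesis

variable {φ : ℤ × ℤ → ℂ} (hφ : Summable fun u => ‖φ u‖)

/-- The convolution of the coefficients of a Laurent polynomial with `φ`, as an element
of `ℓ²(ℤ²)`. -/
def synth : Laurent →ₗ[ℂ] Seq :=
  Finsupp.linearCombination ℂ (fun u => (⟨fun v => φ (v - u), memlp_shift hφ u⟩ : Seq)) ∘ₗ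
    (AddMonoidAlgebra.coeffLinearEquiv ℂ).toLinearMap

lemma synth_mono (u v : ℤ × ℤ) : synth hφ (mono u) v = φ (v - u) := by
  simp [synth, mono]

lemma synth_mono_mul (s : ℤ × ℤ) (f : Laurent) (v : ℤ × ℤ) :
    synth hφ (mono s * f) v = synth hφ f (v - s) := by
  induction f using laurent_induction with
  | mono u => rw [mono_mul, synth_mono, synth_mono, sub_sub]
  | add f g hf hg => rw [mul_add, map_add, map_add, lp.coeFn_add, lp.coeFn_add, Pi.add_apply,
      Pi.add_apply, hf, hg]
  | smul a f hf => rw [mul_smul_comm, map_smul, map_smul, lp.coeFn_smul, lp.coeFn_smul,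
      Pi.smul_apply, Pi.smul_apply, hf]

lemma synth_apply (f : Laurent) (v : ℤ × ℤ) : synth hφ f v = conv f φ v := by
  induction f using laurent_induction with
  | mono u => rw [synth_mono, conv_eq_liftMono, liftMono_mono]
  | add f g hf hg => rw [map_add, lp.coeFn_add, Pi.add_apply, hf, hg, conv_eq_liftMono,
      conv_eq_liftMono, conv_eq_liftMono, map_add]
  | smul a f hf => rw [map_smul, lp.coeFn_smul, Pi.smul_apply, hf, conv_eq_liftMono,
      conv_eq_liftMono, map_smul]

lemma continuous_seq_apply (u : ℤ × ℤ) : Continuous fun F : Seq => F u :=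
  (lp.evalCLM ℂ (fun _ : ℤ × ℤ => ℂ) 2 u).continuous

lemma continuous_conv (p : Laurent) (u : ℤ × ℤ) : Continuous fun F : Seq => conv p F u :=
  continuous_finsetSum _ fun k _ => continuous_const.mul (continuous_seq_apply (u - k))

lemma conv_add (p : Laurent) (F G : ℤ × ℤ → ℂ) (u : ℤ × ℤ) :
    conv p (F + G) u = conv p F u + conv p G u := by
  simp [conv, mul_add, Finsupp.sum_add]

lemma conv_smul (p : Laurent) (a : ℂ) (F : ℤ × ℤ → ℂ) (u : ℤ × ℤ) :
    conv p (a • F) u = a * conv p F u := by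
  simp [conv, Finsupp.sum, Finset.mul_sum, mul_left_comm]

lemma conv_sub (p : Laurent) (F G : ℤ × ℤ → ℂ) (u : ℤ × ℤ) :
    conv p (F - G) u = conv p F u - conv p G u := by
  simp [conv, mul_sub, Finsupp.sum]

lemma inner_synth_mono_mul (s : ℤ × ℤ) (f g : Laurent) :
    inner ℂ (synth hφ (mono s * f)) (synth hφ (mono s * g)) =
      inner ℂ (synth hφ f) (synth hφ g) := by
  rw [lp.inner_eq_tsum, lp.inner_eq_tsum, ← (Equiv.addRight s).tsum_eq]
  refine tsum_congr fun v => ?_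
  rw [synth_mono_mul, synth_mono_mul, Equiv.coe_addRight, add_sub_cancel_right]

lemma inner_synth_mono (u v : ℤ × ℤ) : inner ℂ (synth hφ (mono u)) (synth hφ (mono v)) =
    ∑' j, conj (φ j) * φ (j + (u - v)) := by
  rw [lp.inner_eq_tsum, ← (Equiv.addRight u).tsum_eq]
  refine tsum_congr fun j => ?_
  rw [synth_mono, synth_mono, Equiv.coe_addRight, RCLike.inner_apply', add_sub_cancel_right,
    add_sub_assoc]

/-- The Gram matrix of the monomials depends only on the difference of exponents. This symmetry
transfers vanishing below the strip to vanishing above it. -/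
lemma inner_synth_sharp (f g : Laurent) : inner ℂ (synth hφ (sharp f)) (synth hφ (sharp g)) =
    inner ℂ (synth hφ g) (synth hφ f) := by
  induction f using laurent_induction with
  | mono u =>
    induction g using laurent_induction with
    | mono v =>
      rw [sharp_mono, sharp_mono, inner_synth_mono, inner_synth_mono, neg_sub_neg]
    | add f g hf hg => rw [sharp_add, map_add, inner_add_right, hf, hg, map_add, inner_add_left]
    | smul a f hf => rw [sharp_smul, map_smul, inner_smul_right, hf, map_smul, inner_smul_left]
  | add f g hf hg => rw [sharp_add, map_add, inner_add_left, hf, hg, map_add, inner_add_right]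
  | smul a f hf => rw [sharp_smul, map_smul, inner_smul_left, hf, map_smul, inner_smul_right,
      Complex.conj_conj]

end Synthesis

namespace IsFactor

variable {n m : ℕ} {c φ : ℤ × ℤ → ℂ} {p : Laurent} (h : IsFactor n m c p φ)

include h

lemma conv_synth (f : Laurent) (u : ℤ × ℤ) : conv p (synth h.summable f) u = f.coeff u := by
  induction f using laurent_induction with
  | mono v =>
    have : conv p (synth h.summable (mono v)) u = conv p φ (u - v) := by
      simp only [conv, synth_mono, sub_right_comm]
    rw [this, h.conv_eq, mono_coeff]
    simp only [sub_eq_zero, eq_comm]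
  | add f g hf hg => rw [map_add, lp.coeFn_add, conv_add, hf, hg]; simp
  | smul a f hf => rw [map_smul, lp.coeFn_smul, conv_smul, hf]; simp

/-- Multiples of `p` become finitely supported sequences, so inner products with them are sums of
point values. -/
lemma synth_mul (f : Laurent) (u : ℤ × ℤ) : synth h.summable (f * p) u = f.coeff u := by
  induction f using laurent_induction with
  | mono v =>
    rw [synth_mono_mul, synth_apply, h.conv_eq, mono_coeff]
    simp only [sub_eq_zero, eq_comm]
  | add f g hf hg => rw [add_mul, map_add, lp.coeFn_add, Pi.add_apply, hf, hg]; simp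
  | smul a f hf => rw [smul_mul_assoc, map_smul, lp.coeFn_smul, Pi.smul_apply, hf]; simp

lemma synth_injective : Function.Injective (synth h.summable) := by
  intro f g hfg
  ext u
  rw [← h.conv_synth, hfg, h.conv_synth]

/-- Convolution with `p` is injective on `ℓ²(ℤ²)`. -/
lemma eq_zero_of_conv (F : Seq) (hF : ∀ u, conv p F u = 0) : F = 0 := by
  ext u
  have hb (v : ℤ × ℤ) : ‖F v‖ ≤ ‖F‖ := lp.norm_apply_le_norm (by norm_num) F v
  have hs (k : ℤ × ℤ) : Summable fun j => φ j * F (u - j - k) := by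
    refine Summable.of_norm_bounded (h.summable.mul_right ‖F‖) fun j => ?_
    rw [norm_mul]
    exact mul_le_mul_of_nonneg_left (hb _) (norm_nonneg _)
  -- Associativity of convolution: `φ * (p * F) = (φ * p) * F`, where summability of `φ` and
  -- boundedness of `F` justify the interchange.
  have h1 : ∑' j, φ j * conv p F (u - j) = F u := by
    have e1 (j : ℤ × ℤ) : φ j * conv p F (u - j) =
        ∑ k ∈ p.coeff.support, p.coeff k * (φ j * F (u - j - k)) := by
      rw [conv, Finsupp.sum, Finset.mul_sum]
      exact Finset.sum_congr rfl fun k _ => by ring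
    have hs' (k : ℤ × ℤ) : Summable fun v => p.coeff k * (φ (v - k) * F (u - v)) := by
      refine Summable.mul_left _ ?_
      refine (Equiv.addRight k).summable_iff.mp ?_
      refine (hs k).congr fun j => ?_
      simp [sub_add_eq_sub_sub]
    simp_rw [e1]
    rw [Summable.tsum_finsetSum fun k _ => (hs k).mul_left _]
    have e2 (k : ℤ × ℤ) : ∑' j, p.coeff k * (φ j * F (u - j - k)) =
        ∑' v, p.coeff k * (φ (v - k) * F (u - v)) := by
      rw [← (Equiv.addRight k).tsum_eq fun v => p.coeff k * (φ (v - k) * F (u - v))]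
      refine tsum_congr fun j => ?_
      simp [sub_add_eq_sub_sub]
    simp_rw [e2]
    rw [← Summable.tsum_finsetSum fun k _ => hs' k, tsum_eq_single 0]
    · have := h.conv_eq 0
      rw [if_pos rfl, conv, Finsupp.sum] at this
      simp_rw [← mul_assoc]
      rw [← Finset.sum_mul, this, sub_zero, one_mul]
    · intro v hv
      have := h.conv_eq v
      rw [if_neg hv, conv, Finsupp.sum] at this
      simp_rw [← mul_assoc]
      rw [← Finset.sum_mul, this, zero_mul]
  rw [← h1]
  simp [hF]

lemma synth_eq_zero {f : Laurent} {b : ℤ} (hf : f ∈ Supp {u | b ≤ u.2}) {v : ℤ × ℤ}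
    (hv : v.2 < b) : synth h.summable f v = 0 := by
  rw [mem_Supp_iff] at hf
  rw [synth_apply, conv, Finsupp.sum]
  refine Finset.sum_eq_zero fun k hk => ?_
  have hk' : b ≤ k.2 := by
    by_contra hb
    exact (Finsupp.mem_support_iff.mp hk) (hf k hb)
  rw [h.eq_zero _ (by rw [Prod.snd_sub]; omega), mul_zero]

lemma inner_synth_mul (f : Laurent) (F : Seq) :
    inner ℂ (synth h.summable (f * p)) F = ∑' u, conj (f.coeff u) * F u := by
  rw [lp.inner_eq_tsum]
  refine tsum_congr fun u => ?_
  rw [h.synth_mul, RCLike.inner_apply']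

lemma inner_synth_mul_eq_zero {f : Laurent} {F : Seq} (hF : ∀ u, f.coeff u ≠ 0 → F u = 0) :
    inner ℂ (synth h.summable (f * p)) F = 0 := by
  rw [h.inner_synth_mul]
  refine (tsum_congr fun u => ?_).trans tsum_zero
  by_cases hu : f.coeff u = 0
  · rw [hu, map_zero, zero_mul]
  · rw [hF u hu, mul_zero]

lemma inner_synth_mono_mul_self (u : ℤ × ℤ) (F : Seq) :
    inner ℂ (synth h.summable (mono u * p)) F = F u := by
  rw [h.inner_synth_mul, tsum_eq_single u]
  · simp [mono_coeff]
  · intro v hv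
    rw [mono_coeff, if_neg hv.symm, map_zero, zero_mul]

/-- Recovers a coefficient of the polynomial behind `F` as an inner product, with an element that in
general leaves the strip. `exists_reproducing` corrects it. -/
lemma inner_synth_sharp_mul (u : ℤ × ℤ) (F : Seq) :
    inner ℂ (synth h.summable (mono u * sharp p * p)) F = conv p F u := by
  rw [h.inner_synth_mul, ← (Equiv.subLeft u).tsum_eq, conv, Finsupp.sum,
    tsum_eq_sum (s := p.coeff.support)]
  · refine Finset.sum_congr rfl fun k _ => ?_
    rw [coeff_mono_mul, sharp_coeff, Complex.conj_conj]
    simp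
  · intro k hk
    rw [coeff_mono_mul, sharp_coeff, Complex.conj_conj]
    simp [Finsupp.notMem_support_iff.mp hk]

end IsFactor

end EAR

end

noncomputable section

namespace EAR

open MeasureTheory Filter Topology
open scoped ComplexConjugate Pointwise ENNReal

/-! ## Factorizations give split-shift orthogonality -/

lemma mem_Supp_inter {S S' : Set (ℤ × ℤ)} {f : Laurent} (h : f ∈ Supp S) (h' : f ∈ Supp S') :
    f ∈ Supp (S ∩ S') := by
  rw [mem_Supp_iff] at h h' ⊢
  intro u hu
  by_cases hS : u ∈ S
  · exact h' u fun h1 => hu ⟨hS, h1⟩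
  · exact h u hS

lemma part_mem {S S' : Set (ℤ × ℤ)} [DecidablePred (· ∈ S)] {f : Laurent} (hf : f ∈ Supp S') :
    part S f ∈ Supp (S' ∩ S) := by
  rw [mem_Supp_iff] at hf ⊢
  intro u hu
  rw [part_coeff]
  split_ifs with h
  · exact hf u fun h' => hu ⟨h', h⟩
  · rfl

lemma sub_part_mem {S S' : Set (ℤ × ℤ)} [DecidablePred (· ∈ S)] {f : Laurent} (hf : f ∈ Supp S') :
    f - part S f ∈ Supp (S' \ S) := by
  rw [mem_Supp_iff] at hf ⊢
  intro u hu
  rw [AddMonoidAlgebra.coeff_sub, Finsupp.sub_apply, part_coeff]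
  split_ifs with h
  · exact sub_self _
  · rw [sub_zero]
    exact hf u fun h' => hu ⟨h', h⟩

lemma mono_mem_Supp {S : Set (ℤ × ℤ)} {u : ℤ × ℤ} (hu : u ∈ S) : mono u ∈ Supp S :=
  Submodule.subset_span ⟨u, hu, rfl⟩

lemma eqOn_topologicalClosure {K : Submodule ℂ Seq} {α β : Seq → ℂ} (hα : Continuous α)
    (hβ : Continuous β) (h : ∀ F ∈ K, α F = β F) {F : Seq} (hF : F ∈ K.topologicalClosure) :
    α F = β F :=
  closure_minimal (s := (K : Set Seq)) (t := {F | α F = β F}) h (isClosed_eq hα hβ) hF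

/-- The Laurent polynomials of degree between `0` and `m` in `w`. -/
def strip (m : ℕ) : Submodule ℂ Laurent := Supp {u | 0 ≤ u.2 ∧ u.2 ≤ m}

/-- The span of the monomials `z ^ i * w ^ j` with `0 ≤ i`, `1 ≤ j ≤ m`, and of the `z ^ i * p` with
`0 ≤ i`. -/
def halfStrip (m : ℕ) (p : Laurent) : Submodule ℂ Laurent :=
  Supp {u | 0 ≤ u.1 ∧ 1 ≤ u.2 ∧ u.2 ≤ m} ⊔
    (Supp {u | 0 ≤ u.1 ∧ u.2 = 0}).map (LinearMap.mulRight ℂ p)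

lemma mul_mem_halfStrip {m : ℕ} {p f : Laurent} (hf : f ∈ Supp {u | 0 ≤ u.1 ∧ u.2 = 0}) :
    f * p ∈ halfStrip m p :=
  Submodule.mem_sup_right ⟨f, hf, rfl⟩

namespace IsFactor

variable {n m : ℕ} {c φ : ℤ × ℤ → ℂ} {p : Laurent} (h : IsFactor n m c p φ)

include h

lemma mem_Supp : p ∈ Supp {u | 0 ≤ u.1 ∧ u.1 ≤ n ∧ 0 ≤ u.2 ∧ u.2 ≤ m} := by
  refine Supp_mono ?_ h.mem
  intro u hu
  simp only [Set.mem_Icc, Prod.le_def] at hu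
  simp only [Set.mem_ofPred_eq]
  omega

lemma sharp_mem_Supp' : sharp p ∈ Supp {u | u.1 ≤ 0 ∧ -n ≤ u.1 ∧ u.2 ≤ 0 ∧ -m ≤ u.2} := by
  refine sharp_mem_Supp ?_ h.mem_Supp
  intro u hu
  simp only [Set.mem_ofPred_eq, Prod.fst_neg, Prod.snd_neg] at *
  omega

/-- Coefficients with large index are given by the inner product with an element of the
half strip. -/
lemma exists_reproducing {N l : ℤ} (hN : n ≤ N) (hl : 0 ≤ l) (hlm : l ≤ m) :
    ∃ x ∈ halfStrip m p, ∀ F ∈ ((strip m).map (synth h.summable)).topologicalClosure,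
      inner ℂ (synth h.summable x) F = conv p F (N, l) := by
  -- The element `q p = q' p^♯` represents the coefficient but leaves the strip. Cutting `q` below
  -- row `0` and `q'` above row `m` removes only terms orthogonal to the strip. The row `A₀` must be
  -- kept as a multiple of `p`, since plain monomials in `halfStrip` start at row `1`.
  set q := mono (N, l) * sharp p with hq
  set q' := mono (N, l) * p with hq'
  set A := part {u : ℤ × ℤ | 0 ≤ u.2} q with hA
  set B := part {u : ℤ × ℤ | m + 1 ≤ u.2} q' with hB
  set A₀ := part {u : ℤ × ℤ | u.2 ≤ 0} A with hA₀
  have hp := h.mem_Supp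
  have hp' := h.sharp_mem_Supp'
  have hqS : q ∈ Supp {u | 0 ≤ u.1 ∧ u.2 ≤ l} :=
    mul_mem_Supp (S := {(N, l)}) (by
      rintro u rfl v hv
      simp only [Set.mem_ofPred_eq, Prod.fst_add, Prod.snd_add] at *
      omega) (mono_mem_Supp rfl) hp'
  have hqS' : q' ∈ Supp {u | N ≤ u.1} :=
    mul_mem_Supp (S := {(N, l)}) (by
      rintro u rfl v hv
      simp only [Set.mem_ofPred_eq, Prod.fst_add] at *
      omega) (mono_mem_Supp rfl) hp
  have hAS : A ∈ Supp _ := part_mem hqS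
  have hBS : B ∈ Supp _ := part_mem hqS'
  have hAS' : q - A ∈ Supp _ := sub_part_mem hqS
  have hBS' : q' - B ∈ Supp _ := sub_part_mem hqS'
  have hA₀S : A₀ ∈ Supp _ := part_mem hAS
  have hA₀S' : A - A₀ ∈ Supp _ := sub_part_mem hAS
  -- Two expressions for the same element: the first bounds its exponents below, with `N ≥ n`
  -- keeping the `z`-exponents nonnegative, and the second bounds the `w`-exponents above by `m`.
  have e1 : A * p - B * sharp p - A₀ * p = (A - A₀) * p - B * sharp p := by ring
  have e2 : A * p - B * sharp p - A₀ * p = (q' - B) * sharp p - (q - A) * p - A₀ * p := by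
    rw [hq, hq']
    ring
  have hy1 : A * p - B * sharp p - A₀ * p ∈ Supp {u | 0 ≤ u.1 ∧ 1 ≤ u.2} := by
    rw [e1]
    refine Submodule.sub_mem _ (mul_mem_Supp ?_ hA₀S' hp) (mul_mem_Supp ?_ hBS hp')
    all_goals
      intro u hu v hv
      simp only [Set.mem_ofPred_eq, Set.mem_inter_iff, Set.mem_sdiff, Prod.fst_add,
        Prod.snd_add] at *
      omega
  have hy2 : A * p - B * sharp p - A₀ * p ∈ Supp {u | u.2 ≤ m} := by
    rw [e2]
    refine Submodule.sub_mem _ (Submodule.sub_mem _ (mul_mem_Supp ?_ hBS' hp')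
      (mul_mem_Supp ?_ hAS' hp)) (mul_mem_Supp ?_ hA₀S hp)
    all_goals
      intro u hu v hv
      simp only [Set.mem_ofPred_eq, Set.mem_inter_iff, Set.mem_sdiff, Prod.snd_add] at *
      omega
  refine ⟨A * p - B * sharp p, ?_, fun F hF => ?_⟩
  · have e : A * p - B * sharp p = (A * p - B * sharp p - A₀ * p) + A₀ * p := by ring
    rw [e]
    refine Submodule.add_mem _ (Submodule.mem_sup_left ?_) (mul_mem_halfStrip ?_)
    · refine Supp_mono ?_ (mem_Supp_inter hy1 hy2)
      intro u hu
      simp only [Set.mem_ofPred_eq, Set.mem_inter_iff] at *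
      omega
    · refine Supp_mono ?_ hA₀S
      intro u hu
      simp only [Set.mem_ofPred_eq, Set.mem_inter_iff] at *
      omega
  · refine eqOn_topologicalClosure (α := fun F => inner ℂ (synth h.summable _) F)
      (continuous_const.inner continuous_id) (continuous_conv p (N, l)) ?_ hF
    rintro _ ⟨f, hf, rfl⟩
    have hf0 : f ∈ Supp {u | 0 ≤ u.2} := Supp_mono (fun u hu => hu.1) hf
    have hf1 : sharp f ∈ Supp {u | -(m : ℤ) ≤ u.2} := sharp_mem_Supp (fun u hu => by
      have := hu.2
      simp only [Set.mem_ofPred_eq, Prod.snd_neg]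
      omega) hf
    have i1 : inner ℂ (synth h.summable ((q - A) * p)) (synth h.summable f) = 0 := by
      refine h.inner_synth_mul_eq_zero fun u hu => h.synth_eq_zero hf0 ?_
      by_contra hu'
      refine hu (mem_Supp_iff.mp hAS' u ?_)
      simp only [Set.mem_ofPred_eq, Set.mem_sdiff] at *
      omega
    -- Reflection reduces this to the previous case: `sharp B` has exponents below `-m` in `w`,
    -- where the image of `sharp f` vanishes.
    have i2 : inner ℂ (synth h.summable (B * sharp p)) (synth h.summable f) = 0 := by
      have : B * sharp p = sharp (sharp B * p) := by rw [sharp_mul, sharp_sharp]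
      rw [this, ← sharp_sharp f, inner_synth_sharp, ← inner_conj_symm]
      rw [h.inner_synth_mul_eq_zero, map_zero]
      refine fun u hu => h.synth_eq_zero hf1 ?_
      by_contra hu'
      refine hu ?_
      rw [sharp_coeff, mem_Supp_iff.mp hBS, map_zero]
      simp only [Set.mem_ofPred_eq, Set.mem_inter_iff, Prod.snd_neg] at *
      omega
    have e : A * p - B * sharp p = q * p - (q - A) * p - B * sharp p := by ring
    dsimp only
    rw [e, map_sub, map_sub, inner_sub_left, inner_sub_left, i1, i2, sub_zero, sub_zero,
      h.inner_synth_sharp_mul]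

lemma halfStrip_le : halfStrip m p ≤ Supp {u | 0 ≤ u.1 ∧ 0 ≤ u.2 ∧ u.2 ≤ m} := by
  refine sup_le (Supp_mono ?_) ?_
  · intro u hu
    simp only [Set.mem_ofPred_eq] at *
    omega
  · rintro _ ⟨f, hf, rfl⟩
    refine mul_mem_Supp ?_ hf h.mem_Supp
    intro u hu v hv
    simp only [Set.mem_ofPred_eq, Prod.fst_add, Prod.snd_add] at *
    omega

/-- The closed span of the half strip in `ℓ²(ℤ²)`. -/
def closedHalfStrip : Submodule ℂ Seq :=
  ((halfStrip m p).map (synth h.summable)).topologicalClosure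

instance : CompleteSpace h.closedHalfStrip :=
  (Submodule.isClosed_topologicalClosure _).completeSpace_coe

lemma synth_mem {f : Laurent} (hf : f ∈ halfStrip m p) :
    synth h.summable f ∈ h.closedHalfStrip :=
  Submodule.le_topologicalClosure _ ⟨f, hf, rfl⟩

lemma synth_mem_orthogonal {f : Laurent}
    (hf : ∀ q ∈ halfStrip m p, inner ℂ (synth h.summable f) (synth h.summable q) = 0) :
    synth h.summable f ∈ h.closedHalfStripᗮ := by
  rw [Submodule.mem_orthogonal']
  intro F hF
  refine eqOn_topologicalClosure (α := fun F => inner ℂ (synth h.summable f) F)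
    (continuous_const.inner continuous_id) (continuous_const (y := (0 : ℂ))) ?_ hF
  rintro _ ⟨q, hq, rfl⟩
  exact hf q hq

lemma conv_eq_zero {F : Seq} (hF : F ∈ h.closedHalfStrip) {u : ℤ × ℤ}
    (hu : ¬ (0 ≤ u.1 ∧ 0 ≤ u.2 ∧ u.2 ≤ m)) : conv p F u = 0 := by
  refine eqOn_topologicalClosure (continuous_conv p u) (continuous_const (y := (0 : ℂ))) ?_ hF
  rintro _ ⟨q, hq, rfl⟩
  rw [h.conv_synth]
  exact mem_Supp_iff.mp (h.halfStrip_le hq) u hu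

lemma apply_eq_zero_of_neg {F : Seq} (hF : F ∈ h.closedHalfStrip) {u : ℤ × ℤ} (hu : u.2 < 0) :
    F u = 0 := by
  refine eqOn_topologicalClosure (continuous_seq_apply u) (continuous_const (y := (0 : ℂ))) ?_ hF
  rintro _ ⟨q, hq, rfl⟩
  refine h.synth_eq_zero (b := 0) (Supp_mono ?_ (h.halfStrip_le hq)) hu
  exact fun v hv => hv.2.1

/-- On row `0` the monomials with positive `w`-exponent contribute nothing, and a multiple of `p`
reduces to its cofactor. -/
lemma apply_row_eq_zero {F : Seq} (hF : F ∈ h.closedHalfStrip) {k : ℤ} (hk : k < 0) :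
    F (k, 0) = 0 := by
  refine eqOn_topologicalClosure (continuous_seq_apply (k, 0)) (continuous_const (y := (0 : ℂ)))
    ?_ hF
  rintro _ ⟨q, hq, rfl⟩
  obtain ⟨f, hf, _, ⟨g, hg, rfl⟩, rfl⟩ := Submodule.mem_sup.mp hq
  rw [map_add, lp.coeFn_add, Pi.add_apply, h.synth_eq_zero (b := 1) (Supp_mono ?_ hf),
    LinearMap.mulRight_apply, h.synth_mul, zero_add]
  · refine mem_Supp_iff.mp hg _ fun hk' => ?_
    have := hk'.1
    simp only at this
    omega
  · simp
  · exact fun v hv => hv.2.1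

/-- The projection onto the closed half strip of an element whose coefficients with large index
vanish is a polynomial. -/
lemma exists_projection {Y : Seq} (hY : Y ∈ ((strip m).map (synth h.summable)).topologicalClosure)
    (hc : ∀ u : ℤ × ℤ, n ≤ u.1 → conv p Y u = 0) :
    ∃ g ∈ P ((n : ℤ) - 1) m, synth h.summable g = h.closedHalfStrip.starProjection Y := by
  set G := h.closedHalfStrip.starProjection Y with hG
  have hGm : G ∈ h.closedHalfStrip := Submodule.starProjection_apply_mem _ _
  have hle : h.closedHalfStrip ≤ ((strip m).map (synth h.summable)).topologicalClosure := by
    refine Submodule.topologicalClosure_mono (Submodule.map_mono (h.halfStrip_le.trans ?_))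
    exact Supp_mono fun u hu => hu.2
  have hperp : Y - G ∈ h.closedHalfStripᗮ := Submodule.sub_starProjection_mem_orthogonal _
  -- In the strip this coefficient functional is represented by an element of the half strip, so it
  -- does not see `Y - G` and agrees on `Y` and its projection.
  have hlarge (u : ℤ × ℤ) (hu : n ≤ u.1) : conv p G u = 0 := by
    by_cases hu2 : 0 ≤ u.2 ∧ u.2 ≤ m
    · obtain ⟨x, hx, hx'⟩ := h.exists_reproducing hu hu2.1 hu2.2
      have h1 := hx' (Y - G) (Submodule.sub_mem _ hY (hle hGm))
      rw [(Submodule.mem_orthogonal _ _).mp hperp _ (h.synth_mem hx), lp.coeFn_sub, conv_sub,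
        hc u hu, zero_sub, eq_comm, neg_eq_zero] at h1
      exact h1
    · exact h.conv_eq_zero hGm fun h' => hu2 h'.2
  -- Only finitely many coefficients of `p * G` survive. They define `g`, and injectivity of
  -- convolution with `p` identifies its image with `G`.
  set g : Laurent := ∑ u ∈ Finset.Icc ((0 : ℤ), (0 : ℤ)) ((n : ℤ) - 1, (m : ℤ)),
    conv p G u • mono u with hg
  have hgc (u : ℤ × ℤ) : g.coeff u = conv p G u := by
    have e : g.coeff u = if u ∈ Finset.Icc ((0 : ℤ), (0 : ℤ)) ((n : ℤ) - 1, (m : ℤ))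
        then conv p G u else 0 := by
      rw [hg, AddMonoidAlgebra.coeff_sum, Finsupp.finsetSum_apply]
      simp only [AddMonoidAlgebra.coeff_smul, Finsupp.smul_apply, mono_coeff, smul_eq_mul, mul_ite,
        mul_one, mul_zero]
      rw [Finset.sum_ite_eq']
    rw [e]
    split_ifs with hu
    · rfl
    · by_cases hn : (n : ℤ) ≤ u.1
      · exact (hlarge u hn).symm
      · refine (h.conv_eq_zero hGm fun h' => hu ?_).symm
        rw [Finset.mem_Icc, Prod.le_def, Prod.le_def]
        simp only
        omega
  refine ⟨g, Submodule.sum_mem _ fun u hu => Submodule.smul_mem _ _ (mono_mem_P ?_), ?_⟩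
  · simpa using hu
  · rw [← sub_eq_zero]
    refine h.eq_zero_of_conv _ fun u => ?_
    rw [lp.coeFn_sub, conv_sub, h.conv_synth, hgc, sub_self]

end IsFactor

end EAR

end

/-! ### The split shift produced by a factorization, and the causal case -/

noncomputable section

namespace EAR

open MeasureTheory Filter Topology
open scoped ComplexConjugate Pointwise ENNReal

lemma fourierForm_eq_liftMono {n m : ℕ} {c : ℤ × ℤ → ℂ} (f : L n m) :
    fourierForm n m c f = liftMono (fun u => c (-u)) f.1 := rfl

lemma mem_strip {m : ℕ} {f : Laurent} {k : ℤ} (hf : f ∈ P k m) : f ∈ strip m := by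
  refine Supp_mono ?_ hf
  intro u hu
  simp only [Set.mem_Icc, Prod.le_def] at hu
  exact ⟨hu.1.2, hu.2.2⟩

lemma mono_mem_halfStrip {m : ℕ} {p : Laurent} {u : ℤ × ℤ} (h1 : 0 ≤ u.1) (h2 : 1 ≤ u.2) (h3 : u.2 ≤ m) :
    mono u ∈ halfStrip m p :=
  Submodule.mem_sup_left (mono_mem_Supp ⟨h1, h2, h3⟩)

lemma z_mul_mem_halfStrip {m : ℕ} {p q : Laurent} (hq : q ∈ halfStrip m p) :
    mono (1, 0) * q ∈ halfStrip m p := by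
  obtain ⟨f, hf, _, ⟨g, hg, rfl⟩, rfl⟩ := Submodule.mem_sup.mp hq
  rw [mul_add, LinearMap.mulRight_apply, ← mul_assoc]
  refine Submodule.add_mem _ (Submodule.mem_sup_left (mul_mem_Supp (S := {(1, 0)}) ?_
    (mono_mem_Supp rfl) hf)) (mul_mem_halfStrip (mul_mem_Supp (S := {(1, 0)}) ?_
    (mono_mem_Supp rfl) hg))
  all_goals
    rintro u rfl v hv
    simp only [Set.mem_ofPred_eq, Prod.fst_add, Prod.snd_add] at *
    omega

namespace IsFactor

variable {n m : ℕ} {c φ : ℤ × ℤ → ℂ} {p : Laurent} (h : IsFactor n m c p φ)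

include h

lemma liftMono_mul_sharp {f g : Laurent} (hf : f ∈ P n m) (hg : g ∈ P n m) :
    liftMono (fun u => c (-u)) (f * sharp g) =
      inner ℂ (synth h.summable g) (synth h.summable f) := by
  induction hf using Submodule.span_induction with
  | zero => simp
  | add x y _ _ hx hy => rw [add_mul, map_add, hx, hy, map_add, inner_add_right]
  | smul a x _ hx => rw [smul_mul_assoc, map_smul, hx, map_smul, inner_smul_right, smul_eq_mul]
  | mem x hx =>
    obtain ⟨u, hu, rfl⟩ := hx
    induction hg using Submodule.span_induction with
    | zero => simp [sharp_zero]
    | add x y _ _ hx hy => rw [sharp_add, mul_add, map_add, hx, hy, map_add, inner_add_left]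
    | smul a x _ hx => rw [sharp_smul, mul_smul_comm, map_smul, hx, map_smul, inner_smul_left,
        smul_eq_mul]
    | mem x hx =>
      obtain ⟨v, hv, rfl⟩ := hx
      rw [sharp_mono, mono_mul, liftMono_mono, inner_synth_mono, h.cov_eq]
      · refine tsum_congr fun j => ?_
        rw [← sub_eq_add_neg u v, neg_sub]
      · simp only [Set.mem_Icc, Prod.le_def, Prod.fst_neg, Prod.snd_neg, Prod.fst_add,
          Prod.snd_add] at *
        omega

/-- The form is the Gram form of the injective map `synth`. -/
lemma isPositive : IsPositive (fourierForm n m c) := by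
  intro f hf
  have e : ip (fourierForm n m c) f f =
      ((‖synth h.summable f.1‖ ^ 2 : ℝ) : ℂ) := by
    rw [ip, fourierForm_eq_liftMono, h.liftMono_mul_sharp f.2 f.2, inner_self_eq_norm_sq_to_K]
    simp
  have hne : synth h.summable f.1 ≠ 0 := by
    rw [← map_zero (synth h.summable)]
    exact fun h' => hf (Subtype.ext (h.synth_injective h'))
  rw [e, Complex.ofReal_re, Complex.ofReal_im]
  exact ⟨by positivity, rfl⟩

lemma inner_eq_synth (f g : HT (fourierForm n m c) h.isPositive) :
    inner ℂ f g =
      inner ℂ (synth h.summable (toLaurent h.isPositive f))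
        (synth h.summable (toLaurent h.isPositive g)) :=
  h.liftMono_mul_sharp (toLaurent_mem _ g) (toLaurent_mem _ f)

/-- An element of `P_{k,m}` orthogonal to the monomials `z ^ i * w ^ j`, `j ≥ 1`, is in
`E¹_{k,m}`. -/
lemma mem_E1 {k : ℤ} {f : HT (fourierForm n m c) h.isPositive}
    (hf : f ∈ polys h.isPositive k m)
    (ho : ∀ i j : ℤ, 0 ≤ i → i ≤ k → 1 ≤ j → j ≤ m →
      inner ℂ (synth h.summable (mono (i, j)))
        (synth h.summable (toLaurent h.isPositive f)) = 0) :
    f ∈ E1 h.isPositive k m := by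
  rw [mem_E1_iff]
  refine ⟨hf, fun g hg => ?_⟩
  obtain ⟨g', hg', he⟩ := (mem_shift_iff _).mp hg
  rw [h.inner_eq_synth, he]
  have hg'' : toLaurent h.isPositive g' ∈ P k ((m : ℤ) - 1) := hg'
  generalize toLaurent h.isPositive g' = q at hg''
  induction hg'' using Submodule.span_induction with
  | zero => simp
  | add x y _ _ hx hy => rw [mul_add, map_add, inner_add_left, hx, hy, add_zero]
  | smul a x _ hx => rw [mul_smul_comm, map_smul, inner_smul_left, hx, mul_zero]
  | mem x hx =>
    obtain ⟨u, hu, rfl⟩ := hx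
    simp only [Set.mem_Icc, Prod.le_def] at hu
    rw [mono_mul]
    exact ho _ _ (by omega) (by omega) (by omega) (by omega)

lemma inner_mono_eq_zero {k : ℤ} (hk : k ≤ n) {f : HT (fourierForm n m c) h.isPositive}
    (hf : f ∈ E1 h.isPositive k m) {i j : ℤ} (h1 : 0 ≤ i) (h2 : i ≤ k) (h3 : 1 ≤ j) (h4 : j ≤ m) :
    inner ℂ (synth h.summable (mono (i, j)))
        (synth h.summable (toLaurent h.isPositive f)) = 0 := by
  have hu : mono (i, j) ∈ P n m := mono_mem_P (by
    simp only [Set.mem_Icc, Prod.le_def]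
    omega)
  have := ((mem_E1_iff _).mp hf).2 (ofLaurent h.isPositive _ hu) ?_
  · rwa [h.inner_eq_synth] at this
  · rw [mem_shift_w_iff _ hk le_rfl, mem_polys_iff]
    simp only [cf_apply, toLaurent_ofLaurent, mono_coeff]
    refine ⟨fun u hu' => if_neg ?_, fun i' => if_neg ?_⟩
    · rintro rfl
      simp only [Set.mem_Icc, Prod.le_def] at hu'
      omega
    · simp only [Prod.mk.injEq, not_and]
      omega

/-- The elements of `P_{n-1,m}` orthogonal to the half strip. -/
def orthPart : Submodule ℂ (HT (fourierForm n m c) h.isPositive) :=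
  polys h.isPositive ((n : ℤ) - 1) m ⊓
    h.closedHalfStripᗮ.comap (synth h.summable ∘ₗ toLaurent h.isPositive)

/-- The elements of `E¹_{n-1,m}` in the closed half strip. -/
def innerPart : Submodule ℂ (HT (fourierForm n m c) h.isPositive) :=
  E1 h.isPositive ((n : ℤ) - 1) m ⊓
    h.closedHalfStrip.comap (synth h.summable ∘ₗ toLaurent h.isPositive)

lemma orthPart_le {k : ℤ} (hk : (n : ℤ) - 1 ≤ k) :
    h.orthPart ≤ E1 h.isPositive k m := by
  rintro f ⟨hf, hfo⟩
  refine h.mem_E1 (polys_mono _ hk le_rfl hf) fun i j hi _ hj hjm => ?_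
  exact (Submodule.mem_orthogonal _ _).mp hfo _ (h.synth_mem (mono_mem_halfStrip hi hj hjm))

/-- The projection of an element of `E¹_{n-1,m}` onto the closed half strip is again in `P_{n-1,m}`
by `exists_projection`. The remainder is in `orthPart`, which lies in `E¹_{n-1,m}`, hence so does
the projection. -/
lemma orthPart_sup_innerPart : h.orthPart ⊔ h.innerPart = E1 h.isPositive ((n : ℤ) - 1) m := by
  refine le_antisymm (sup_le (h.orthPart_le le_rfl) inf_le_left) fun f hf => ?_
  have hfp : toLaurent h.isPositive f ∈ P ((n : ℤ) - 1) m := ((mem_E1_iff _).mp hf).1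
  obtain ⟨g, hg, hg'⟩ := h.exists_projection
    (Submodule.le_topologicalClosure _ ⟨_, mem_strip hfp, rfl⟩) (fun u hu => by
      rw [h.conv_synth, mem_P_iff.mp hfp]
      simp only [Set.mem_Icc, Prod.le_def]
      omega)
  have hgn : g ∈ P n m := by
    have := mem_P_iff.mp hg
    refine mem_P_iff.mpr fun u hu => this u fun hu' => hu ?_
    simp only [Set.mem_Icc, Prod.le_def] at *
    omega
  set G := ofLaurent h.isPositive g hgn with hG
  have h1 : f - G ∈ h.orthPart := by
    refine ⟨Submodule.sub_mem _ hfp hg, ?_⟩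
    rw [SetLike.mem_coe, Submodule.mem_comap, LinearMap.comp_apply, map_sub, map_sub, hG, toLaurent_ofLaurent, hg']
    exact Submodule.sub_starProjection_mem_orthogonal _
  have h2 : G ∈ h.innerPart := by
    refine ⟨?_, ?_⟩
    · have := Submodule.sub_mem _ hf (h.orthPart_le le_rfl h1)
      rwa [sub_sub_cancel] at this
    · rw [SetLike.mem_coe, Submodule.mem_comap, LinearMap.comp_apply, hG, toLaurent_ofLaurent, hg']
      exact Submodule.starProjection_apply_mem _ _
  have e : f = (f - G) + G := by abel
  rw [e]
  exact Submodule.add_mem_sup h1 h2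

lemma orthPart_isOrtho : h.orthPart ⟂ h.innerPart := by
  rw [Submodule.isOrtho_iff_inner_eq]
  rintro f ⟨-, hf⟩ g ⟨-, hg⟩
  rw [h.inner_eq_synth]
  exact (Submodule.mem_orthogonal' _ _).mp hf _ hg

/-- The half strip is invariant under `z`, so dividing an element orthogonal to it by `z` preserves
the orthogonality. -/
lemma orthPart_isOrtho_shift : h.orthPart ⟂ shift h.isPositive (1, 0) h.innerPart := by
  rw [Submodule.isOrtho_iff_inner_eq]
  rintro f ⟨-, hf⟩ g hg
  obtain ⟨g', ⟨-, hg'⟩, he⟩ := (mem_shift_iff _).mp hg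
  rw [h.inner_eq_synth, he, ← mono_mul_cancel (1, 0) (toLaurent h.isPositive f),
    inner_synth_mono_mul]
  refine (Submodule.mem_orthogonal' _ _).mp (h.synth_mem_orthogonal fun q hq => ?_) _ hg'
  rw [← inner_synth_mono_mul h.summable (1, 0), mono_mul_cancel]
  exact (Submodule.mem_orthogonal' _ _).mp hf _ (h.synth_mem (z_mul_mem_halfStrip hq))

lemma shift_innerPart_le : shift h.isPositive (1, 0) h.innerPart ≤ E1 h.isPositive n m := by
  intro g hg
  obtain ⟨f, ⟨hf, hfc⟩, he⟩ := (mem_shift_iff _).mp hg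
  refine h.mem_E1 (toLaurent_mem _ g) fun i j hi hin hj hjm => ?_
  have e : mono (i, j) = mono (1, 0) * mono (i - 1, j) := by rw [mono_mul]; simp
  rw [he, e, inner_synth_mono_mul]
  rcases hi.lt_or_eq with hi | rfl
  · exact h.inner_mono_eq_zero (by omega) hf (by omega) (by omega) hj hjm
  -- After division by `z`, the only new condition concerns `z^{-1} w^j`. As `f` is in the closed
  -- half strip, this monomial may be replaced by its projection, a polynomial `q`. It remains to
  -- see that `q` is divisible by `w`.
  set Y := synth h.summable (mono (0 - 1, j)) with hY
  have hYm : mono (0 - 1, j) ∈ strip m := mono_mem_Supp ⟨by simp only; omega, hjm⟩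
  obtain ⟨q, hq, hq'⟩ := h.exists_projection
    (Submodule.le_topologicalClosure _ ⟨_, hYm, rfl⟩) (fun u hu => by
      rw [h.conv_synth, mono_coeff, if_neg]
      rintro rfl
      simp only at hu
      omega)
  rw [← hY] at hq'
  have hperp : Y - synth h.summable q ∈ h.closedHalfStripᗮ := by
    rw [hq']
    exact Submodule.sub_starProjection_mem_orthogonal _
  have hqc : synth h.summable q ∈ h.closedHalfStrip := by
    rw [hq']
    exact Submodule.starProjection_apply_mem _ _
  -- For `i ≥ 0` the value is tested against `z^i p`, to which `Y - q` is orthogonal, and `Y`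
  -- vanishes on row `0` because `j ≥ 1`.
  have hrow (i : ℤ) : synth h.summable q (i, 0) = 0 := by
    rcases lt_or_ge i 0 with hi | hi
    · exact h.apply_row_eq_zero hqc hi
    · have h1 := (Submodule.mem_orthogonal _ _).mp hperp _
        (h.synth_mem (mul_mem_halfStrip (f := mono (i, 0)) (mono_mem_Supp ⟨hi, rfl⟩)))
      rw [h.inner_synth_mono_mul_self, lp.coeFn_sub, Pi.sub_apply, hY, synth_mono, h.eq_zero,
        zero_sub, neg_eq_zero] at h1
      · exact h1
      · simp only [Prod.snd_sub]
        omega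
  have hrow0 (i : ℤ) : q.coeff (i, 0) = 0 := by
    rw [← h.conv_synth, conv, Finsupp.sum]
    refine Finset.sum_eq_zero fun k hk => ?_
    have hk0 : 0 ≤ k.2 := by
      by_contra hk0
      refine (Finsupp.mem_support_iff.mp hk) (mem_Supp_iff.mp h.mem_Supp k fun hk' => hk0 ?_)
      exact hk'.2.2.1
    rcases hk0.lt_or_eq with hk0 | hk0
    · rw [h.apply_eq_zero_of_neg hqc (by simpa using hk0), mul_zero]
    · have : ((i, 0) : ℤ × ℤ) - k = (i - k.1, 0) := by
        ext
        · rfl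
        · simp [← hk0]
      rw [this, hrow, mul_zero]
  have h1 : inner ℂ Y (synth h.summable (toLaurent h.isPositive f)) =
      inner ℂ (synth h.summable q) (synth h.summable (toLaurent h.isPositive f)) := by
    rw [← sub_eq_zero, ← inner_sub_left]
    exact (Submodule.mem_orthogonal' _ _).mp hperp _ hfc
  rw [h1]
  have hqn : q ∈ P n m := by
    have := mem_P_iff.mp hq
    refine mem_P_iff.mpr fun u hu => this u fun hu' => hu ?_
    simp only [Set.mem_Icc, Prod.le_def] at *
    omega
  have h2 := ((mem_E1_iff _).mp hf).2 (ofLaurent h.isPositive q hqn)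
    ((mem_shift_w_iff _ (by omega) le_rfl).mpr ⟨hq, hrow0⟩)
  rwa [h.inner_eq_synth] at h2

theorem splitShift : SplitShift h.isPositive :=
  ⟨h.orthPart, h.innerPart, ⟨h.orthPart_isOrtho, h.orthPart_sup_innerPart⟩,
    h.orthPart_isOrtho_shift, h.orthPart_le (by omega), h.shift_innerPart_le⟩

/-- For causal `φ`, the image of an element of `orthPart` vanishes on row `0`: at negative indices
by causality, at the others by orthogonality to `z^i p`. Convolving with `p`, its terms of degree
`0` in `w` vanish, so the element is zero. Thus all of `E¹_{n-1,m}` is `innerPart`. -/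
theorem opA_eq_zero (hφ : ∀ k < 0, φ (k, 0) = 0) : opA h.isPositive = 0 := by
  have hbot : h.orthPart = ⊥ := by
    rw [eq_bot_iff]
    intro f hfm
    obtain ⟨hf, hfo⟩ := hfm
    have hfS : toLaurent h.isPositive f ∈ Supp {u | 0 ≤ u.1 ∧ 0 ≤ u.2} := by
      refine Supp_mono ?_ (toLaurent_mem h.isPositive f)
      intro u hu
      simp only [Set.mem_Icc, Prod.le_def] at hu
      exact ⟨hu.1.1, hu.1.2⟩
    have hrow (i : ℤ) : synth h.summable (toLaurent h.isPositive f) (i, 0) = 0 := by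
      rcases lt_or_ge i 0 with hi | hi
      · rw [synth_apply, conv, Finsupp.sum]
        refine Finset.sum_eq_zero fun k hk => ?_
        have hk0 : 0 ≤ k.1 ∧ 0 ≤ k.2 := by
          by_contra hk0
          exact (Finsupp.mem_support_iff.mp hk) (mem_Supp_iff.mp hfS k hk0)
        rcases hk0.2.lt_or_eq with hk2 | hk2
        · rw [h.eq_zero _ (by simpa using hk2), mul_zero]
        · have : ((i, 0) : ℤ × ℤ) - k = (i - k.1, 0) := by
            ext
            · rfl
            · simp [← hk2]
          rw [this, hφ _ (by omega), mul_zero]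
      · have h1 := (Submodule.mem_orthogonal _ _).mp hfo _
          (h.synth_mem (mul_mem_halfStrip (f := mono (i, 0)) (mono_mem_Supp ⟨hi, rfl⟩)))
        rwa [h.inner_synth_mono_mul_self] at h1
    have hf0 := h.orthPart_le (k := (n : ℤ) - 1) le_rfl ⟨hf, hfo⟩
    rw [Submodule.mem_bot]
    refine eq_zero_of_mem_E1 _ (by omega) le_rfl hf0 fun i => ?_
    rw [cf_apply, ← h.conv_synth, conv, Finsupp.sum]
    refine Finset.sum_eq_zero fun k hk => ?_
    have hk0 : 0 ≤ k.2 := by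
      by_contra hk0
      refine (Finsupp.mem_support_iff.mp hk) (mem_Supp_iff.mp h.mem_Supp k fun hk' => hk0 ?_)
      exact hk'.2.2.1
    rcases hk0.lt_or_eq with hk0 | hk0
    · rw [h.synth_eq_zero (b := 0) (Supp_mono (fun u hu => hu.2) hfS) (by simpa using hk0),
        mul_zero]
    · have : ((i, 0) : ℤ × ℤ) - k = (i - k.1, 0) := by
        ext
        · rfl
        · simp [← hk0]
      rw [this, hrow, mul_zero]
  rw [opA_eq_zero_iff_forall]
  intro f hf
  have hf' : f ∈ h.innerPart := by
    have := h.orthPart_sup_innerPart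
    rw [hbot, bot_sup_eq] at this
    rwa [this]
  refine h.shift_innerPart_le (sh_mem_shift _ (k := (n : ℤ) - 1) (l := m) (by simp) (by simp)
    (by simp) ?_ hf')
  exact fun g hg => ((mem_E1_iff _).mp hg.1).1

end IsFactor

end EAR

end

noncomputable section

namespace EAR

open MeasureTheory Filter Topology
open scoped ComplexConjugate Pointwise ENNReal

/-! ## Fourier coefficients of `1 / p` -/

lemma mean_swap {F : ℝ → ℝ → ℂ} (hF : Continuous fun x : ℝ × ℝ => F x.1 x.2) :
    (mean fun s => mean fun t => F s t) = mean fun t => mean fun s => F s t := by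
  simp_rw [mean, intervalIntegral.integral_const_mul]
  congr 2
  simp_rw [intervalIntegral.integral_of_le Real.two_pi_pos.le]
  refine integral_integral_swap ?_
  rw [Measure.prod_restrict]
  refine Integrable.mono_measure (ν := (volume.prod volume).restrict
    (Set.Icc 0 (2 * Real.pi) ×ˢ Set.Icc 0 (2 * Real.pi))) ?_ ?_
  · exact hF.continuousOn.integrableOn_compact (isCompact_Icc.prod isCompact_Icc)
  · exact Measure.restrict_mono
      (Set.prod_mono Set.Ioc_subset_Icc_self Set.Ioc_subset_Icc_self) le_rfl

lemma circleAverage_eq_of_differentiableAt {f : ℂ → ℂ} {r R : ℝ} (h0 : 0 < r) (hle : r ≤ R)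
    (hf : ∀ z : ℂ, r ≤ ‖z‖ → ‖z‖ ≤ R → DifferentiableAt ℂ f z) :
    Real.circleAverage f 0 R = Real.circleAverage f 0 r := by
  rw [Real.circleAverage_eq_circleIntegral (h0.trans_le hle).ne',
    Real.circleAverage_eq_circleIntegral h0.ne']
  congr 1
  refine Complex.circleIntegral_sub_center_inv_smul_eq_of_differentiable_on_annulus_off_countable
    h0 hle Set.countable_empty ?_ ?_
  · intro z hz
    simp only [Set.mem_sdiff, Metric.mem_closedBall, Metric.mem_ball, dist_zero_right,
      not_lt] at hz
    exact (hf z hz.2 hz.1).continuousAt.continuousWithinAt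
  · intro z hz
    simp only [Set.mem_sdiff, Metric.mem_closedBall, Metric.mem_ball, dist_zero_right,
      not_le, Set.mem_empty_iff_false, not_false_eq_true, and_true] at hz
    exact hf z hz.2.le hz.1.le

lemma exists_exp_mul_circ {z : ℂ} (hz : z ≠ 0) :
    ∃ t, z = Real.exp (Real.log ‖z‖) * circ t := by
  refine ⟨z.arg, ?_⟩
  rw [Real.exp_log (norm_pos_iff.mpr hz)]
  exact (Complex.norm_mul_exp_arg_mul_I z).symm

lemma norm_exp_mul_circ (a t : ℝ) : ‖(Real.exp a : ℂ) * circ t‖ = Real.exp a := by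
  rw [norm_mul, norm_circ, mul_one, Complex.norm_real, Real.norm_of_nonneg (Real.exp_pos a).le]

/-- Cauchy's theorem in an annulus: the mean does not depend on the radius. -/
lemma mean_exp_mul {f : ℂ → ℂ} {ε a : ℝ} (ha : |a| ≤ ε)
    (hf : ∀ b t : ℝ, |b| ≤ ε → DifferentiableAt ℂ f (Real.exp b * circ t)) :
    (mean fun t => f (Real.exp a * circ t)) = mean fun t => f (circ t) := by
  have e (b : ℝ) : (mean fun t => f (Real.exp b * circ t)) =
      Real.circleAverage f 0 (Real.exp b) := by
    rw [mean, Real.circleAverage_def, Complex.real_smul, Complex.ofReal_inv]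
    simp_rw [circ, circleMap, zero_add]
  have hd (b₁ b₂ : ℝ) (h1 : -ε ≤ b₁) (h2 : b₂ ≤ ε) (h12 : b₁ ≤ b₂) :
      Real.circleAverage f 0 (Real.exp b₂) = Real.circleAverage f 0 (Real.exp b₁) := by
    refine circleAverage_eq_of_differentiableAt (Real.exp_pos _) (Real.exp_le_exp.mpr h12)
      fun z hz1 hz2 => ?_
    have hz : 0 < ‖z‖ := (Real.exp_pos _).trans_le hz1
    obtain ⟨t, ht⟩ := exists_exp_mul_circ (norm_pos_iff.mp hz)
    rw [ht]
    refine hf _ t (abs_le.mpr ⟨h1.trans ?_, le_trans ?_ h2⟩)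
    · exact (Real.le_log_iff_exp_le hz).mpr hz1
    · exact (Real.log_le_iff_le_exp hz).mpr hz2
  have h0 : (mean fun t => f (circ t)) = Real.circleAverage f 0 (Real.exp 0) := by
    rw [mean_eq_circleAverage, Real.exp_zero]
  obtain ⟨h1, h2⟩ := abs_le.mp ha
  rw [e, h0]
  rcases le_total a 0 with h | h
  · exact (hd a 0 h1 (by linarith) h).symm
  · exact hd 0 a (by linarith) h2 h

/-- The Fourier coefficients of a function holomorphic in an annulus decay exponentially. -/
lemma norm_mean_zpow_mul_le {g : ℂ → ℂ} {ε C : ℝ} (hε : 0 ≤ ε)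
    (hg : ∀ b t : ℝ, |b| ≤ ε → DifferentiableAt ℂ g (Real.exp b * circ t))
    (hC : ∀ b t : ℝ, |b| ≤ ε → ‖g (Real.exp b * circ t)‖ ≤ C) (k : ℤ) :
    ‖mean fun t => circ t ^ (-k) * g (circ t)‖ ≤ C * Real.exp (-(ε * |(k : ℝ)|)) := by
  -- The contour is moved outwards or inwards according to the sign of `k`, so that `z ^ (-k)` has
  -- size `exp (-ε |k|)` on it.
  obtain ⟨a, ha, hak⟩ : ∃ a : ℝ, |a| ≤ ε ∧ a * k = ε * |(k : ℝ)| := by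
    rcases le_total 0 (k : ℝ) with h | h
    · exact ⟨ε, (abs_of_nonneg hε).le, by rw [abs_of_nonneg h]⟩
    · exact ⟨-ε, by rw [abs_neg, abs_of_nonneg hε], by rw [abs_of_nonpos h]; ring⟩
  have hne (b t : ℝ) : (Real.exp b : ℂ) * circ t ≠ 0 := by
    rw [← norm_pos_iff, norm_exp_mul_circ]
    exact Real.exp_pos b
  rw [← mean_exp_mul (f := fun z => z ^ (-k) * g z) ha fun b t hb =>
    (differentiableAt_zpow.mpr (Or.inl (hne b t))).mul (hg b t hb)]
  refine norm_mean_le fun t => ?_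
  rw [norm_mul, norm_zpow, norm_exp_mul_circ, mul_comm C, ← hak, ← mul_neg, ← Int.cast_neg,
    Real.exp_mul, Real.rpow_intCast]
  exact mul_le_mul_of_nonneg_left (hC a t ha) (by positivity)

lemma summable_exp_neg_abs {ε : ℝ} (hε : 0 < ε) : Summable fun k : ℤ => Real.exp (-(ε * |(k : ℝ)|)) := by
  have h : Summable fun k : ℕ => Real.exp (-(ε * (k : ℝ))) := by
    have := summable_geometric_of_lt_one (Real.exp_pos (-ε)).le (Real.exp_lt_one_iff.mpr (by linarith))
    refine this.congr fun k => ?_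
    rw [← Real.exp_nat_mul]
    ring_nf
  refine Summable.of_nat_of_neg ?_ ?_
  · simpa using h
  · simpa using h

/-- A function of exponential decay in each variable is summable. -/
lemma summable_of_exp_bound {φ : ℤ × ℤ → ℂ} {ε C : ℝ} (hε : 0 < ε)
    (h1 : ∀ u, ‖φ u‖ ≤ C * Real.exp (-(ε * |(u.1 : ℝ)|)))
    (h2 : ∀ u, ‖φ u‖ ≤ C * Real.exp (-(ε * |(u.2 : ℝ)|))) : Summable fun u => ‖φ u‖ := by
  -- The maximum of two numbers is at least their average, so decay in each variable at rate `ε`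
  -- gives a product bound at rate `ε / 2`.
  have hs := summable_exp_neg_abs (half_pos hε)
  have hp := (hs.mul_of_nonneg hs (fun _ => (Real.exp_pos _).le)
    (fun _ => (Real.exp_pos _).le)).mul_left C
  refine Summable.of_nonneg_of_le (fun _ => norm_nonneg _) (fun u => ?_) hp
  have hC : 0 ≤ C := by
    have := (norm_nonneg _).trans (h1 0)
    simpa using this
  rw [← Real.exp_add]
  rcases le_total |(u.1 : ℝ)| |(u.2 : ℝ)| with h | h
  · refine (h2 u).trans (mul_le_mul_of_nonneg_left (Real.exp_le_exp.mpr ?_) hC)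
    nlinarith
  · refine (h1 u).trans (mul_le_mul_of_nonneg_left (Real.exp_le_exp.mpr ?_) hC)
    nlinarith

lemma mean_tsum {ι : Type*} [Countable ι] {F : ι → ℝ → ℂ} {b : ι → ℝ} (hF : ∀ i, Continuous (F i))
    (hb : ∀ i t, ‖F i t‖ ≤ b i) (hs : Summable b) :
    (mean fun t => ∑' i, F i t) = ∑' i, mean (F i) := by
  have := intervalIntegral.hasSum_intervalIntegral_of_summable_norm (a := 0) (b := 2 * Real.pi)
    (f := fun i => (⟨F i, hF i⟩ : C(ℝ, ℂ))) (Summable.of_nonneg_of_le (fun _ => norm_nonneg _)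
      (fun i => (ContinuousMap.norm_le _ ((norm_nonneg _).trans (hb i 0))).mpr fun t => hb i t) hs)
  have h := this.tsum_eq
  simp only [ContinuousMap.coe_mk] at h
  rw [mean, ← h, ← tsum_mul_left]
  rfl

lemma continuous_evalAt_exp (f : Laurent) : Continuous fun x : (ℝ × ℝ) × (ℝ × ℝ) =>
    evalAt f (Real.exp x.1.1 * circ x.2.1) (Real.exp x.1.2 * circ x.2.2) := by
  have hc : Continuous circ := continuous_circ
  have hne (b t : ℝ) : (Real.exp b : ℂ) * circ t ≠ 0 := by
    rw [← norm_pos_iff, norm_exp_mul_circ]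
    exact Real.exp_pos b
  induction f using laurent_induction with
  | mono u =>
    simp_rw [evalAt_mono]
    refine Continuous.mul ?_ ?_
    · refine Continuous.zpow₀ ?_ _ fun x => Or.inl (hne _ _)
      exact (Complex.continuous_ofReal.comp (Real.continuous_exp.comp (by fun_prop))).mul
        (hc.comp (by fun_prop))
    · refine Continuous.zpow₀ ?_ _ fun x => Or.inl (hne _ _)
      exact (Complex.continuous_ofReal.comp (Real.continuous_exp.comp (by fun_prop))).mul
        (hc.comp (by fun_prop))
  | add f g hf hg =>
    simp_rw [evalAt_add]
    exact hf.add hg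
  | smul a f hf =>
    simp_rw [evalAt_smul]
    exact continuous_const.mul hf

lemma exists_circ_Icc (t : ℝ) : ∃ s ∈ Set.Icc (-Real.pi) Real.pi, circ s = circ t := by
  refine ⟨(circ t).arg, ⟨(Complex.neg_pi_lt_arg _).le, Complex.arg_le_pi _⟩, ?_⟩
  have := Complex.norm_mul_exp_arg_mul_I (circ t)
  rwa [norm_circ, Complex.ofReal_one, one_mul] at this

/-- A Laurent polynomial without zeros on the torus is bounded below near the torus. -/
lemma exists_annulus {p : Laurent} (hp : ∀ z w : ℂ, ‖z‖ = 1 → ‖w‖ = 1 → evalAt p z w ≠ 0) :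
    ∃ ε C : ℝ, 0 < ε ∧ ∀ a b : ℝ, |a| ≤ ε → |b| ≤ ε → ∀ s t : ℝ,
      evalAt p (Real.exp a * circ s) (Real.exp b * circ t) ≠ 0 ∧
      ‖(evalAt p (Real.exp a * circ s) (Real.exp b * circ t))⁻¹‖ ≤ C := by
  have hc := continuous_evalAt_exp p
  have hK : IsCompact (Set.Icc (-Real.pi) Real.pi ×ˢ Set.Icc (-Real.pi) Real.pi) :=
    isCompact_Icc.prod isCompact_Icc
  have h1 := hK.eventually_forall_of_forall_eventually (x₀ := ((0, 0) : ℝ × ℝ))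
    (P := fun x y => evalAt p (Real.exp x.1 * circ y.1) (Real.exp x.2 * circ y.2) ≠ 0)
    fun y _ => hc.continuousAt.eventually_ne (by
      simpa using hp _ _ (norm_circ y.1) (norm_circ y.2))
  obtain ⟨δ, hδ, hδ'⟩ := Metric.eventually_nhds_iff.mp h1
  have hne (a b : ℝ) (ha : |a| ≤ δ / 2) (hb : |b| ≤ δ / 2) (s t : ℝ) :
      evalAt p (Real.exp a * circ s) (Real.exp b * circ t) ≠ 0 := by
    obtain ⟨s', hs', hs⟩ := exists_circ_Icc s
    obtain ⟨t', ht', ht⟩ := exists_circ_Icc t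
    rw [← hs, ← ht]
    refine hδ' (y := (a, b)) ?_ (s', t') ⟨hs', ht'⟩
    rw [Prod.dist_eq, Real.dist_eq, Real.dist_eq, sub_zero, sub_zero]
    exact max_lt (by linarith) (by linarith)
  have hK' : IsCompact ((Set.Icc (-(δ / 2)) (δ / 2) ×ˢ Set.Icc (-(δ / 2)) (δ / 2)) ×ˢ
      (Set.Icc (-Real.pi) Real.pi ×ˢ Set.Icc (-Real.pi) Real.pi)) :=
    (isCompact_Icc.prod isCompact_Icc).prod hK
  obtain ⟨C, hC⟩ := hK'.exists_bound_of_continuousOn (f := fun x : (ℝ × ℝ) × (ℝ × ℝ) =>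
    (evalAt p (Real.exp x.1.1 * circ x.2.1) (Real.exp x.1.2 * circ x.2.2))⁻¹)
    (hc.continuousOn.inv₀ fun x hx =>
      hne _ _ (abs_le.mpr hx.1.1) (abs_le.mpr hx.1.2) _ _)
  refine ⟨δ / 2, C, half_pos hδ, fun a b ha hb s t => ⟨hne a b ha hb s t, ?_⟩⟩
  obtain ⟨s', hs', hs⟩ := exists_circ_Icc s
  obtain ⟨t', ht', ht⟩ := exists_circ_Icc t
  rw [← hs, ← ht]
  exact hC ((a, b), (s', t')) ⟨⟨abs_le.mp ha, abs_le.mp hb⟩, hs', ht'⟩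

end EAR

end

/-! ### The Fourier coefficients of the reciprocal form a factorization -/

noncomputable section

namespace EAR

open MeasureTheory Filter Topology
open scoped ComplexConjugate Pointwise ENNReal

lemma differentiableAt_evalAt_left (p : Laurent) {z : ℂ} (hz : z ≠ 0) (w : ℂ) :
    DifferentiableAt ℂ (fun z => evalAt p z w) z := by
  induction p using laurent_induction with
  | mono u =>
    simp_rw [evalAt_mono]
    exact (differentiableAt_zpow.mpr (Or.inl hz)).mul_const _
  | add f g hf hg =>
    simp_rw [evalAt_add]
    exact hf.add hg
  | smul a f hf =>
    simp_rw [evalAt_smul]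
    exact hf.const_mul a

lemma differentiableAt_evalAt_right (p : Laurent) (z : ℂ) {w : ℂ} (hw : w ≠ 0) :
    DifferentiableAt ℂ (fun w => evalAt p z w) w := by
  induction p using laurent_induction with
  | mono u =>
    simp_rw [evalAt_mono]
    exact (differentiableAt_zpow.mpr (Or.inl hw)).const_mul _
  | add f g hf hg =>
    simp_rw [evalAt_add]
    exact hf.add hg
  | smul a f hf =>
    simp_rw [evalAt_smul]
    exact hf.const_mul a

/-- The Fourier coefficients of `1 / p`. -/
def recip (p : Laurent) (u : ℤ × ℤ) : ℂ :=
  mean fun s => mean fun t =>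
    circ s ^ (-u.1) * (circ t ^ (-u.2) * (evalAt p (circ s) (circ t))⁻¹)

lemma continuous_recip {p : Laurent} (hp : ∀ z w : ℂ, ‖z‖ = 1 → ‖w‖ = 1 → evalAt p z w ≠ 0)
    (u : ℤ × ℤ) : Continuous fun x : ℝ × ℝ =>
      circ x.1 ^ (-u.1) * (circ x.2 ^ (-u.2) * (evalAt p (circ x.1) (circ x.2))⁻¹) := by
  refine ((continuous_circ_zpow _).comp continuous_fst).mul
    (((continuous_circ_zpow _).comp continuous_snd).mul ?_)
  exact (continuous_evalAt_circ p).inv₀ fun x => hp _ _ (norm_circ _) (norm_circ _)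

/-- The reciprocal stays holomorphic and bounded when either variable moves in a thin annulus, which
gives exponential decay in each index separately. -/
lemma summable_recip {p : Laurent} (hp : ∀ z w : ℂ, ‖z‖ = 1 → ‖w‖ = 1 → evalAt p z w ≠ 0) :
    Summable fun u => ‖recip p u‖ := by
  obtain ⟨ε, C, hε, hA⟩ := exists_annulus hp
  have hne (b t : ℝ) : (Real.exp b : ℂ) * circ t ≠ 0 := by
    rw [← norm_pos_iff, norm_exp_mul_circ]
    exact Real.exp_pos b
  have hA1 (s a t : ℝ) (ha : |a| ≤ ε) : evalAt p (circ s) (Real.exp a * circ t) ≠ 0 ∧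
      ‖(evalAt p (circ s) (Real.exp a * circ t))⁻¹‖ ≤ C := by
    simpa using hA 0 a (by simpa using hε.le) ha s t
  have hA2 (t a s : ℝ) (ha : |a| ≤ ε) : evalAt p (Real.exp a * circ s) (circ t) ≠ 0 ∧
      ‖(evalAt p (Real.exp a * circ s) (circ t))⁻¹‖ ≤ C := by
    simpa using hA a 0 ha (by simpa using hε.le) s t
  refine summable_of_exp_bound (C := C) hε (fun u => ?_) (fun u => ?_)
  · rw [recip, mean_swap (continuous_recip hp u)]
    refine norm_mean_le fun t => ?_
    have e : (mean fun s => circ s ^ (-u.1) * (circ t ^ (-u.2) *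
        (evalAt p (circ s) (circ t))⁻¹)) =
        circ t ^ (-u.2) * mean fun s => circ s ^ (-u.1) * (evalAt p (circ s) (circ t))⁻¹ := by
      rw [← mean_const_mul]
      congr 1 with s
      ring
    rw [e, norm_mul, norm_zpow, norm_circ, one_zpow, one_mul]
    exact norm_mean_zpow_mul_le (g := fun z => (evalAt p z (circ t))⁻¹) hε.le
      (fun b s hb => (differentiableAt_evalAt_left p (hne b s) _).inv (hA2 t b s hb).1)
      (fun b s hb => (hA2 t b s hb).2) u.1
  · refine norm_mean_le fun s => ?_
    rw [mean_const_mul, norm_mul, norm_zpow, norm_circ, one_zpow, one_mul]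
    exact norm_mean_zpow_mul_le (g := fun w => (evalAt p (circ s) w)⁻¹) hε.le
      (fun b t hb => (differentiableAt_evalAt_right p _ (hne b t)).inv (hA1 s b t hb).1)
      (fun b t hb => (hA1 s b t hb).2) u.2

lemma conv_recip {p : Laurent} (hp : ∀ z w : ℂ, ‖z‖ = 1 → ‖w‖ = 1 → evalAt p z w ≠ 0)
    (u : ℤ × ℤ) : conv p (recip p) u = if u = 0 then 1 else 0 := by
  have hc (u : ℤ × ℤ) (s : ℝ) : Continuous fun t =>
      circ s ^ (-u.1) * (circ t ^ (-u.2) * (evalAt p (circ s) (circ t))⁻¹) := by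
    have h : Continuous fun t : ℝ => (s, t) := by fun_prop
    simpa only [Function.comp_def] using (continuous_recip hp u).comp h
  have hc' (u : ℤ × ℤ) : Continuous fun s => mean fun t =>
      circ s ^ (-u.1) * (circ t ^ (-u.2) * (evalAt p (circ s) (circ t))⁻¹) :=
    continuous_mean (F := fun s t =>
      circ s ^ (-u.1) * (circ t ^ (-u.2) * (evalAt p (circ s) (circ t))⁻¹)) (continuous_recip hp u)
  have e : conv p (recip p) u = mean fun s => mean fun t => circ s ^ (-u.1) * circ t ^ (-u.2) := by
    rw [conv, Finsupp.sum]
    simp_rw [recip, ← mean_const_mul]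
    rw [← mean_sum _ fun k _ => ?_]
    · congr 1 with s
      rw [← mean_sum _ fun k _ => (hc _ _).const_mul _]
      congr 1 with t
      have e1 : ∀ k : ℤ × ℤ, p.coeff k * (circ s ^ (-(u - k).1) * (circ t ^ (-(u - k).2) *
          (evalAt p (circ s) (circ t))⁻¹)) = (p.coeff k * circ s ^ k.1 * circ t ^ k.2) *
          (circ s ^ (-u.1) * circ t ^ (-u.2) * (evalAt p (circ s) (circ t))⁻¹) := by
        intro k
        rw [Prod.fst_sub, Prod.snd_sub, neg_sub, neg_sub, sub_eq_add_neg, sub_eq_add_neg,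
          zpow_add₀ (circ_ne_zero s), zpow_add₀ (circ_ne_zero t)]
        ring
      simp_rw [e1]
      rw [← Finset.sum_mul]
      change evalAt p (circ s) (circ t) * _ = _
      rw [mul_comm, inv_mul_cancel_right₀ (hp _ _ (norm_circ s) (norm_circ t))]
    · simp_rw [mean_const_mul (p.coeff k)]
      exact (hc' _).const_mul _
  rw [e]
  simp_rw [mean_const_mul, mean_circ_zpow]
  rw [mean_mul_const, mean_circ_zpow]
  simp only [neg_eq_zero, Prod.ext_iff, Prod.fst_zero, Prod.snd_zero]
  split_ifs <;> simp_all

/-- The Fourier series of `1 / p` on the torus. -/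
lemma tsum_recip {p : Laurent} (hp : ∀ z w : ℂ, ‖z‖ = 1 → ‖w‖ = 1 → evalAt p z w ≠ 0)
    {z w : ℂ} (hz : ‖z‖ = 1) (hw : ‖w‖ = 1) :
    ∑' j, recip p j * (z ^ j.1 * w ^ j.2) = (evalAt p z w)⁻¹ := by
  have hz0 : z ≠ 0 := by rintro rfl; simp at hz
  have hw0 : w ≠ 0 := by rintro rfl; simp at hw
  have hs (k : ℤ × ℤ) : Summable fun v : ℤ × ℤ =>
      p.coeff k * (recip p (v - k) * (z ^ v.1 * w ^ v.2)) := by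
    refine Summable.mul_left _ (Summable.of_norm ?_)
    refine ((Equiv.subRight k).summable_iff.mpr (summable_recip hp)).congr fun v => ?_
    simp [hz, hw]
  refine eq_inv_of_mul_eq_one_right ?_
  rw [evalAt, Finsupp.sum, Finset.sum_mul]
  have e (k : ℤ × ℤ) : p.coeff k * z ^ k.1 * w ^ k.2 * ∑' j, recip p j * (z ^ j.1 * w ^ j.2) =
      ∑' v : ℤ × ℤ, p.coeff k * (recip p (v - k) * (z ^ v.1 * w ^ v.2)) := by
    rw [← tsum_mul_left, ← (Equiv.addRight k).tsum_eq fun v : ℤ × ℤ =>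
      p.coeff k * (recip p (v - k) * (z ^ v.1 * w ^ v.2))]
    refine tsum_congr fun j => ?_
    rw [Equiv.coe_addRight, add_sub_cancel_right, Prod.fst_add, Prod.snd_add, zpow_add₀ hz0,
      zpow_add₀ hw0]
    ring
  simp_rw [e]
  rw [← Summable.tsum_finsetSum fun k _ => hs k, tsum_eq_single 0]
  · have := conv_recip hp 0
    rw [if_pos rfl, conv, Finsupp.sum] at this
    simpa using this
  · intro v hv
    have := conv_recip hp v
    rw [if_neg hv, conv, Finsupp.sum] at this
    simp_rw [← mul_assoc]
    rw [← Finset.sum_mul, ← Finset.sum_mul, this, zero_mul, zero_mul]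

/-- Parseval's identity: one factor of `1 / |p|²` is expanded in its absolutely convergent Fourier
series and integrated term by term. -/
lemma mean_mean_norm_sq {p : Laurent}
    (hp : ∀ z w : ℂ, ‖z‖ = 1 → ‖w‖ = 1 → evalAt p z w ≠ 0) (u : ℤ × ℤ) :
    (mean fun s => mean fun t => circ s ^ (-u.1) * circ t ^ (-u.2) /
      ((‖evalAt p (circ s) (circ t)‖ ^ 2 : ℝ) : ℂ)) =
      ∑' j, conj (recip p j) * recip p (j + u) := by
  obtain ⟨ε, C, hε, hA⟩ := exists_annulus hp
  have hC (s t : ℝ) : ‖(evalAt p (circ s) (circ t))⁻¹‖ ≤ C := by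
    simpa using (hA 0 0 (by simpa using hε.le) (by simpa using hε.le) s t).2
  set F : ℤ × ℤ → ℝ → ℝ → ℂ := fun j s t => conj (recip p j) *
    (circ s ^ (-(j + u).1) * (circ t ^ (-(j + u).2) * (evalAt p (circ s) (circ t))⁻¹)) with hF
  have hpt (s t : ℝ) : circ s ^ (-u.1) * circ t ^ (-u.2) /
      ((‖evalAt p (circ s) (circ t)‖ ^ 2 : ℝ) : ℂ) = ∑' j, F j s t := by
    have h1 := congrArg conj (tsum_recip hp (norm_circ s) (norm_circ t))
    rw [Complex.conj_tsum, map_inv₀] at h1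
    have h2 (j : ℤ × ℤ) : F j s t = conj (recip p j * (circ s ^ j.1 * circ t ^ j.2)) *
        (circ s ^ (-u.1) * circ t ^ (-u.2) * (evalAt p (circ s) (circ t))⁻¹) := by
      simp only [hF]
      rw [map_mul, map_mul, conj_zpow_of_norm_one (norm_circ s),
        conj_zpow_of_norm_one (norm_circ t), Prod.fst_add, Prod.snd_add, neg_add, neg_add,
        zpow_add₀ (circ_ne_zero s), zpow_add₀ (circ_ne_zero t)]
      ring
    simp_rw [h2]
    rw [tsum_mul_right, h1, ← Complex.normSq_eq_norm_sq, ← Complex.mul_conj, div_eq_mul_inv,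
      mul_inv]
    ring
  have hb (j : ℤ × ℤ) (s t : ℝ) : ‖F j s t‖ ≤ ‖recip p j‖ * C := by
    simp only [hF]
    rw [norm_mul, norm_mul, norm_mul, norm_zpow, norm_zpow, norm_circ, norm_circ, one_zpow,
      one_zpow, one_mul, one_mul, RCLike.norm_conj]
    exact mul_le_mul_of_nonneg_left (hC s t) (norm_nonneg _)
  have hs := (summable_recip hp).mul_right C
  have hc (j : ℤ × ℤ) : Continuous fun x : ℝ × ℝ => F j x.1 x.2 :=
    (continuous_recip hp (j + u)).const_mul _
  have hc' (j : ℤ × ℤ) (s : ℝ) : Continuous fun t => F j s t := by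
    have h : Continuous fun t : ℝ => (s, t) := by fun_prop
    simpa only [Function.comp_def] using (hc j).comp h
  simp_rw [hpt]
  have e1 (s : ℝ) : (mean fun t => ∑' j, F j s t) = ∑' j, mean (F j s) :=
    mean_tsum (hc' · s) (fun j t => hb j s t) hs
  simp_rw [e1]
  rw [mean_tsum (F := fun j s => mean (F j s)) (fun j => continuous_mean (hc j))
    (fun j s => norm_mean_le (hb j s)) hs]
  refine tsum_congr fun j => ?_
  simp only [hF]
  simp_rw [mean_const_mul (conj (recip p j))]
  rfl

/-- For fixed `z` on the circle, `1 / p(z, ·)` is holomorphic on the closed disk and has no negative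
Fourier coefficients. -/
lemma recip_eq_zero {n m : ℕ} {p : Laurent} (hpm : p ∈ P n m)
    (hp : ∀ z w : ℂ, ‖z‖ = 1 → ‖w‖ ≤ 1 → evalAt p z w ≠ 0) {u : ℤ × ℤ} (hu : u.2 < 0) :
    recip p u = 0 := by
  have e (s : ℝ) : (mean fun t =>
      circ s ^ (-u.1) * (circ t ^ (-u.2) * (evalAt p (circ s) (circ t))⁻¹)) = 0 := by
    rw [mean_const_mul]
    have := mean_zpow_div_pol (m := m) (a := fun i => rowEval (circ s) i p) (fun w hw => by
      rw [← evalAt_eq_pol hpm]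
      exact hp _ _ (norm_circ s) hw) (k := -u.2) (by omega)
    simp_rw [← evalAt_eq_pol hpm, div_eq_mul_inv] at this
    rw [this, mul_zero]
  rw [recip]
  simp_rw [e]
  exact mean_const 0

theorem isFactor_recip {n m : ℕ} {c : ℤ × ℤ → ℂ} {p : Laurent} (hpm : p ∈ P n m)
    (hp : ∀ z w : ℂ, ‖z‖ = 1 → ‖w‖ ≤ 1 → evalAt p z w ≠ 0)
    (hT : ∀ (u : ℤ × ℤ) (hu : u ∈ Set.Icc (-(n : ℤ), -(m : ℤ)) (n, m)),
      fourierForm n m c ⟨mono u, mono_mem_L hu⟩ =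
        ((2 * Real.pi : ℝ) : ℂ)⁻¹ ^ 2 * ∫ s in (0 : ℝ)..2 * Real.pi, ∫ t in (0 : ℝ)..2 * Real.pi,
          circ s ^ u.1 * circ t ^ u.2 / ((‖evalAt p (circ s) (circ t)‖ ^ 2 : ℝ) : ℂ)) :
    IsFactor n m c p (recip p) := by
  have hp' : ∀ z w : ℂ, ‖z‖ = 1 → ‖w‖ = 1 → evalAt p z w ≠ 0 := fun z w hz hw => hp z w hz hw.le
  refine ⟨hpm, summable_recip hp', fun u hu => recip_eq_zero hpm hp hu, conv_recip hp',
    fun u hu => ?_⟩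
  have hu' : -u ∈ Set.Icc (-(n : ℤ), -(m : ℤ)) (n, m) := by
    simp only [Set.mem_Icc, Prod.le_def, Prod.fst_neg, Prod.snd_neg] at *
    omega
  have := hT (-u) hu'
  rw [fourierForm_mono, mean_mean] at this
  rw [this, ← mean_mean_norm_sq hp']
  rfl

/-- Averaging over `w` evaluates `1 / p` at `w = 0`. The result `1 / p(z, 0)` is holomorphic in the
closed disk. -/
lemma recip_row_eq_zero {n m : ℕ} {p : Laurent} (hpm : p ∈ P n m)
    (hp : ∀ z w : ℂ, ‖z‖ = 1 → ‖w‖ ≤ 1 → evalAt p z w ≠ 0)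
    (hp0 : ∀ z : ℂ, ‖z‖ ≤ 1 → evalAt p z 0 ≠ 0) {k : ℤ} (hk : k < 0) : recip p (k, 0) = 0 := by
  have e (s : ℝ) : (mean fun t =>
      circ s ^ (-k) * (circ t ^ (-(0 : ℤ)) * (evalAt p (circ s) (circ t))⁻¹)) =
      circ s ^ (-k) * (evalAt p (circ s) 0)⁻¹ := by
    rw [mean_const_mul]
    have := mean_eq_apply_zero (diffContOnCl_div_pol (m := m)
      (a := fun i => rowEval (circ s) i p) (fun w hw => by
        rw [← evalAt_eq_pol hpm]
        exact hp _ _ (norm_circ s) hw) (f := fun _ => 1) (differentiable_const _))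
    simp_rw [← evalAt_eq_pol hpm, one_div] at this
    simp_rw [neg_zero, zpow_zero, one_mul]
    rw [this]
  have hd : Differentiable ℂ fun z => evalAt p z 0 := by
    have (z : ℂ) : evalAt p z 0 = ∑ u ∈ Lam n m, p.coeff u * z ^ u.1.toNat * 0 ^ u.2 := by
      rw [evalAt, Finsupp.sum_of_support_subset (s := Lam n m)]
      · refine Finset.sum_congr rfl fun u hu => ?_
        have : 0 ≤ u.1 := (Finset.mem_Icc.mp hu).1.1
        rw [← zpow_natCast, Int.toNat_of_nonneg this]
      · intro u hu
        by_contra h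
        refine (Finsupp.mem_support_iff.mp hu) (mem_P_iff.mp hpm u ?_)
        simpa [Lam] using h
      · simp
    simp_rw [this]
    fun_prop
  obtain ⟨j, rfl⟩ : ∃ j : ℕ, k = -j := ⟨k.natAbs, by omega⟩
  rw [recip]
  simp only
  simp_rw [e, neg_neg, zpow_natCast]
  rw [mean_eq_apply_zero (f := fun z => z ^ j * (evalAt p z 0)⁻¹), zero_pow (by omega), zero_mul]
  refine DifferentiableOn.diffContOnCl_ball (U := Metric.closedBall 0 1) ?_ subset_rfl
  refine (differentiable_pow j).differentiableOn.mul (hd.differentiableOn.inv fun z hz => hp0 z ?_)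
  simpa using hz

end EAR

end

/-! ### From the operator conditions to the polynomial -/

noncomputable section

namespace EAR

open MeasureTheory Filter Topology
open scoped ComplexConjugate Pointwise

lemma evalAt_zero_right {n m : ℕ} {f : Laurent} (hf : f ∈ P n m) (z : ℂ) :
    evalAt f z 0 = ∑ i ∈ Finset.range (n + 1), f.coeff ((i : ℤ), 0) * z ^ i := by
  induction hf using Submodule.span_induction with
  | zero => simp [evalAt_eq_liftMono]
  | add x y _ _ hx hy =>
    rw [evalAt_add, hx, hy, ← Finset.sum_add_distrib]
    refine Finset.sum_congr rfl fun i _ => ?_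
    rw [AddMonoidAlgebra.coeff_add, Finsupp.add_apply, add_mul]
  | smul a x _ hx =>
    rw [evalAt_smul, hx, Finset.mul_sum]
    refine Finset.sum_congr rfl fun i _ => ?_
    rw [AddMonoidAlgebra.coeff_smul, Finsupp.smul_apply, smul_eq_mul, mul_assoc]
  | mem x hx =>
    obtain ⟨⟨u1, u2⟩, hu, rfl⟩ := hx
    simp only [Set.mem_Icc, Prod.le_def] at hu
    obtain ⟨j, rfl⟩ : ∃ j : ℕ, u1 = j := ⟨u1.toNat, by omega⟩
    simp_rw [evalAt_mono, mono_coeff, Prod.mk.injEq]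
    by_cases h2 : u2 = 0
    · rw [Finset.sum_eq_single j]
      · simp [h2]
      · intro i _ hi
        rw [if_neg, zero_mul]
        rintro ⟨h, -⟩
        exact hi (by exact_mod_cast h.symm)
      · simp only [Finset.mem_range]
        omega
    · simp [h2, zero_zpow]

section Form

variable {n m : ℕ} {T : L n m →ₗ[ℂ] ℂ} {hT : IsPositive T}

theorem bernsteinSzego_of_splitShift (h : SplitShift hT) : BernsteinSzego T := by
  obtain ⟨K₁, K₂, ⟨h12, hsup⟩, hz, h1, h2⟩ := h
  obtain ⟨p, -, hp1, hp2, hp3⟩ := exists_unit_of_split hT h12 hsup hz h1 h2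
  have hp := fibreRecursion_of_split hT h12 hsup hz hp1 hp2 hp3
  exact ⟨toLaurent hT p, toLaurent_mem hT p, fun z w hz hw => hp.evalAt_ne_zero hz hw, hp.moments⟩

/-- The division of `p(z, 0)` by `z - z₀`. -/
lemma exists_quotient {p : HT T hT} {z₀ : ℂ} (h0 : evalAt (toLaurent hT p) z₀ 0 = 0) :
    ∃ f ∈ E1 hT ((n : ℤ) - 1) m, ∀ i : ℤ,
      cf hT (i, 0) p = cf hT (i - 1, 0) f - z₀ * cf hT (i, 0) f := by
  set q : Polynomial ℂ := ∑ i ∈ Finset.range (n + 1),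
    Polynomial.C (cf hT ((i : ℤ), 0) p) * Polynomial.X ^ i with hq
  have hqc (j : ℕ) : q.coeff j = cf hT ((j : ℤ), 0) p := by
    simp only [hq, Polynomial.finsetSum_coeff, Polynomial.coeff_C_mul, Polynomial.coeff_X_pow,
      mul_ite, mul_one, mul_zero, Finset.sum_ite_eq, Finset.mem_range]
    split_ifs with h
    · rfl
    · refine (cf_eq_zero hT p ?_).symm
      simp only [Set.mem_Icc, Prod.le_def]
      omega
  have hroot : q.IsRoot z₀ := by
    rw [evalAt_zero_right (toLaurent_mem hT p)] at h0
    rw [Polynomial.IsRoot, hq, Polynomial.eval_finsetSum, ← h0]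
    refine Finset.sum_congr rfl fun i _ => ?_
    simp [cf_apply]
  set g := q /ₘ (Polynomial.X - Polynomial.C z₀) with hg
  have hmul : (Polynomial.X - Polynomial.C z₀) * g = q :=
    Polynomial.mul_divByMonic_eq_iff_isRoot.mpr hroot
  have hgc (j : ℕ) (hj : n ≤ j) : g.coeff j = 0 := by
    by_cases hq0 : q = 0
    · rw [hg, hq0, Polynomial.zero_divByMonic, Polynomial.coeff_zero]
    · refine Polynomial.coeff_eq_zero_of_degree_lt ?_
      have h1 := Polynomial.degree_divByMonic_lt q (Polynomial.X - Polynomial.C z₀) hq0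
        (by rw [Polynomial.degree_X_sub_C]; exact zero_lt_one)
      have h2 : q.degree < ((n + 1 : ℕ) : WithBot ℕ) := by
        rw [Polynomial.degree_lt_iff_coeff_zero]
        intro i hi
        rw [hqc]
        refine cf_eq_zero hT p ?_
        simp only [Set.mem_Icc, Prod.le_def]
        omega
      have h3 : g.degree < n := lt_of_lt_of_le h1 (Order.lt_succ_iff.mp (by exact_mod_cast h2))
      exact h3.trans_le (by exact_mod_cast hj)
  set G : Laurent := ∑ i ∈ Finset.range n, g.coeff i • mono ((i : ℤ), 0) with hG
  have hGP {k : ℤ} (hk : (n : ℤ) - 1 ≤ k) : G ∈ P k m := by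
    refine Submodule.sum_mem _ fun i hi => Submodule.smul_mem _ _ (mono_mem_P ?_)
    rw [Finset.mem_range] at hi
    simp only [Set.mem_Icc, Prod.le_def]
    omega
  obtain ⟨f, hf, hfc⟩ := exists_mem_E1 hT (k := (n : ℤ) - 1) (l := m) (by omega) le_rfl
    (g := ofLaurent hT G (hGP (by omega))) (hGP le_rfl)
  have hGc (i : ℕ) : G.coeff ((i : ℤ), 0) = g.coeff i := by
    rw [hG, AddMonoidAlgebra.coeff_sum, Finsupp.finsetSum_apply]
    simp only [AddMonoidAlgebra.coeff_smul, Finsupp.smul_apply, mono_coeff, smul_eq_mul, mul_ite,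
      mul_one, mul_zero, Prod.mk.injEq, and_true, Nat.cast_inj, Finset.sum_ite_eq',
      Finset.mem_range]
    split_ifs with h
    · rfl
    · exact (hgc i (by omega)).symm
  have hneg (i : ℤ) (hi : i < 0) (x : HT T hT) : cf hT (i, 0) x = 0 := by
    refine cf_eq_zero hT x ?_
    simp only [Set.mem_Icc, Prod.le_def]
    omega
  refine ⟨f, hf, fun i => ?_⟩
  rcases lt_trichotomy i 0 with hi | rfl | hi
  · rw [hneg i hi, hneg i hi, hneg (i - 1) (by omega)]
    ring
  · have := hqc 0
    rw [← hmul, sub_mul, Polynomial.coeff_sub, Polynomial.coeff_X_mul_zero,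
      Polynomial.coeff_C_mul] at this
    rw [hneg (0 - 1) (by omega), hfc, cf_apply hT _ (ofLaurent hT G _), toLaurent_ofLaurent]
    have h0 := hGc 0
    rw [Nat.cast_zero] at this h0
    rw [h0, ← this]
  · obtain ⟨j, rfl⟩ : ∃ j : ℕ, i = (j + 1 : ℕ) := ⟨(i - 1).toNat, by omega⟩
    have := hqc (j + 1)
    rw [← hmul, sub_mul, Polynomial.coeff_sub, Polynomial.coeff_X_mul,
      Polynomial.coeff_C_mul] at this
    rw [hfc, hfc, cf_apply hT _ (ofLaurent hT G _), cf_apply hT _ (ofLaurent hT G _),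
      toLaurent_ofLaurent, hGc, ← this]
    have e : (((j + 1 : ℕ) : ℤ) - 1) = (j : ℤ) := by push_cast; ring
    rw [e, hGc]

/-- A zero `z₀` lets one write `p(z, 0) = (z - z₀) f(z, 0)` with `f` in `E¹_{n-1,m}`. Comparing
norms in the orthogonal relations between `p`, `z f` and `r` gives `|z₀|² ‖f‖² = ‖r‖² + 1 + ‖f‖²`,
so `|z₀| > 1`. -/
lemma evalAt_zero_right_ne_zero (h : ∀ f ∈ E1 hT ((n : ℤ) - 1) m, sh hT (1, 0) f ∈ E1 hT n m)
    {p : HT T hT} (hp : p ∈ E1 hT n m) (hp1 : inner ℂ p p = (1 : ℂ))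
    (hp2 : ∀ f ∈ E1 hT ((n : ℤ) - 1) m, inner ℂ p (sh hT (1, 0) f) = 0) {z₀ : ℂ}
    (hz₀ : ‖z₀‖ ≤ 1) : evalAt (toLaurent hT p) z₀ 0 ≠ 0 := by
  intro h0
  obtain ⟨f, hf, hfc⟩ := exists_quotient h0
  have hfp : f ∈ polys hT ((n : ℤ) - 1) m := ((mem_E1_iff hT).mp hf).1
  set zf := sh hT (1, 0) f with hzf
  -- The terms of degree `0` in `w` cancel, so `r` is divisible by `w` and orthogonal to `p - z f`,
  -- which lies in `E¹_{n,m}`.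
  set r := p - zf + z₀ • f with hr
  have hE : p - zf ∈ E1 hT n m := Submodule.sub_mem _ hp (h f hf)
  have hrw : r ∈ shift hT (0, 1) (polys hT n ((m : ℤ) - 1)) := by
    rw [mem_shift_w_iff hT le_rfl le_rfl]
    refine ⟨toLaurent_mem hT r, fun i => ?_⟩
    rw [hr, map_add, map_sub, map_smul, hzf, cf_sh_of_mem hT (k := (n : ℤ) - 1) (l := m) (by simp)
      (by simp) (by simp) hfp, hfc i, smul_eq_mul]
    simp
  have hort : inner ℂ r (p - zf) = 0 := ((mem_E1_iff hT).mp hE).2 r hrw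
  have e1 : z₀ • f = r - (p - zf) := by rw [hr]; abel
  have hpyth {x y : HT T hT} (hxy : inner ℂ x y = (0 : ℂ)) : ‖x - y‖ ^ 2 = ‖x‖ ^ 2 + ‖y‖ ^ 2 := by
    rw [@norm_sub_sq ℂ, hxy]
    simp
  have e2 := hpyth hort
  have e3 := hpyth (hp2 f hf)
  have e4 : ‖zf‖ = ‖f‖ := norm_sh_z hT hfp
  have e5 : ‖p‖ ^ 2 = 1 := by
    have := inner_self_eq_norm_sq (𝕜 := ℂ) p
    rw [hp1] at this
    simpa using this.symm
  rw [← e1, e3, e4, e5, norm_smul] at e2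
  have : (‖z₀‖ * ‖f‖) ^ 2 ≤ (1 * ‖f‖) ^ 2 := by gcongr
  nlinarith [sq_nonneg ‖r‖]

/-- If `A = 0`, the polynomial `p` has no zeros in the unit disk for `w = 0`. -/
theorem exists_of_opA_eq_zero (hA : opA hT = 0) : ∃ p ∈ P n m,
    (∀ z w : ℂ, ‖z‖ = 1 → ‖w‖ ≤ 1 → evalAt p z w ≠ 0) ∧
    (∀ z : ℂ, ‖z‖ ≤ 1 → evalAt p z 0 ≠ 0) ∧
    ∀ (u : ℤ × ℤ) (hu : u ∈ Set.Icc (-(n : ℤ), -(m : ℤ)) (n, m)),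
      T ⟨mono u, mono_mem_L hu⟩ =
        ((2 * Real.pi : ℝ) : ℂ)⁻¹ ^ 2 * ∫ s in (0 : ℝ)..2 * Real.pi, ∫ t in (0 : ℝ)..2 * Real.pi,
          circ s ^ u.1 * circ t ^ u.2 / ((‖evalAt p (circ s) (circ t)‖ ^ 2 : ℝ) : ℂ) := by
  rw [opA_eq_zero_iff_forall] at hA
  have hle : E1 hT ((n : ℤ) - 1) m ≤ polys hT ((n : ℤ) - 1) m := inf_le_left
  have hs : (⊥ : Submodule ℂ (HT T hT)) ⊔ E1 hT ((n : ℤ) - 1) m = E1 hT ((n : ℤ) - 1) m :=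
    bot_sup_eq _
  have h2 : shift hT (1, 0) (E1 hT ((n : ℤ) - 1) m) ≤ E1 hT n m := by
    rw [shift_eq_map hT (k := (n : ℤ) - 1) (l := m) (by simp) (by simp) (by simp) hle]
    rintro _ ⟨f, hf, rfl⟩
    exact hA f hf
  -- The split with `K₁ = 0` and `K₂ = E¹_{n-1,m}`. It makes `p` orthogonal to `z E¹_{n-1,m}`.
  obtain ⟨p, hp, hp1, hp2, hp3⟩ := exists_unit_of_split hT Submodule.isOrtho_bot_left hs
    Submodule.isOrtho_bot_left bot_le h2
  have hrec := fibreRecursion_of_split hT Submodule.isOrtho_bot_left hs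
    Submodule.isOrtho_bot_left hp1 hp2 hp3
  refine ⟨toLaurent hT p, toLaurent_mem hT p, fun z w hz hw => hrec.evalAt_ne_zero hz hw,
    fun z hz => evalAt_zero_right_ne_zero hA hp hp1 (fun f hf => ?_) hz, hrec.moments⟩
  refine Submodule.isOrtho_iff_inner_eq.mp hp2 p (Submodule.mem_span_singleton_self p) _ ?_
  exact Submodule.mem_sup_right (sh_mem_shift hT (k := (n : ℤ) - 1) (l := m) (by simp) (by simp)
    (by simp) hle hf)

end Form

end EAR

end

noncomputable section

namespace EAR

open MeasureTheory Filter Topology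
open scoped ComplexConjugate Pointwise ENNReal

/-! ## Autoregressive processes and factorizations -/

section Stochastic

variable {Ω : Type*} [MeasurableSpace Ω] {Pr : Measure Ω}

lemma cov_eq_inner (X Y : Lp ℂ 2 Pr) : cov Pr X Y = inner ℂ Y X := by
  rw [cov, L2.inner_def]
  simp only [RCLike.inner_apply]

lemma inner_noise {ε : ℤ × ℤ → Lp ℂ 2 Pr} (hε : IsWhiteNoise Pr ε) (u v : ℤ × ℤ) :
    inner ℂ (ε u) (ε v) = if u = v then (1 : ℂ) else 0 := by
  rw [← cov_eq_inner, hε.2]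
  simp only [eq_comm]

variable {ψ : ℤ × ℤ → ℂ} {X ε : ℤ × ℤ → Lp ℂ 2 Pr} (hε : IsWhiteNoise Pr ε)
  (hX : ∀ u, HasSum (fun k => ψ k • ε (u - k)) (X u))

include hX

lemma hasSum_inner_process (Y : Lp ℂ 2 Pr) (u : ℤ × ℤ) :
    HasSum (fun k => ψ k * inner ℂ Y (ε (u - k))) (inner ℂ Y (X u)) := by
  simpa only [Function.comp_def, innerSL_apply_apply, inner_smul_right] using
    (hX u).mapL (innerSL ℂ Y)

include hε

lemma inner_noise_process (u v : ℤ × ℤ) : inner ℂ (ε v) (X u) = ψ (u - v) := by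
  refine (hasSum_inner_process hX (ε v) u).unique ?_
  have := hasSum_single (f := fun k => ψ k * inner ℂ (ε v) (ε (u - k))) (u - v) fun k hk => ?_
  · simpa only [inner_noise hε, sub_sub_cancel, if_true, mul_one] using this
  · rw [inner_noise hε, if_neg, mul_zero]
    rintro rfl
    simp at hk

lemma cov_process (k l : ℤ × ℤ) :
    cov Pr (X k) (X l) = ∑' j, ψ j * conj (ψ (j + (l - k))) := by
  rw [cov_eq_inner, ← (hasSum_inner_process hX (X l) k).tsum_eq]
  refine tsum_congr fun j => ?_
  rw [← inner_conj_symm, inner_noise_process hε hX]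
  congr 3
  abel

end Stochastic

lemma mem_Lam_sub_Lam {n m : ℕ} {u : ℤ × ℤ} :
    u ∈ Lam n m - Lam n m ↔ u ∈ Set.Icc (-(n : ℤ), -(m : ℤ)) (n, m) := by
  simp only [Finset.mem_sub, Lam, Finset.mem_Icc, Set.mem_Icc, Prod.le_def]
  constructor
  · rintro ⟨v, hv, w, hw, rfl⟩
    simp only [Prod.fst_sub, Prod.snd_sub]
    omega
  · intro hu
    refine ⟨(max u.1 0, max u.2 0), ?_, (max (-u.1) 0, max (-u.2) 0), ?_, ?_⟩
    · simp only
      omega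
    · simp only
      omega
    · ext
      · simp only [Prod.fst_sub]
        omega
      · simp only [Prod.snd_sub]
        omega

lemma conv_eq_sum_Lam {n m : ℕ} {p : Laurent} (hp : p ∈ P n m) (F : ℤ × ℤ → ℂ) (u : ℤ × ℤ) :
    conv p F u = ∑ k ∈ Lam n m, p.coeff k * F (u - k) := by
  rw [conv, Finsupp.sum_of_support_subset (s := Lam n m)]
  · intro k hk
    by_contra h
    refine (Finsupp.mem_support_iff.mp hk) (mem_P_iff.mp hp k ?_)
    simpa [Lam] using h
  · simp

/-- A solution of the filter problem gives a factorization. -/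
lemma exists_isFactor_of_hasSolution {S : Set (ℤ × ℤ)} (hS : ∀ u ∈ S, 0 ≤ u.2) {n m : ℕ}
    {c : ℤ × ℤ → ℂ} (h : HasSolution S n m c) :
    ∃ p φ, IsFactor n m c p φ ∧ ∀ u ∉ S, φ u = 0 := by
  classical
  obtain ⟨Ω, _, Pr, _, a, X, ε, ⟨hX, hε, ha, hf⟩, ⟨ψ, hψ, hexp⟩, hc⟩ := h
  set ψ' : ℤ × ℤ → ℂ := fun k => if hk : k ∈ S then ψ ⟨k, hk⟩ else 0 with hψ'
  have hψS (k : S) : ψ' k = ψ k := dif_pos k.2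
  have hψ0 (k) (hk : k ∉ S) : ψ' k = 0 := dif_neg hk
  have hsum : Summable fun k => ‖ψ' k‖ := by
    have hsub : Function.support (fun k => ‖ψ' k‖) ⊆ S := by
      intro k hk
      by_contra hkS
      exact hk (by simp [hψ0 k hkS])
    have := hψ.hasSum
    simp_rw [← hψS] at this
    exact ((hasSum_subtype_iff_of_support_subset hsub).mp this).summable
  have hX' (u : ℤ × ℤ) : HasSum (fun k => ψ' k • ε (u - k)) (X u) := by
    rw [← hasSum_subtype_iff_of_support_subset (s := S)]
    · simpa only [Function.comp_def, hψS] using hexp u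
    · intro k hk
      by_contra hkS
      exact hk (by simp [hψ0 k hkS])
  -- Coefficients are conjugated because `E (X_0 X_u*)` is the sum of `ψ j * conj (ψ (j + u))`,
  -- whereas a factor has the conjugate on the unshifted term.
  set p : Laurent := ∑ k ∈ Lam n m, conj (a k) • mono k with hp
  have hpm : p ∈ P n m := Submodule.sum_mem _ fun k hk =>
    Submodule.smul_mem _ _ (mono_mem_P (by simpa [Lam] using hk))
  have hpc (k : ℤ × ℤ) (hk : k ∈ Lam n m) : p.coeff k = conj (a k) := by
    rw [hp, AddMonoidAlgebra.coeff_sum, Finsupp.finsetSum_apply]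
    simp only [AddMonoidAlgebra.coeff_smul, Finsupp.smul_apply, mono_coeff, smul_eq_mul, mul_ite,
      mul_one, mul_zero]
    rw [Finset.sum_ite_eq', if_pos hk]
  refine ⟨p, fun u => conj (ψ' u), ⟨hpm, by simpa using hsum, fun u hu => ?_, fun u => ?_,
    fun u hu => ?_⟩, fun u hu => by simp only [hψ0 u hu, map_zero]⟩
  · rw [hψ0, map_zero]
    intro h
    have := hS u h
    omega
  -- Pairing the filter equation with the noise at `0` turns it into the convolution identity for
  -- the expansion coefficients.
  · have h1 : inner ℂ (ε 0) (∑ k ∈ Lam n m, a k • X (u - k)) = if u = 0 then (1 : ℂ) else 0 := by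
      rw [hf u, inner_noise hε]
      simp only [eq_comm]
    rw [inner_sum] at h1
    have h2 := congrArg conj h1
    rw [map_sum, apply_ite conj, map_one, map_zero] at h2
    rw [← h2, conv_eq_sum_Lam hpm]
    refine Finset.sum_congr rfl fun k hk => ?_
    rw [hpc k hk, inner_smul_right, inner_noise_process hε hX', map_mul, sub_zero]
  · rw [← hc u (mem_Lam_sub_Lam.mpr hu), cov_process hε hX']
    simp

section Construction

/-- An injection of the index set into the nonzero integers. -/
def freq (u : ℤ × ℤ) : ℤ := (Encodable.encode u : ℤ) + 1

lemma freq_injective : Function.Injective freq := fun u v h => by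
  have : (Encodable.encode u : ℤ) = Encodable.encode v := by simpa [freq] using h
  exact Encodable.encode_injective (by exact_mod_cast this)

lemma freq_ne_zero (u : ℤ × ℤ) : freq u ≠ 0 := by
  unfold freq
  omega

/-- White noise on the circle. -/
def circleNoise (u : ℤ × ℤ) : Lp ℂ 2 (@AddCircle.haarAddCircle (1 : ℝ) _) := fourierLp 2 (freq u)

lemma integral_eq_inner_fourierLp (f : Lp ℂ 2 (@AddCircle.haarAddCircle (1 : ℝ) _)) :
    ∫ t, f t ∂AddCircle.haarAddCircle = inner ℂ (fourierLp (T := (1 : ℝ)) 2 0) f := by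
  rw [L2.inner_def]
  refine integral_congr_ae ?_
  filter_upwards [coeFn_fourierLp (T := (1 : ℝ)) 2 0] with t ht
  rw [ht]
  simp

lemma inner_fourierLp (i j : ℤ) : inner ℂ (fourierLp (T := (1 : ℝ)) 2 i) (fourierLp 2 j) =
    if i = j then (1 : ℂ) else 0 :=
  orthonormal_iff_ite.mp orthonormal_fourier i j

/-- Distinct characters are orthonormal, and a nonzero frequency is orthogonal to constants, hence
of mean zero. -/
lemma isWhiteNoise_circleNoise : IsWhiteNoise AddCircle.haarAddCircle circleNoise := by
  refine ⟨fun u => ?_, fun u v => ?_⟩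
  · rw [integral_eq_inner_fourierLp, circleNoise, inner_fourierLp, if_neg (freq_ne_zero u).symm]
  · rw [cov_eq_inner, circleNoise, circleNoise, inner_fourierLp]
    simp only [freq_injective.eq_iff, eq_comm]

end Construction

/-- A factorization gives a solution of the filter problem. -/
lemma hasSolution_of_isFactor {S : Set (ℤ × ℤ)} {n m : ℕ} {c φ : ℤ × ℤ → ℂ} {p : Laurent}
    (h : IsFactor n m c p φ) (hS : ∀ u ∉ S, φ u = 0) : HasSolution S n m c := by
  set ψ : ℤ × ℤ → ℂ := fun k => conj (φ k) with hψ
  have hψs : Summable fun k => ‖ψ k‖ := by simpa [hψ] using h.summable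
  have hε := isWhiteNoise_circleNoise
  have hnorm (u : ℤ × ℤ) : ‖circleNoise u‖ = 1 := orthonormal_fourier.1 (freq u)
  have hs (u : ℤ × ℤ) : Summable fun k => ψ k • circleNoise (u - k) := by
    refine Summable.of_norm (hψs.congr fun k => ?_)
    rw [norm_smul, hnorm, mul_one]
  set X : ℤ × ℤ → Lp ℂ 2 (@AddCircle.haarAddCircle (1 : ℝ) _) :=
    fun u => ∑' k, ψ k • circleNoise (u - k) with hXdef
  have hX (u : ℤ × ℤ) : HasSum (fun k => ψ k • circleNoise (u - k)) (X u) := (hs u).hasSum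
  refine ⟨AddCircle (1 : ℝ), inferInstance, AddCircle.haarAddCircle, inferInstance,
    fun k => conj (p.coeff k), X, circleNoise, ⟨⟨fun u => ?_, fun k l u => ?_⟩, hε, ?_, fun u => ?_⟩,
    ⟨fun k => ψ k, hψs.comp_injective Subtype.val_injective, fun u => ?_⟩, fun k hk => ?_⟩
  · rw [integral_eq_inner_fourierLp]
    refine (hasSum_inner_process hX _ u).unique ?_
    have e (k : ℤ × ℤ) : ψ k * inner ℂ (fourierLp 2 0) (circleNoise (u - k)) = 0 := by
      rw [circleNoise, inner_fourierLp, if_neg (freq_ne_zero _).symm, mul_zero]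
    simp_rw [e]
    exact hasSum_zero
  · rw [cov_process hε hX, cov_process hε hX, add_sub_add_right_eq_sub]
  -- If all `a (i, 0)` vanished, the identity `p * φ = δ` would fail at `0`, because the other terms
  -- involve `φ` at negative `w`-index.
  · by_contra! hcon
    have h1 := h.conv_eq 0
    rw [if_pos rfl, conv_eq_sum_Lam h.mem, Finset.sum_eq_zero] at h1
    · exact zero_ne_one h1
    · intro k hk
      simp only [Lam, Finset.mem_Icc, Prod.le_def] at hk
      rcases hk.1.2.lt_or_eq with h2 | h2
      · rw [h.eq_zero _ (by simpa using h2), mul_zero]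
      · have h3 := hcon k.1 hk.1.1 hk.2.1
        have h4 : (k.1, (0 : ℤ)) = k := Prod.ext rfl h2
        rw [h4, map_eq_zero] at h3
        rw [h3, zero_mul]
  -- Reindexing each delayed series by the total delay `v` makes the coefficient of the noise at `u
  -- - v` equal to the conjugate of `(p * φ)(v)`.
  · have hk (k : ℤ × ℤ) : HasSum (fun v => conj (p.coeff k) • ψ (v - k) • circleNoise (u - v))
        (conj (p.coeff k) • X (u - k)) := by
      refine HasSum.const_smul _ ?_
      rw [← (Equiv.addRight k).hasSum_iff]
      simpa only [Function.comp_def, Equiv.coe_addRight, add_sub_cancel_right,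
        sub_add_eq_sub_sub_swap] using hX (u - k)
    have h1 := hasSum_sum (s := Lam n m) fun k _ => hk k
    refine h1.unique ?_
    have e (v : ℤ × ℤ) : ∑ k ∈ Lam n m, conj (p.coeff k) • ψ (v - k) • circleNoise (u - v) =
        if v = 0 then circleNoise u else 0 := by
      have h2 := congrArg conj (h.conv_eq v)
      rw [conv_eq_sum_Lam h.mem, map_sum, apply_ite conj, map_one, map_zero] at h2
      simp_rw [smul_smul]
      rw [← Finset.sum_smul]
      simp_rw [map_mul] at h2
      rw [h2]
      split_ifs with hv
      · rw [hv, sub_zero, one_smul]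
      · rw [zero_smul]
    simp_rw [e]
    exact hasSum_ite_eq 0 (circleNoise u)
  · rw [← Function.comp_def (fun k => ψ k • circleNoise (u - k)) Subtype.val,
      hasSum_subtype_iff_of_support_subset]
    · exact hX u
    · intro k hk
      by_contra hkS
      exact hk (by simp [hψ, hS k hkS])
  · rw [cov_process hε hX, h.cov_eq k (mem_Lam_sub_Lam.mp hk)]
    simp [hψ]

lemma mem_acausalIndex_iff {u : ℤ × ℤ} : u ∈ acausalIndex ↔ 0 ≤ u.2 := by
  simp only [acausalIndex, HTilde, Set.mem_union, Set.mem_ofPred_eq]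
  omega

lemma mem_causalIndex_iff {u : ℤ × ℤ} : u ∈ causalIndex ↔ 0 < u.2 ∨ (u.2 = 0 ∧ 0 ≤ u.1) := by
  simp only [causalIndex, HTilde, Set.mem_union, Set.mem_ofPred_eq, Set.mem_singleton_iff,
    Prod.ext_iff]
  omega

end EAR

end

/-! ### Closing the circle of equivalences -/

noncomputable section

namespace EAR

theorem hasAcausalSolution_iff_isFactor {n m : ℕ} {c : ℤ × ℤ → ℂ} :
    HasAcausalSolution n m c ↔ ∃ p φ, IsFactor n m c p φ := by
  refine ⟨fun h => ?_, fun ⟨p, φ, h⟩ => hasSolution_of_isFactor h fun u hu => ?_⟩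
  · obtain ⟨p, φ, h, -⟩ :=
      exists_isFactor_of_hasSolution (fun u hu => mem_acausalIndex_iff.mp hu) h
    exact ⟨p, φ, h⟩
  · exact h.eq_zero u (not_le.mp (mt mem_acausalIndex_iff.mpr hu))

theorem hasAcausalSolution_of_bernsteinSzego {n m : ℕ} {c : ℤ × ℤ → ℂ}
    (h : BernsteinSzego (fourierForm n m c)) : HasAcausalSolution n m c := by
  obtain ⟨p, hpm, hp, hT⟩ := h
  exact hasAcausalSolution_iff_isFactor.mpr ⟨p, recip p, isFactor_recip hpm hp hT⟩

theorem hasAcausalSolution_iff_splitShift {n m : ℕ} {c : ℤ × ℤ → ℂ} : HasAcausalSolution n m c ↔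
    ∃ hT : IsPositive (fourierForm n m c), SplitShift hT := by
  refine ⟨fun h => ?_, fun ⟨_, h⟩ =>
    hasAcausalSolution_of_bernsteinSzego (bernsteinSzego_of_splitShift h)⟩
  obtain ⟨p, φ, h⟩ := hasAcausalSolution_iff_isFactor.mp h
  exact ⟨h.isPositive, h.splitShift⟩

theorem hasCausalSolution_iff {n m : ℕ} {c : ℤ × ℤ → ℂ} : HasCausalSolution n m c ↔
    ∃ hT : IsPositive (fourierForm n m c), opA hT = 0 := by
  constructor
  · intro h
    obtain ⟨p, φ, h, hφ⟩ := exists_isFactor_of_hasSolution (fun u hu => by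
      have := mem_causalIndex_iff.mp hu
      omega) h
    refine ⟨h.isPositive, h.opA_eq_zero fun k hk => hφ _ fun hk' => ?_⟩
    have := mem_causalIndex_iff.mp hk'
    simp only at this
    omega
  · rintro ⟨hT, hA⟩
    obtain ⟨p, hpm, hp, hp0, hmom⟩ := exists_of_opA_eq_zero hA
    refine hasSolution_of_isFactor (isFactor_recip hpm hp hmom) fun u hu => ?_
    rw [mem_causalIndex_iff] at hu
    obtain h | ⟨h0, h⟩ : u.2 < 0 ∨ (u.2 = 0 ∧ u.1 < 0) := by omega
    · exact recip_eq_zero hpm hp h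
    · have e : u = (u.1, 0) := Prod.ext rfl h0
      rw [e]
      exact recip_row_eq_zero hpm hp hp0 h

end EAR

end

theorem mainTheorem12 (n m : ℕ) (c : ℤ × ℤ → ℂ) :
    (EAR.HasAcausalSolution n m c ↔
      EAR.IsPositive (EAR.fourierForm n m c) ∧ EAR.BernsteinSzego (EAR.fourierForm n m c)) ∧
    (EAR.HasAcausalSolution n m c ↔
      ∃ hT : EAR.IsPositive (EAR.fourierForm n m c), EAR.SplitShift hT) ∧
    (EAR.HasAcausalSolution n m c ↔
      ∃ hT : EAR.IsPositive (EAR.fourierForm n m c), EAR.MatrixCondition hT) ∧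
    (EAR.HasAcausalSolution n m c ↔
      ∃ hT : EAR.IsPositive (EAR.fourierForm n m c), EAR.InvariantSubspaceCondition hT) ∧
    (EAR.HasCausalSolution n m c ↔
      ∃ hT : EAR.IsPositive (EAR.fourierForm n m c), EAR.opA hT = 0) := by
  have hsplit := EAR.hasAcausalSolution_iff_splitShift (n := n) (m := m) (c := c)
  have hinv : EAR.HasAcausalSolution n m c ↔
      ∃ hT : EAR.IsPositive (EAR.fourierForm n m c), EAR.InvariantSubspaceCondition hT := by
    rw [hsplit]
    exact exists_congr fun hT => ⟨EAR.invariantSubspaceCondition_of_splitShift hT,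
      EAR.splitShift_of_invariantSubspaceCondition hT⟩
  refine ⟨⟨fun h => ?_, fun h => EAR.hasAcausalSolution_of_bernsteinSzego h.2⟩, hsplit, ?_, hinv,
    EAR.hasCausalSolution_iff⟩
  · obtain ⟨hT, h⟩ := hsplit.mp h
    exact ⟨hT, EAR.bernsteinSzego_of_splitShift h⟩
  · rw [hinv]
    exact exists_congr fun hT => (EAR.matrixCondition_iff hT).symm
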